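/- **Setting.** Consider a linear system $x_{t+1}=Ax_t+Bu_t+w_t$, $y_t=Cx_t+\eta_t$, $x_0=0$, with $x_t\in\mathbb R^r$, $y_t\in\mathbb R^n$, $u_t\in\mathbb R^m$, $1\le r<n$, with independent noises $w_t\sim N(0,\Sigma_w)$, $\eta_t\sim N(0,\sigma_\eta^2I)$ ($\Sigma_w\succeq0$, $\sigma_\eta^2\ge 0$) and inputs $u_t\sim N(0,\Sigma_u)$, $\Sigma_u\succ0$, all independent. Write $\mathcal M=(r,n,m,A,B,C,\Sigma_w,\sigma_\eta^2I)$. Assume $\mathcal M$ is minimal ($(A,B)$ controllable, $(A,C)$ observable) and $\|A^i\|\le\psi_A\rho_A^{i-1}$ for all $i\ge1$, with $\psi_A\ge1$, $\rho_A\in(0,1)$. Norms of matrices are spectral norms. We observe two independent data sets $\mathcal D_k=\{y_{k,t}\}_{t=0}^{T_k}\cup\{u_{k,t}\}_{t=0}^{T_k-1}$, $k=1,2$, from this system. **Oracle.** A SYSID oracle is a (measurable) estimator that maps input-output data from a system of any dimensions (and possibly a failure probability) to an estimate $(\hat A,\hat B,\hat C)$, together with nonnegative constants $\kappa_i=\kappa_i(\mathcal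 M,\mathcal U,\delta)$ depending (measurably) on the system, its stability constants, the input ensemble $\mathcal U$ (covariance and number of inputs) and $\delta$, and polynomials $p_1,p_2$ with coefficients in $\mathbb N$, such that for every minimal system $\mathcal M=(r,n,m,A,B,C,\Sigma_w,\Sigma_\eta)$ with $r\ge 1$ satisfying the above stability assumption, every $\delta\in(0,1)$ and every $T\ge\max\{1,\kappa_1p_1(r,n,m)\}$, the estimate from a data set of length $T$ satisfies, with probability at least $1-\delta$, $$\max\{\|S^{-1}AS-\hat A\|,\|S^{-1}B-\hat B\|,\|CS-\hat C\|\}\le \frac{p_2(r,n,m)}{\sqrt T}\,\kappa_2\quad\text{for some invertible }S$$ (in particular, $\hat A$ is $r\times r$). **Algorithm.** (i) Column space approximation: let $\Sigma_y=\sum_{t=0}^{T_1}y_{1,t}y_{1,t}^\top$, let $\hat r_c$ be the largest $i\in\{1,\dots,n-1\}$ with $\sigma_i(\Sigma_y)-\sigma_{i+1}(\Sigma_y)>T_1^{3/4}$ ($\hat r_c=0$ if there is none), and let the columns of $\hat\Phi_C\in\mathbb R^{n\times\hat r_c}$ be orthonormal eigenvectors (chosen measurably) of $\Sigma_y$ for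 its $\hat r_c$ largest eigenvalues. (ii) Apply the oracle, at failure level $\delta/2$, to $\{\hat\Phi_C^\top y_{2,t}\}_{t=0}^{T_2}\cup\{u_{2,t}\}_{t=0}^{T_2-1}$, obtaining $(\hat A,\hat B,\tilde C)$. (iii) Output $(\hat A,\hat B,\hat C)$ with $\hat C=\hat\Phi_C\tilde C$. **Constants.** Let $\psi_C=\sigma_1(C)$, $\psi_\eta=\sigma_\eta^2$, $\psi_w=\sigma_1(\Sigma_w+B\Sigma_uB^\top)$, each replaced by its maximum with $1$; let $\phi_C$, $\phi_O$, $\phi_R$, $\phi_u$ be the smallest nonzero singular values of $C$, of the observability matrix with block rows $C,CA,\dots,CA^{r-1}$, of the controllability matrix $[B,AB,\dots,A^{r-1}B]$, and of $\Sigma_u$, each replaced by its minimum with $1$. Put $$\kappa_4=\frac{\psi_\eta}{\phi_u\phi_C^2\phi_R^2}\sqrt{\log\tfrac1\delta},$$ $$\kappa_3=\max\left\{\kappa_4^2\frac{\psi_A^2\psi_C^2}{(1-\rho_A^2)\phi_O^2},\ \Big(\frac{\psi_\eta^2\psi_C^2\psi_w\psi_A^2}{(1-\rho_A^2)\phi_u^2\phi_C^4\phi_R^4}\Big)^2\log^2\Big(\frac{\psi_C^2\psi_w\psi_A^4}{1-\rho_A^2}\,r\log\frac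 r\delta\Big)\log^4\frac r\delta\right\}.$$ Let $\widehat{\mathcal M}=(r,\hat r_c,m,A,B,\hat\Phi_C^\top C,\Sigma_w,\sigma_\eta^2I)$, and let $\kappa_i=\kappa_i(\widehat{\mathcal M},\mathcal U_2,\delta/2)$, $i=1,2$, be the constants of the oracle. **Theorem.** For every $\delta_0\in(0,e^{-1})$ there are constants $c_3,c>0$ depending only on $\delta_0$, and for all $p_1,p_2$ there are polynomials $q_1,q_2$ in two variables depending only on $p_1,p_2$, such that for every SYSID oracle with polynomials $p_1,p_2$, every system as above, every $\delta\in(0,\delta_0]$, every $T_1\ge c_3\kappa_3n^2r^3$ and every $T_2\ge1$, with probability at least $1-\delta$ the following holds: if $T_2\ge\kappa_1\,q_1(r,m)$, then for some invertible $S$ $$\max\{\|S^{-1}AS-\hat A\|,\|S^{-1}B-\hat B\|,\|CS-\hat C\|\}\le c\left(\kappa_4\sqrt{\frac n{T_1}}\,\|\hat C\|+\kappa_2\sqrt{\frac{q_2(r,m)}{T_2}}\right),$$ and consequently (sample complexity $\tilde O((n+\mathrm{poly}(r,m))/\epsilon^2)$, i.e. $\tilde O(n/\epsilon^2)$ when $r,m\ll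 n$) the left-hand side is at most $\epsilon$ for every $\epsilon>0$ such that $T_1\ge c\,\kappa_4^2\|\hat C\|^2\,n/\epsilon^2$ and $T_2\ge c\,\kappa_2^2\,q_2(r,m)/\epsilon^2$. -/

import Mathlib

open MeasureTheory ProbabilityTheory
open scoped Matrix Matrix.Norms.L2Operator

/-- Matrices carry the product (equivalently, Borel) sigma-algebra of their entries. -/
instance Matrix.instMeasurableSpaceEntries {α β : Type*} :
    MeasurableSpace (Matrix α β ℝ) :=
  inferInstanceAs (MeasurableSpace (α → β → ℝ))

noncomputable section

namespace HDSysId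

/-- Euclidean space of dimension `d`. -/
abbrev Vec (d : ℕ) : Type := EuclideanSpace ℝ (Fin d)

/-! ### Singular values -/

section SingularValues

variable {α β : Type*} [Fintype α] [Fintype β] [DecidableEq β]

/-- The `i`-th largest singular value of a matrix, counted from `i = 0`
(and `0` beyond the number of columns). -/
def sv (P : Matrix α β ℝ) (i : ℕ) : ℝ := P.toEuclideanLin.singularValues i

/-- The largest singular value. -/
def svMax (P : Matrix α β ℝ) : ℝ := sv P 0

/-- The smallest nonzero singular value, i.e. the one with (one-based) index `rank P`. -/
def svMin (P : Matrix α β ℝ) : ℝ := sv P (P.rank - 1)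

end SingularValues

/-! ### Linear systems and their trajectories -/

/-- The parameters of the linear system
`x (t+1) = A x t + B u t + w t`, `y t = C x t + η t`, `x 0 = 0`, with latent dimension `r`,
observation dimension `n`, input dimension `m`, and centred Gaussian noises of covariances
`covW` (process) and `covEta` (observation). -/
structure LTISystem (r n m : ℕ) where
  A : Matrix (Fin r) (Fin r) ℝ
  B : Matrix (Fin r) (Fin m) ℝ
  C : Matrix (Fin n) (Fin r) ℝ
  covW : Matrix (Fin r) (Fin r) ℝ
  covEta : Matrix (Fin n) (Fin n) ℝ

/-- A data set of length `T`: the outputs `y 0, …, y T` and the inputs `u 0, …, u (T-1)`. -/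
abbrev Data (n m T : ℕ) : Type := (Fin (T + 1) → Vec n) × (Fin T → Vec m)

/-- The randomness behind a trajectory: inputs, process noises, observation noises. -/
abbrev Noise (r n m T : ℕ) : Type :=
  (Fin T → Vec m) × (Fin T → Vec r) × (Fin (T + 1) → Vec n)

namespace LTISystem

variable {r n m : ℕ}

/-- The controllability matrix `[B, AB, …, A^(r-1) B]`. -/
def ctrlMatrix (M : LTISystem r n m) : Matrix (Fin r) (Fin r × Fin m) ℝ :=
  Matrix.of fun i kj => (M.A ^ (kj.1 : ℕ) * M.B) i kj.2

/-- The observability matrix, with block rows `C, CA, …, C A^(r-1)`. -/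
def obsMatrix (M : LTISystem r n m) : Matrix (Fin r × Fin n) (Fin r) ℝ :=
  Matrix.of fun ki j => (M.C * M.A ^ (ki.1 : ℕ)) ki.2 j

/-- Minimality: `(A, B)` is controllable and `(A, C)` is observable. -/
def IsMinimal (M : LTISystem r n m) : Prop :=
  M.ctrlMatrix.rank = r ∧ M.obsMatrix.rank = r

/-- The stability assumption with constants `ψA`, `ρA`:
`‖A^i‖ ≤ ψA * ρA^(i-1)` for all `i ≥ 1`. -/
def IsStableWith (M : LTISystem r n m) (ψA ρA : ℝ) : Prop :=
  1 ≤ ψA ∧ 0 < ρA ∧ ρA < 1 ∧ ∀ i : ℕ, ‖M.A ^ (i + 1)‖ ≤ ψA * ρA ^ i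

/-- The latent state at time `t ≤ T`. -/
def state {T : ℕ} (M : LTISystem r n m) (u : Fin T → Vec m) (w : Fin T → Vec r) : ℕ → Vec r
  | 0 => 0
  | t + 1 => M.A.toEuclideanLin (state M u w t) +
      (if h : t < T then M.B.toEuclideanLin (u ⟨t, h⟩) + w ⟨t, h⟩ else 0)

/-- The data set generated by a realization of inputs and noises. -/
def trajectory (M : LTISystem r n m) (T : ℕ) (ω : Noise r n m T) : Data n m T :=
  (fun t => M.C.toEuclideanLin (M.state ω.1 ω.2.1 t) + ω.2.2 t, ω.1)

/-- The law of inputs and noises: all independent, `u t ~ N(0, covU)`, `w t ~ N(0, covW)`,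
`η t ~ N(0, covEta)`. -/
def noiseLaw (M : LTISystem r n m) (covU : Matrix (Fin m) (Fin m) ℝ) (T : ℕ) :
    Measure (Noise r n m T) :=
  (Measure.pi fun _ => multivariateGaussian 0 covU).prod
    ((Measure.pi fun _ => multivariateGaussian 0 M.covW).prod
      (Measure.pi fun _ => multivariateGaussian 0 M.covEta))

/-- The law of a data set of length `T`. -/
def dataLaw (M : LTISystem r n m) (covU : Matrix (Fin m) (Fin m) ℝ) (T : ℕ) :
    Measure (Data n m T) :=
  (M.noiseLaw covU T).map (M.trajectory T)

/-- The system that generates the observations `Φᵀ y t`: observer `Φᵀ C`, and the covariance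
of `Φᵀ η t` (this is `σ² I` if `covEta = σ² I` and the columns of `Φ` are orthonormal). -/
def compress {k : ℕ} (M : LTISystem r n m) (Φ : Matrix (Fin n) (Fin k) ℝ) :
    LTISystem r k m where
  A := M.A
  B := M.B
  C := Φᵀ * M.C
  covW := M.covW
  covEta := Φᵀ * M.covEta * Φ

/-- `max {‖S⁻¹AS - Â‖, ‖S⁻¹B - B̂‖, ‖CS - Ĉ‖}` in spectral norm. -/
def recoveryError (M : LTISystem r n m) (S Ah : Matrix (Fin r) (Fin r) ℝ)
    (Bh : Matrix (Fin r) (Fin m) ℝ) (Ch : Matrix (Fin n) (Fin r) ℝ) : ℝ :=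
  max ‖S⁻¹ * M.A * S - Ah‖ (max ‖S⁻¹ * M.B - Bh‖ ‖M.C * S - Ch‖)

/-! ### The problem-dependent constants -/

def psiC (M : LTISystem r n m) : ℝ := max 1 (svMax M.C)

def psiEta (M : LTISystem r n m) : ℝ := max 1 (svMax M.covEta)

def psiW (M : LTISystem r n m) (covU : Matrix (Fin m) (Fin m) ℝ) : ℝ :=
  max 1 (svMax (M.covW + M.B * covU * M.Bᵀ))

def phiC (M : LTISystem r n m) : ℝ := min 1 (svMin M.C)

def phiO (M : LTISystem r n m) : ℝ := min 1 (svMin M.obsMatrix)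

def phiR (M : LTISystem r n m) : ℝ := min 1 (svMin M.ctrlMatrix)

def phiU (covU : Matrix (Fin m) (Fin m) ℝ) : ℝ := min 1 (svMin covU)

def kappa4 (M : LTISystem r n m) (covU : Matrix (Fin m) (Fin m) ℝ) (δ : ℝ) : ℝ :=
  M.psiEta / (phiU covU * M.phiC ^ 2 * M.phiR ^ 2) * √(Real.log (1 / δ))

def kappa3 (M : LTISystem r n m) (covU : Matrix (Fin m) (Fin m) ℝ) (ψA ρA δ : ℝ) : ℝ :=
  max (M.kappa4 covU δ ^ 2 * (ψA ^ 2 * M.psiC ^ 2 / ((1 - ρA ^ 2) * M.phiO ^ 2)))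
    ((M.psiEta ^ 2 * M.psiC ^ 2 * M.psiW covU * ψA ^ 2 /
        ((1 - ρA ^ 2) * phiU covU ^ 2 * M.phiC ^ 4 * M.phiR ^ 4)) ^ 2 *
      Real.log (M.psiC ^ 2 * M.psiW covU * ψA ^ 4 / (1 - ρA ^ 2) * r * Real.log (r / δ)) ^ 2 *
      Real.log (r / δ) ^ 4)

end LTISystem

/-! ### Column space approximation by PCA -/

/-- The (unnormalized) data covariance `∑ y t (y t)ᵀ`. -/
def sampleCov {n T : ℕ} (Y : Fin (T + 1) → Vec n) : Matrix (Fin n) (Fin n) ℝ :=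
  ∑ t, Matrix.vecMulVec (fun i => Y t i) (fun i => Y t i)

open Classical in
/-- The estimated observer rank: the largest `i ∈ {1, …, n-1}` with
`σ_i - σ_(i+1) > T^(3/4)`, where `σ_1 ≥ … ≥ σ_n` are the singular values of the data
covariance (`0` if there is no such `i`). -/
def rankEst {n T : ℕ} (Y : Fin (T + 1) → Vec n) : ℕ :=
  ((Finset.Icc 1 (n - 1)).filter fun i =>
    (T : ℝ) ^ (3 / 4 : ℝ) < sv (sampleCov Y) (i - 1) - sv (sampleCov Y) i).sup id

/-- A candidate basis of a subspace of `ℝⁿ`, of any number of vectors. -/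
abbrev SubspaceBasis (n : ℕ) : Type := Σ k : ℕ, Matrix (Fin n) (Fin k) ℝ

/-- `Φ` is an implementation of PCA column space approximation: it returns, measurably in the
observations, orthonormal eigenvectors of the data covariance for its `rankEst Y` largest
eigenvalues. (Eigenvectors are not unique; any choice is allowed.) -/
structure IsColApprox {n T : ℕ} (Φ : (Fin (T + 1) → Vec n) → SubspaceBasis n) : Prop where
  measurable : Measurable Φ
  rank_eq : ∀ Y, (Φ Y).1 = rankEst Y
  orthonormal : ∀ Y, (Φ Y).2ᵀ * (Φ Y).2 = 1
  eigenvectors : ∀ Y, sampleCov Y * (Φ Y).2 =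
    (Φ Y).2 * Matrix.diagonal fun i : Fin (Φ Y).1 => sv (sampleCov Y) i

/-! ### System identification oracles -/

/-- An estimate `(Â, B̂, Ĉ)`; its latent dimension is part of the estimate. -/
abbrev Estimate (n m : ℕ) : Type :=
  Σ k : ℕ, Matrix (Fin k) (Fin k) ℝ × Matrix (Fin k) (Fin m) ℝ × Matrix (Fin n) (Fin k) ℝ

/-- An estimator for all dimensions and lengths. The first argument is the target failure
probability, which the estimator may use or ignore. -/
abbrev Estimator : Type := ∀ (_δ : ℝ) (n m T : ℕ), Data n m T → Estimate n m

/-- A problem-related constant: a function of the system, of the input ensemble (the covariance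
and number of inputs), of the stability constants `ψA`, `ρA`, and of the failure probability. -/
abbrev ProblemConst : Type :=
  ∀ {r n m : ℕ}, LTISystem r n m → Matrix (Fin m) (Fin m) ℝ → (T : ℕ) → (ψA ρA δ : ℝ) → ℝ

/-- The estimate `E` has the latent dimension of `M` and recovers `M` up to similarity with
error at most `ε`. -/
def Recovers {r n m : ℕ} (M : LTISystem r n m) (E : Estimate n m) (ε : ℝ) : Prop :=
  ∃ Ah Bh Ch, E = ⟨r, Ah, Bh, Ch⟩ ∧
    ∃ S : Matrix (Fin r) (Fin r) ℝ, IsUnit S ∧ M.recoveryError S Ah Bh Ch ≤ ε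

/-- `est` is a SYSID oracle with constants `κ₁`, `κ₂` and polynomials `p₁`, `p₂` in
`(r, n, m)`: on every stable minimal system, of any dimensions, with probability at least
`1 - δ` its error is at most `p₂ / √T * κ₂` as soon as `T ≥ κ₁ * p₁`. -/
structure IsSysIdOracle (est : Estimator) (κ₁ κ₂ : ProblemConst)
    (p₁ p₂ : MvPolynomial (Fin 3) ℕ) : Prop where
  measurable_est : ∀ δ n m T, Measurable (est δ n m T)
  nonneg₁ : ∀ {r n m : ℕ} (M : LTISystem r n m) covU T ψA ρA δ, 0 ≤ κ₁ M covU T ψA ρA δ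
  nonneg₂ : ∀ {r n m : ℕ} (M : LTISystem r n m) covU T ψA ρA δ, 0 ≤ κ₂ M covU T ψA ρA δ
  measurable₁ : ∀ {r n m : ℕ} (M : LTISystem r n m) covU T ψA ρA δ,
    Measurable fun C => κ₁ { M with C := C } covU T ψA ρA δ
  measurable₂ : ∀ {r n m : ℕ} (M : LTISystem r n m) covU T ψA ρA δ,
    Measurable fun C => κ₂ { M with C := C } covU T ψA ρA δ
  guarantee : ∀ {r n m : ℕ} (M : LTISystem r n m) (covU : Matrix (Fin m) (Fin m) ℝ)
    (T : ℕ) (ψA ρA δ : ℝ), 0 < r → M.IsMinimal → M.covW.PosSemidef → M.covEta.PosSemidef →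
    covU.PosDef → M.IsStableWith ψA ρA → 0 < δ → δ < 1 → 1 ≤ T →
    κ₁ M covU T ψA ρA δ * (MvPolynomial.eval ![r, n, m] p₁ : ℕ) ≤ T →
    M.dataLaw covU T
      {D | ¬ Recovers M (est δ n m T D)
        ((MvPolynomial.eval ![r, n, m] p₂ : ℕ) / √T * κ₂ M covU T ψA ρA δ)}
      ≤ ENNReal.ofReal δ

/-! ### The two-stage algorithm -/

/-- Replace each output `y t` of a data set by `Φᵀ y t`. -/
def projectData {n m k T : ℕ} (Φ : Matrix (Fin n) (Fin k) ℝ) (D : Data n m T) : Data k m T :=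
  (fun t => Φᵀ.toEuclideanLin (D.1 t), D.2)

/-- Lift a low-dimensional estimate `(Â, B̂, C̃)` to `(Â, B̂, Φ C̃)`. -/
def liftEstimate {n m k : ℕ} (Φ : Matrix (Fin n) (Fin k) ℝ) (E : Estimate k m) :
    Estimate n m :=
  ⟨E.1, E.2.1, E.2.2.1, Φ * E.2.2.2⟩

/-- Approximate the column space from the outputs of the first data set, project the second
data set onto it, run the oracle (at level `δ`), and lift its output. -/
def colSysId {n m T₁ T₂ : ℕ} (Φ : (Fin (T₁ + 1) → Vec n) → SubspaceBasis n) (est : Estimator)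
    (δ : ℝ) (D₁ : Data n m T₁) (D₂ : Data n m T₂) : Estimate n m :=
  liftEstimate (Φ D₁.1).2 (est δ (Φ D₁.1).1 m T₂ (projectData (Φ D₁.1).2 D₂))

end HDSysId

end

/-!
The observations of the first data set have the form `Y = W + N`, with a signal `W` whose values
lie in the column space `V` of `C`, of dimension `s = rank C ≤ r`, and an isotropic noise `N`.
Principal component analysis finds `V`, after which the second data set, projected to dimension
`s ≤ r`, is a data set of a smaller minimal system to which the oracle applies.

*Why PCA finds `V`.* The deterministic part (`SignalNoise.pca`) assumes that the signal has
strength `h` on `V`, that the noise energy is isotropic up to an error `e`, and that noise and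
realized signal correlate at most at the level `b`. Comparing the sample covariance with `τ • 1`,
where `τ` is the expected noise energy, its `s` top eigenvalues exceed the others by `h² / 2`, the
other ones agree up to `2 e + b²`, and the top eigenvectors span `V` up to an error of order
`b / h + e / h²`. A perturbation bound that ignores the directional structure of the cross terms
would lose here: it is essential that only the correlation of the noise with the at most `r`
dimensional space of realized signals matters, so that `b² ~ n + r` and not `T`.

The three assumptions hold with high probability. All of them follow from one uniform
concentration inequality for `a ↦ ‖X a‖²`, where `X a` is linear in `a` and Gaussian in the
randomness (`measure_exists_norm_sq_deviation_le`): a chi-square moment generating function bound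
on the diagonalized covariance, a net of the sphere, and polarization. It applies to the noise
energy; to the correlation, conditionally on the states; and to the state energy, after whitening
by its mean, which is bounded below by the controllability Gramian
(`LTISystem.measure_state_energy_lt_le`), while stability bounds the variances above through
Schur's test. With `T₁ ≥ c₃ κ₃ n² r³` the levels fit together (`pca_level_estimates`), and the error
is at most `θ = 6100 κ₄ √(n / T₁) ≤ 1 / 2`.

*Why the oracle applies.* Since `θ < 1`, the compression `Φᵀ` is injective on `V`, so that the
compressed system has the same unobservable directions as the original one and stays minimal
(`LTISystem.isMinimal_compress`). Its noise is again isotropic because `Φ` is orthonormal. An error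
`η` of the oracle becomes `2 θ ‖Ĉ‖ + 2 η` (`ApproximatesRange.norm_sub_le`): measuring the PCA error
against `C S = Ĉ + (C S - Ĉ)` and absorbing the second term avoids any bound on `S`. The two data
sets are independent, so that the failures of the oracle can be integrated over the first one by
Fubini; this needs that recovery up to similarity is a measurable event
(`measurableSet_recoveryError_le`).
-/

open MeasureTheory ProbabilityTheory
open scoped Matrix Matrix.Norms.L2Operator

namespace HDSysId

open scoped RealInnerProductSpace

/-! ### Concentration of Gaussian quadratic forms -/

theorem isGaussian_pi {ι : Type*} [Fintype ι] {E : ι → Type*} [∀ i, NormedAddCommGroup (E i)]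
    [∀ i, NormedSpace ℝ (E i)] [∀ i, MeasurableSpace (E i)] [∀ i, BorelSpace (E i)]
    [∀ i, SecondCountableTopology (E i)] [∀ i, CompleteSpace (E i)] (μ : ∀ i, Measure (E i))
    [∀ i, IsGaussian (μ i)] : IsGaussian (Measure.pi μ) := by
  have h := iIndepFun.hasGaussianLaw (P := Measure.pi μ) (X := fun i (ω : ∀ i, E i) => ω i)
    (fun i => ⟨by rw [(measurePreserving_eval μ i).map_eq]; infer_instance⟩)
    (iIndepFun_pi (X := fun i x => x) (fun i => aemeasurable_id))
  have h2 := h.isGaussian_map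
  rwa [show (fun ω : ∀ i, E i => fun i => ω i) = id from rfl, Measure.map_id] at h2

theorem gaussianPDFReal_mul_exp_sq (t x : ℝ) :
    gaussianPDFReal 0 1 x * Real.exp (t * x ^ 2) =
      (√(2 * Real.pi))⁻¹ * Real.exp (-(1 / 2 - t) * x ^ 2) := by
  simp only [gaussianPDFReal, NNReal.coe_one, mul_one, sub_zero]
  rw [mul_assoc, ← Real.exp_add]
  congr 2
  ring

theorem integrable_exp_sq_gaussianReal {t : ℝ} (ht : t < 1 / 2) :
    Integrable (fun x => Real.exp (t * x ^ 2)) (gaussianReal 0 1) := by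
  rw [gaussianReal_of_var_ne_zero _ one_ne_zero,
    integrable_withDensity_iff_integrable_smul' (measurable_gaussianPDF _ _)
      (ae_of_all _ fun _ => gaussianPDF_lt_top)]
  simp only [toReal_gaussianPDF, smul_eq_mul, gaussianPDFReal_mul_exp_sq]
  exact (integrable_exp_neg_mul_sq (by linarith)).const_mul _

/-- The moment generating function of a squared standard Gaussian, bounded by that of a
sub-gamma variable. -/
theorem integral_exp_sq_gaussianReal_le {t : ℝ} (ht : |t| ≤ 1 / 4) :
    ∫ x, Real.exp (t * x ^ 2) ∂(gaussianReal 0 1) ≤ Real.exp (t + 4 * t ^ 2) := by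
  obtain ⟨h1, h2⟩ := abs_le.1 ht
  rw [integral_gaussianReal_eq_integral_smul one_ne_zero]
  simp only [smul_eq_mul, gaussianPDFReal_mul_exp_sq]
  rw [integral_const_mul, integral_gaussian, ← Real.sqrt_inv,
    ← Real.sqrt_mul (by positivity)]
  have h3 : (2 * Real.pi)⁻¹ * (Real.pi / (1 / 2 - t)) = (1 - 2 * t)⁻¹ := by
    have : 1 - 2 * t ≠ 0 := by linarith
    have : 1 / 2 - t ≠ 0 := by linarith
    field_simp
  rw [h3]
  apply Real.sqrt_le_iff.2 ⟨by positivity, ?_⟩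
  rw [← Real.exp_nat_mul, inv_le_comm₀ (by linarith) (by positivity), ← Real.exp_neg]
  have h2t : |2 * t| ≤ 1 / 2 := by rw [abs_mul, abs_two]; linarith
  have h4 := Real.abs_log_sub_add_sum_range_le (x := 2 * t) (by linarith) 1
  simp only [Finset.range_one, Finset.sum_singleton, zero_add, pow_one, Nat.cast_zero,
    div_one] at h4
  have h5 : |2 * t| ^ (1 + 1) / (1 - |2 * t|) ≤ 8 * t ^ 2 := by
    rw [div_le_iff₀ (by linarith)]
    have : |2 * t| ^ (1 + 1) = 4 * t ^ 2 := by rw [sq_abs]; ring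
    rw [this]
    nlinarith [sq_nonneg t]
  have h6 := (abs_le.1 (h4.trans h5)).1
  rw [← Real.le_log_iff_exp_le (by linarith)]
  push_cast
  linarith

section GaussianVectors

variable {F : Type*} [NormedAddCommGroup F] [InnerProductSpace ℝ F] [FiniteDimensional ℝ F]
  [MeasurableSpace F] [BorelSpace F]

/-- A centred Gaussian measure is the law of `∑ √sᵢ ζᵢ bᵢ`, with independent standard Gaussians
`ζᵢ`, as soon as the orthonormal basis `b` diagonalizes its covariance. -/
theorem eq_map_pi_of_covariance_diagonal {ι : Type*} [Fintype ι] (ν : Measure F) [IsGaussian ν]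
    (h0 : ∫ y, y ∂ν = 0) (b : OrthonormalBasis ι ℝ F) (s : ι → ℝ) (hs : ∀ i, 0 ≤ s i)
    (hcov : ∀ x, ∫ y, ⟪x, y⟫ ^ 2 ∂ν = ∑ i, s i * ⟪b i, x⟫ ^ 2) :
    ν = (Measure.pi fun _ : ι => gaussianReal 0 1).map fun x => ∑ i, (√(s i) * x i) • b i := by
  have hi : ∀ L : StrongDual ℝ F, ∫ y, L y ∂ν = 0 := fun L => by
    rw [L.integral_comp_comm IsGaussian.integrable_fun_id, h0, map_zero]
  apply Measure.ext_of_charFun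
  ext t
  have hvar : Var[fun x => ⟪t, x⟫; ν] = ∑ i, s i * ⟪b i, t⟫ ^ 2 := by
    rw [variance_of_integral_eq_zero (X := fun x => ⟪t, x⟫) (by fun_prop) (hi (innerSL ℝ t)),
      hcov]
  rw [IsGaussian.charFun_eq, hvar]
  have h1 : ∫ x, ⟪t, x⟫ ∂ν = 0 := hi (innerSL ℝ t)
  rw [integral_complex_ofReal, h1, charFun_apply,
    integral_map (Measurable.aemeasurable (by fun_prop))
      (Measurable.aestronglyMeasurable (by fun_prop))]
  simp_rw [sum_inner, Complex.ofReal_sum, Finset.sum_mul, Complex.exp_sum,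
    integral_fintype_prod_eq_prod
      (f := fun i x => Complex.exp (⟪(√(s i) * x) • b i, t⟫ * Complex.I))]
  have : ∀ i, ∫ x, Complex.exp (⟪(√(s i) * x) • b i, t⟫ * Complex.I) ∂(gaussianReal 0 1) =
      Complex.exp (-(s i * ⟪b i, t⟫ ^ 2 : ℝ) / 2) := by
    intro i
    have h2 := charFun_gaussianReal (μ := 0) (v := 1) (√(s i) * ⟪b i, t⟫)
    rw [charFun_apply_real] at h2
    simp only [real_inner_smul_left]
    rw [show (s i * ⟪b i, t⟫ ^ 2 : ℝ) = (√(s i) * ⟪b i, t⟫) ^ 2 by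
      rw [mul_pow, Real.sq_sqrt (hs i)]]
    convert! h2 using 1
    · congr 1; ext x; push_cast; ring_nf
    · push_cast; ring_nf
  simp_rw [this, ← Complex.exp_sum]
  simp [← Finset.sum_div, neg_div]

/-- Bernstein-type bound for the moment generating function of `‖y‖² - 𝔼 ‖y‖²`, where `y` is a
centred Gaussian vector: only the trace `τ` and the largest eigenvalue `κ` of its covariance enter. -/
theorem mgf_norm_sq_gaussian_le (ν : Measure F) [IsGaussian ν] (h0 : ∫ y, y ∂ν = 0) {κ t : ℝ}
    (hκ : ∀ x : F, ∫ y, ⟪x, y⟫ ^ 2 ∂ν ≤ κ * ‖x‖ ^ 2) (ht : |t| * κ ≤ 1 / 4) :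
    Integrable (fun y => Real.exp (t * ‖y‖ ^ 2)) ν ∧
    ∫ y, Real.exp (t * ‖y‖ ^ 2) ∂ν ≤
      Real.exp (t * (∫ y, ‖y‖ ^ 2 ∂ν) + 4 * t ^ 2 * (κ * ∫ y, ‖y‖ ^ 2 ∂ν)) := by
  have hmem : MemLp id 2 ν := IsGaussian.memLp_two_id
  have hpos : (covarianceOperator ν).toLinearMap.IsPositive := isPositive_covarianceOperator
  have hS := hpos.isSymmetric
  let b := hS.eigenvectorBasis rfl
  let s := hS.eigenvalues rfl
  have hs : ∀ i, 0 ≤ s i := hpos.nonneg_eigenvalues rfl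
  have happ : ∀ i, covarianceOperator ν (b i) = s i • b i := fun i =>
    hS.apply_eigenvectorBasis rfl i
  have hcov : ∀ x, ∫ y, ⟪x, y⟫ ^ 2 ∂ν = ∑ i, s i * ⟪b i, x⟫ ^ 2 := by
    intro x
    have h1 := covarianceOperator_inner hmem x x
    simp_rw [← pow_two] at h1
    rw [← h1, ← b.sum_inner_mul_inner]
    refine Finset.sum_congr rfl fun i _ => ?_
    have h2 : ⟪covarianceOperator ν x, b i⟫ = s i * ⟪b i, x⟫ := by
      rw [show ⟪covarianceOperator ν x, b i⟫ = ⟪x, covarianceOperator ν (b i)⟫ from hS x (b i),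
        happ, real_inner_smul_right, real_inner_comm]
    rw [h2]; ring
  have hsκ : ∀ i, s i ≤ κ := by
    intro i
    have h1 := hκ (b i)
    rw [hcov] at h1
    simpa [OrthonormalBasis.inner_eq_ite] using h1
  have hν := eq_map_pi_of_covariance_diagonal ν h0 b s hs hcov
  have hnorm : ∀ x : Fin (Module.finrank ℝ F) → ℝ,
      ‖∑ i, (√(s i) * x i) • b i‖ ^ 2 = ∑ i, s i * x i ^ 2 := by
    intro x
    rw [← b.sum_sq_norm_inner_right]
    refine Finset.sum_congr rfl fun j _ => ?_
    simp [inner_sum, real_inner_smul_right, OrthonormalBasis.inner_eq_ite, mul_pow,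
      Real.sq_sqrt (hs j)]
  have htr : ∫ y, ‖y‖ ^ 2 ∂ν = ∑ i, s i := by
    have h1 : ∀ y : F, ‖y‖ ^ 2 = ∑ i, ⟪b i, y⟫ ^ 2 := fun y => by
      rw [← b.sum_sq_norm_inner_right]; simp
    simp_rw [h1]
    rw [integral_finsetSum _ fun i _ => by
      simpa using (hmem.const_inner (b i)).integrable_sq]
    refine Finset.sum_congr rfl fun i _ => ?_
    rw [hcov]
    simp [OrthonormalBasis.inner_eq_ite]
  have hti : ∀ i, |t * s i| ≤ 1 / 4 := fun i => by
    rw [abs_mul, abs_of_nonneg (hs i)]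
    exact (mul_le_mul_of_nonneg_left (hsκ i) (abs_nonneg t)).trans ht
  have hint : Integrable (fun x : Fin (Module.finrank ℝ F) → ℝ =>
      ∏ i, Real.exp (t * s i * x i ^ 2)) (Measure.pi fun _ => gaussianReal 0 1) :=
    Integrable.fintype_prod fun i =>
      integrable_exp_sq_gaussianReal (by linarith [(abs_le.1 (hti i)).2])
  have hexp : ∀ x : Fin (Module.finrank ℝ F) → ℝ,
      Real.exp (t * ‖∑ i, (√(s i) * x i) • b i‖ ^ 2) = ∏ i, Real.exp (t * s i * x i ^ 2) := by
    intro x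
    rw [hnorm, Finset.mul_sum, Real.exp_sum]
    simp only [mul_assoc]
  have hmeas : Measurable fun x : Fin (Module.finrank ℝ F) → ℝ =>
      ∑ i, (√(s i) * x i) • b i := by fun_prop
  constructor
  · rw [hν, integrable_map_measure (Measurable.aestronglyMeasurable (by fun_prop))
      hmeas.aemeasurable]
    exact hint.congr (ae_of_all _ fun x => (hexp x).symm)
  · rw [htr, hν, integral_map hmeas.aemeasurable (Measurable.aestronglyMeasurable (by fun_prop))]
    simp_rw [hexp]
    rw [integral_fintype_prod_eq_prod (f := fun i x => Real.exp (t * s i * x ^ 2)),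
      Finset.mul_sum, Finset.mul_sum, Finset.mul_sum, ← Finset.sum_add_distrib, Real.exp_sum]
    refine Finset.prod_le_prod (fun i _ => integral_nonneg fun x => (Real.exp_pos _).le)
      fun i _ => (integral_exp_sq_gaussianReal_le (hti i)).trans (Real.exp_le_exp.2 ?_)
    have : t ^ 2 * (s i * s i) ≤ t ^ 2 * (κ * s i) :=
      mul_le_mul_of_nonneg_left (mul_le_mul_of_nonneg_right (hsκ i) (hs i)) (sq_nonneg t)
    nlinarith

/-- Concentration of `‖y‖²` around its mean for a centred Gaussian vector `y`. -/
theorem measure_norm_sq_gaussian_deviation_le (ν : Measure F) [IsGaussian ν]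
    (h0 : ∫ y, y ∂ν = 0) {κ τ x : ℝ} (hκ0 : 0 < κ) (hx : 0 < x)
    (hκ : ∀ x : F, ∫ y, ⟪x, y⟫ ^ 2 ∂ν ≤ κ * ‖x‖ ^ 2) (hτ : ∫ y, ‖y‖ ^ 2 ∂ν = τ) :
    ν.real {y | 4 * √(κ * τ * x) + 8 * κ * x ≤ |‖y‖ ^ 2 - τ|} ≤ 2 * Real.exp (-x) := by
  have hτ0 : 0 ≤ τ := hτ ▸ integral_nonneg fun y => sq_nonneg _
  set u := 4 * √(κ * τ * x) + 8 * κ * x with hu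
  have hκx : 0 < κ * x := mul_pos hκ0 hx
  have hu0 : 0 < u := by positivity
  -- the Chernoff exponent `t`, chosen as large as the range of the previous lemma allows
  obtain ⟨t, ht0, htκ, hexp⟩ : ∃ t : ℝ, 0 ≤ t ∧ t * κ ≤ 1 / 4 ∧
      -(t * u) + 4 * t ^ 2 * (κ * τ) ≤ -x := by
    rcases le_or_gt u (2 * τ) with h | h
    · have hτ1 : 0 < τ := by linarith
      refine ⟨u / (8 * (κ * τ)), by positivity, ?_, ?_⟩
      · rw [div_mul_eq_mul_div, div_le_iff₀ (by positivity)]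
        nlinarith
      · have h1 : -(u / (8 * (κ * τ)) * u) + 4 * (u / (8 * (κ * τ))) ^ 2 * (κ * τ) =
            -(u ^ 2 / (16 * (κ * τ))) := by field_simp; ring
        rw [h1, neg_le_neg_iff, le_div_iff₀ (by positivity)]
        have h2 : (√(κ * τ * x)) ^ 2 = κ * τ * x := Real.sq_sqrt (by positivity)
        have h3 : 0 ≤ √(κ * τ * x) := Real.sqrt_nonneg _
        have h4 : (4 * √(κ * τ * x)) ^ 2 ≤ u ^ 2 :=
          pow_le_pow_left₀ (by positivity) (by rw [hu]; nlinarith) 2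
        nlinarith
    · refine ⟨1 / (4 * κ), by positivity, by field_simp; norm_num, ?_⟩
      have h1 : -(1 / (4 * κ) * u) + 4 * (1 / (4 * κ)) ^ 2 * (κ * τ) = -((u - τ) / (4 * κ)) := by
        field_simp; ring
      rw [h1, neg_le_neg_iff, le_div_iff₀ (by positivity)]
      have h3 : 0 ≤ √(κ * τ * x) := Real.sqrt_nonneg _
      nlinarith
  have hup := mgf_norm_sq_gaussian_le ν h0 hκ (t := t) (by rwa [abs_of_nonneg ht0])
  have hdn := mgf_norm_sq_gaussian_le ν h0 hκ (t := -t) (by rwa [abs_neg, abs_of_nonneg ht0])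
  rw [hτ] at hup hdn
  have h1 := (measure_ge_le_exp_mul_mgf (X := fun y : F => ‖y‖ ^ 2) (μ := ν) (τ + u) ht0
    hup.1).trans (mul_le_mul_of_nonneg_left hup.2 (Real.exp_pos _).le)
  have h2 := (measure_le_le_exp_mul_mgf (X := fun y : F => ‖y‖ ^ 2) (μ := ν) (τ - u)
    (neg_nonpos.2 ht0) hdn.1).trans (mul_le_mul_of_nonneg_left hdn.2 (Real.exp_pos _).le)
  rw [← Real.exp_add] at h1 h2
  have h1' := h1.trans (Real.exp_le_exp.2 (show _ ≤ -x by nlinarith))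
  have h2' := h2.trans (Real.exp_le_exp.2 (show _ ≤ -x by nlinarith))
  refine (measureReal_mono (s₂ := {y | τ + u ≤ ‖y‖ ^ 2} ∪ {y | ‖y‖ ^ 2 ≤ τ - u}) ?_).trans
    ((measureReal_union_le _ _).trans (by linarith))
  intro y hy
  rcases le_abs.1 (show u ≤ |‖y‖ ^ 2 - τ| from hy) with h | h
  · left; show τ + u ≤ ‖y‖ ^ 2; linarith
  · right; show ‖y‖ ^ 2 ≤ τ - u; linarith

end GaussianVectors

/-! ### Uniform concentration by nets -/

/-- The unit ball of a `d`-dimensional normed space has a `1/2`-net of at most `5 ^ d` points. -/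
theorem exists_half_net (E : Type*) [NormedAddCommGroup E] [NormedSpace ℝ E]
    [FiniteDimensional ℝ E] :
    ∃ N : Finset E, N.card ≤ 5 ^ Module.finrank ℝ E ∧ (∀ x ∈ N, ‖x‖ ≤ 1) ∧
      ∀ a : E, ‖a‖ ≤ 1 → ∃ x ∈ N, ‖a - x‖ ≤ 1 / 2 := by
  classical
  -- a `1`-separated subset of the ball of radius `2` of maximal cardinality
  let P : ℕ → Prop := fun k => ∃ s : Finset E, s.card = k ∧ (∀ c ∈ s, ‖c‖ ≤ 2) ∧
    ∀ c ∈ s, ∀ d ∈ s, c ≠ d → 1 ≤ ‖c - d‖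
  have hP0 : P 0 := ⟨∅, by simp⟩
  have hPle : ∀ k, P k → k ≤ 5 ^ Module.finrank ℝ E := by
    rintro k ⟨s, rfl, h1, h2⟩
    exact Besicovitch.card_le_of_separated s h1 h2
  obtain ⟨s, hcard, hs1, hs2⟩ := Nat.findGreatest_spec (P := P) (Nat.zero_le _) hP0
  have hmax : ∀ a : E, ‖a‖ ≤ 2 → ∃ c ∈ s, ‖a - c‖ ≤ 1 := by
    intro a ha
    by_contra! hc
    have has : a ∉ s := fun h => by
      have := hc a h
      rw [sub_self, norm_zero] at this
      linarith
    have hP : P (s.card + 1) := by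
      clear hcard
      refine ⟨insert a s, Finset.card_insert_of_notMem has, ?_, ?_⟩
      · intro c h
        rcases Finset.mem_insert.1 h with rfl | h
        exacts [ha, hs1 c h]
      · intro c h d h' hne
        rcases Finset.mem_insert.1 h with hca | hcs <;>
          rcases Finset.mem_insert.1 h' with hda | hds
        · exact absurd (hca.trans hda.symm) hne
        · rw [hca]; exact (hc d hds).le
        · rw [hda, norm_sub_rev]; exact (hc c hcs).le
        · exact hs2 c hcs d hds hne
    have h1 := Nat.le_findGreatest (hPle _ hP) hP
    rw [← hcard] at h1
    exact absurd h1 (Nat.not_succ_le_self _)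
  refine ⟨s.image fun c => (1 / 2 : ℝ) • c, Finset.card_image_le.trans ?_, ?_, ?_⟩
  · rw [hcard]; exact Nat.findGreatest_le _
  · intro x hx
    obtain ⟨c, hc, rfl⟩ := Finset.mem_image.1 hx
    rw [norm_smul]
    norm_num
    linarith [hs1 c hc]
  · intro a ha
    obtain ⟨c, hc, hac⟩ := hmax ((2 : ℝ) • a) (by rw [norm_smul]; norm_num; linarith)
    refine ⟨_, Finset.mem_image_of_mem _ hc, ?_⟩
    rw [show a - (1 / 2 : ℝ) • c = (1 / 2 : ℝ) • ((2 : ℝ) • a - c) by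
      rw [smul_sub, smul_smul]; norm_num, norm_smul]
    norm_num
    linarith

/-- The operator norm is controlled by the values of the bilinear form on a `1/2`-net. -/
theorem opNorm_le_of_half_net {E : Type*} [NormedAddCommGroup E] [InnerProductSpace ℝ E]
    {N : Finset E} (hN : ∀ a : E, ‖a‖ ≤ 1 → ∃ x ∈ N, ‖a - x‖ ≤ 1 / 2) (S : E →L[ℝ] E) {ε : ℝ}
    (hε : 0 ≤ ε) (h : ∀ x ∈ N, ∀ y ∈ N, |⟪S x, y⟫| ≤ ε) : ‖S‖ ≤ 4 * ε := by
  have key : ∀ w : E, (∀ y ∈ N, |⟪w, y⟫| ≤ ε) → ‖w‖ ≤ 2 * ε := by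
    intro w hw
    rcases eq_or_ne w 0 with rfl | h0
    · simpa using hε
    have hw0 : 0 < ‖w‖ := norm_pos_iff.2 h0
    obtain ⟨y, hy, hd⟩ := hN (‖w‖⁻¹ • w) (by rw [norm_smul, norm_inv, norm_norm]; field_simp; rfl)
    have h1 : ⟪w, ‖w‖⁻¹ • w⟫ = ‖w‖ := by
      rw [real_inner_smul_right, real_inner_self_eq_norm_sq]; field_simp
    have h2 : ⟪w, ‖w‖⁻¹ • w - y⟫ ≤ ‖w‖ * (1 / 2) :=
      (real_inner_le_norm _ _).trans (mul_le_mul_of_nonneg_left hd hw0.le)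
    rw [inner_sub_right, h1] at h2
    linarith [(abs_le.1 (hw y hy)).2]
  have h2 : ‖S‖ ≤ 2 * ε + ‖S‖ / 2 := by
    refine S.opNorm_le_of_unit_norm (by positivity) fun a ha => ?_
    obtain ⟨x, hx, hd⟩ := hN a ha.le
    have h3 := key (S x) (h x hx)
    have h4 : ‖S (a - x)‖ ≤ ‖S‖ * (1 / 2) :=
      (S.le_opNorm _).trans (mul_le_mul_of_nonneg_left hd (norm_nonneg _))
    calc ‖S a‖ = ‖S x + S (a - x)‖ := by rw [← map_add]; congr 2; abel
      _ ≤ _ := (norm_add_le _ _).trans (by linarith)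
  linarith

/-- If `‖X a‖²` is close to `τ ‖a‖²` at the sums and differences of the points of a `1/2`-net,
then it is close to it everywhere. -/
theorem norm_sq_deviation_le_of_half_net {E F : Type*} [NormedAddCommGroup E]
    [InnerProductSpace ℝ E] [FiniteDimensional ℝ E] [NormedAddCommGroup F]
    [InnerProductSpace ℝ F] [FiniteDimensional ℝ F]
    {N : Finset E} (hN1 : ∀ x ∈ N, ‖x‖ ≤ 1)
    (hN : ∀ a : E, ‖a‖ ≤ 1 → ∃ x ∈ N, ‖a - x‖ ≤ 1 / 2) (X : E →ₗ[ℝ] F) {τ ε : ℝ} (hε : 0 ≤ ε)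
    (h : ∀ x ∈ N, ∀ y ∈ N, |‖X (x + y)‖ ^ 2 - τ * ‖x + y‖ ^ 2| ≤ ε * ‖x + y‖ ^ 2 ∧
      |‖X (x - y)‖ ^ 2 - τ * ‖x - y‖ ^ 2| ≤ ε * ‖x - y‖ ^ 2) (a : E) :
    |‖X a‖ ^ 2 - τ * ‖a‖ ^ 2| ≤ 4 * ε * ‖a‖ ^ 2 := by
  let X' : E →L[ℝ] F := X.toContinuousLinearMap
  let S : E →L[ℝ] E := X'.adjoint ∘L X' - τ • ContinuousLinearMap.id ℝ E
  have hS : ∀ x y, ⟪S x, y⟫ = ⟪X x, X y⟫ - τ * ⟪x, y⟫ := by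
    intro x y
    simp [S, X', inner_sub_left, ContinuousLinearMap.adjoint_inner_left, real_inner_smul_left]
  have hnorm : ‖S‖ ≤ 4 * ε := by
    refine opNorm_le_of_half_net hN S hε fun x hx y hy => ?_
    obtain ⟨h1, h2⟩ := h x hx y hy
    rw [map_add] at h1
    rw [map_sub] at h2
    have e1 := norm_add_sq_real (X x) (X y)
    have e2 := norm_sub_sq_real (X x) (X y)
    have e3 := norm_add_sq_real x y
    have e4 := norm_sub_sq_real x y
    have h5 := hN1 x hx
    have h6 := hN1 y hy
    have h7 : ‖x‖ ^ 2 ≤ 1 := pow_le_one₀ (norm_nonneg _) h5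
    have h8 : ‖y‖ ^ 2 ≤ 1 := pow_le_one₀ (norm_nonneg _) h6
    have h9 : ε * (‖x‖ ^ 2 + ‖y‖ ^ 2) ≤ ε * 2 := mul_le_mul_of_nonneg_left (by linarith) hε
    rw [e1, e3] at h1
    rw [e2, e4] at h2
    rw [hS]
    have h1' := abs_le.1 h1
    have h2' := abs_le.1 h2
    exact abs_le.2 ⟨by nlinarith [h1'.1, h2'.2], by nlinarith [h1'.2, h2'.1]⟩
  have h1 : ‖X a‖ ^ 2 - τ * ‖a‖ ^ 2 = ⟪S a, a⟫ := by
    rw [hS, real_inner_self_eq_norm_sq, real_inner_self_eq_norm_sq]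
  rw [h1]
  refine (abs_real_inner_le_norm _ _).trans ?_
  have := (S.le_opNorm a).trans (mul_le_mul_of_nonneg_right hnorm (norm_nonneg a))
  nlinarith [norm_nonneg a]

/-- Uniform concentration of a Gaussian chaos. Let `X a` be Gaussian vectors that depend linearly
on `a` in a `d`-dimensional space, with `𝔼 ‖X a‖² = τ ‖a‖²` and covariance at most `κ ‖a‖²`. Then
`‖X a‖²` is close to `τ ‖a‖²` for all `a` simultaneously, at the scale `√(κτ(d + log (1/p)))`. -/
theorem measure_exists_norm_sq_deviation_le {Ω E F : Type*} [MeasurableSpace Ω]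
    {P : Measure Ω} [IsProbabilityMeasure P] [NormedAddCommGroup E]
    [InnerProductSpace ℝ E] [FiniteDimensional ℝ E] [NormedAddCommGroup F]
    [InnerProductSpace ℝ F] [FiniteDimensional ℝ F] [MeasurableSpace F] [BorelSpace F]
    (X : Ω → E →ₗ[ℝ] F) (hX : ∀ a, HasGaussianLaw (fun ω => X ω a) P)
    (h0 : ∀ a, ∫ ω, X ω a ∂P = 0) {κ τ p : ℝ} (hκ0 : 0 < κ) (hp0 : 0 < p) (hp1 : p ≤ 1)
    (hκ : ∀ a c, ∫ ω, ⟪c, X ω a⟫ ^ 2 ∂P ≤ κ * ‖a‖ ^ 2 * ‖c‖ ^ 2)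
    (hτ : ∀ a, ∫ ω, ‖X ω a‖ ^ 2 ∂P = τ * ‖a‖ ^ 2) {x : ℝ}
    (hx : 4 * Module.finrank ℝ E + 2 + Real.log (1 / p) ≤ x) :
    P {ω | ∃ a, 4 * (4 * √(κ * τ * x) + 8 * κ * x) * ‖a‖ ^ 2 < |‖X ω a‖ ^ 2 - τ * ‖a‖ ^ 2|} ≤
      ENNReal.ofReal p := by
  obtain ⟨N, hNcard, hN1, hN⟩ := exists_half_net E
  have hlog : 0 ≤ Real.log (1 / p) := Real.log_nonneg (by rw [le_div_iff₀ hp0]; linarith)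
  have hx0 : 0 < x := lt_of_lt_of_le (by positivity) hx
  set ε := 4 * √(κ * τ * x) + 8 * κ * x with hε
  have hε0 : 0 ≤ ε := by positivity
  have hpt : ∀ a : E, P {ω | ε * ‖a‖ ^ 2 < |‖X ω a‖ ^ 2 - τ * ‖a‖ ^ 2|} ≤
      ENNReal.ofReal (2 * Real.exp (-x)) := by
    intro a
    rcases eq_or_ne a 0 with rfl | ha
    · simp
    have ha0 : 0 < ‖a‖ := norm_pos_iff.2 ha
    have := (hX a).isGaussian_map
    have hm := (hX a).aemeasurable
    have h1 := measure_norm_sq_gaussian_deviation_le (P.map fun ω => X ω a) (κ := κ * ‖a‖ ^ 2)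
      (τ := τ * ‖a‖ ^ 2) (x := x)
      (by rw [integral_map hm (by fun_prop)]; exact h0 a) (by positivity) hx0
      (fun c => by
        rw [integral_map hm (Measurable.aestronglyMeasurable (by fun_prop))]; exact hκ a c)
      (by rw [integral_map hm (Measurable.aestronglyMeasurable (by fun_prop))]; exact hτ a)
    have h2 : 4 * √(κ * ‖a‖ ^ 2 * (τ * ‖a‖ ^ 2) * x) + 8 * (κ * ‖a‖ ^ 2) * x = ε * ‖a‖ ^ 2 := by
      rw [show κ * ‖a‖ ^ 2 * (τ * ‖a‖ ^ 2) * x = (κ * τ * x) * (‖a‖ ^ 2) ^ 2 by ring,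
        Real.sqrt_mul' _ (by positivity), Real.sqrt_sq (by positivity), hε]
      ring
    rw [h2] at h1
    have h3 := ENNReal.ofReal_le_ofReal h1
    rw [ofReal_measureReal, Measure.map_apply_of_aemeasurable hm
      (measurableSet_le (by fun_prop) (by fun_prop))] at h3
    refine (measure_mono ?_).trans h3
    intro ω hω
    exact le_of_lt (show ε * ‖a‖ ^ 2 < |‖X ω a‖ ^ 2 - τ * ‖a‖ ^ 2| from hω)
  have hsub : {ω | ∃ a, 4 * ε * ‖a‖ ^ 2 < |‖X ω a‖ ^ 2 - τ * ‖a‖ ^ 2|} ⊆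
      ⋃ q ∈ N ×ˢ N, ({ω | ε * ‖q.1 + q.2‖ ^ 2 < |‖X ω (q.1 + q.2)‖ ^ 2 - τ * ‖q.1 + q.2‖ ^ 2|} ∪
        {ω | ε * ‖q.1 - q.2‖ ^ 2 < |‖X ω (q.1 - q.2)‖ ^ 2 - τ * ‖q.1 - q.2‖ ^ 2|}) := by
    rintro ω ⟨a, ha⟩
    by_contra hc
    simp only [Set.mem_iUnion, not_exists, Finset.mem_product, Set.mem_union, not_or,
      Set.mem_ofPred_eq, not_lt, Prod.forall] at hc
    exact absurd (norm_sq_deviation_le_of_half_net hN1 hN (X ω) hε0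
      (fun x hx y hy => hc x y ⟨hx, hy⟩) a) (not_le.2 ha)
  refine (measure_mono hsub).trans ((measure_biUnion_finset_le _ _).trans ?_)
  refine (Finset.sum_le_card_nsmul _ _ (ENNReal.ofReal (4 * Real.exp (-x))) fun q _ => ?_).trans ?_
  · refine (measure_union_le _ _).trans ((add_le_add (hpt _) (hpt _)).trans ?_)
    rw [← ENNReal.ofReal_add (by positivity) (by positivity)]
    exact ENNReal.ofReal_le_ofReal (by linarith)
  · rw [← ENNReal.ofReal_nsmul, nsmul_eq_mul]
    refine ENNReal.ofReal_le_ofReal ?_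
    set d := Module.finrank ℝ E
    have h1 : ((N ×ˢ N).card : ℝ) ≤ 25 ^ d := by
      rw [Finset.card_product]
      have : N.card * N.card ≤ 5 ^ d * 5 ^ d := Nat.mul_le_mul hNcard hNcard
      rw [← mul_pow] at this
      exact_mod_cast this
    have h2 : (25 : ℝ) ≤ Real.exp 4 := by
      have := Real.add_one_le_exp (1 : ℝ)
      have e1 : Real.exp 4 = Real.exp 1 ^ 4 := by rw [← Real.exp_nat_mul]; norm_num
      have e2 := Real.exp_one_gt_d9
      rw [e1]
      calc (25 : ℝ) ≤ 2.7 ^ 4 := by norm_num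
        _ ≤ _ := pow_le_pow_left₀ (by norm_num) (by linarith) 4
    have h3 : (4 : ℝ) ≤ Real.exp 2 := by
      have e1 : Real.exp 2 = Real.exp 1 ^ 2 := by rw [← Real.exp_nat_mul]; norm_num
      have e2 := Real.exp_one_gt_d9
      rw [e1]
      nlinarith
    have h4 : (25 : ℝ) ^ d ≤ Real.exp (4 * d) := by
      rw [mul_comm, Real.exp_nat_mul]
      exact pow_le_pow_left₀ (by norm_num) h2 d
    have h5 : Real.exp (-x) ≤ Real.exp (-(4 * d + 2 + Real.log (1 / p))) :=
      Real.exp_le_exp.2 (by linarith)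
    have h6 : Real.exp (-(4 * d + 2 + Real.log (1 / p))) =
        (Real.exp (4 * d))⁻¹ * (Real.exp 2)⁻¹ * p := by
      rw [one_div, Real.log_inv, ← Real.exp_neg, ← Real.exp_neg]
      conv_rhs => rw [← Real.exp_log hp0]
      rw [← Real.exp_add, ← Real.exp_add]
      congr 1
      ring
    calc ((N ×ˢ N).card : ℝ) * (4 * Real.exp (-x))
        ≤ Real.exp (4 * d) * (Real.exp 2 * ((Real.exp (4 * d))⁻¹ * (Real.exp 2)⁻¹ * p)) := by
          rw [← h6]
          exact mul_le_mul (h1.trans h4) (mul_le_mul h3 h5 (by positivity) (by positivity))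
            (by positivity) (by positivity)
      _ = p := by field_simp

/-! ### Singular values and perturbation of a signal by noise -/

section InnerProduct

variable {E : Type*} [NormedAddCommGroup E] [InnerProductSpace ℝ E]

theorem norm_sq_eq_sum_inner {n : ℕ} (b : OrthonormalBasis (Fin n) ℝ E) (x : E) :
    ‖x‖ ^ 2 = ∑ i, ⟪b i, x⟫ ^ 2 := by
  rw [← b.sum_sq_norm_inner_right]; simp

/-- A symmetric operator is bounded by its quadratic form. -/
theorem norm_apply_le_of_abs_inner_le {S : E →ₗ[ℝ] E} (hS : S.IsSymmetric) {e : ℝ}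
    (h : ∀ x, |⟪S x, x⟫| ≤ e * ‖x‖ ^ 2) (x : E) : ‖S x‖ ≤ e * ‖x‖ := by
  rcases eq_or_ne (S x) 0 with h0 | h0
  · have h1 := (abs_nonneg _).trans (h x)
    rcases eq_or_ne x 0 with rfl | hx
    · simp
    · have : 0 < ‖x‖ := norm_pos_iff.2 hx
      rw [h0, norm_zero]
      by_contra! hc
      nlinarith
  have hx : x ≠ 0 := fun hx => h0 (by rw [hx, map_zero])
  have hx0 : 0 < ‖x‖ := norm_pos_iff.2 hx
  have hs0 : 0 < ‖S x‖ := norm_pos_iff.2 h0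
  set a := ‖x‖ / ‖S x‖ with ha
  set y := a • S x with hy
  have hyn : ‖y‖ = ‖x‖ := by
    rw [hy, norm_smul, Real.norm_of_nonneg (by positivity), ha]; field_simp
  have hxy : ⟪S x, y⟫ = ‖x‖ * ‖S x‖ := by
    rw [hy, real_inner_smul_right, real_inner_self_eq_norm_sq, ha]; field_simp
  have hyx : ⟪S y, x⟫ = ⟪S x, y⟫ := by rw [hS, real_inner_comm]
  have h1 := (abs_le.1 (h (x + y))).2
  have h2 := (abs_le.1 (h (x - y))).1
  have e1 := norm_add_sq_real x y
  have e2 := norm_sub_sq_real x y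
  have e3 : ⟪S (x + y), x + y⟫ = ⟪S x, x⟫ + 2 * ⟪S x, y⟫ + ⟪S y, y⟫ := by
    rw [map_add, inner_add_left, inner_add_right, inner_add_right, hyx]; ring
  have e4 : ⟪S (x - y), x - y⟫ = ⟪S x, x⟫ - 2 * ⟪S x, y⟫ + ⟪S y, y⟫ := by
    rw [map_sub, inner_sub_left, inner_sub_right, inner_sub_right, hyx]; ring
  rw [e1, e3] at h1
  rw [e2, e4] at h2
  rw [hyn] at h1 h2
  rw [hxy] at h1 h2
  have h3 : ‖x‖ * ‖S x‖ ≤ ‖x‖ * (e * ‖x‖) := by nlinarith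
  exact le_of_mul_le_mul_left h3 hx0

theorem inner_apply_self_eq_sum {n : ℕ} (S : E →ₗ[ℝ] E) (b : OrthonormalBasis (Fin n) ℝ E)
    (μ : ℕ → ℝ) (hb : ∀ i : Fin n, S (b i) = μ i • b i) (x : E) :
    ⟪S x, x⟫ = ∑ i : Fin n, μ i * ⟪b i, x⟫ ^ 2 := by
  nth_rewrite 1 [← b.sum_repr' x]
  simp_rw [map_sum, map_smul, hb, sum_inner, real_inner_smul_left]
  exact Finset.sum_congr rfl fun i _ => by ring

end InnerProduct

section LinearAlgebra

variable {E F : Type*} [NormedAddCommGroup E] [InnerProductSpace ℝ E] [FiniteDimensional ℝ E]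
  [NormedAddCommGroup F] [InnerProductSpace ℝ F] [FiniteDimensional ℝ F]

/-- On the range of a linear map, its adjoint expands by at least the smallest nonzero singular
value. -/
theorem singularValues_mul_norm_le_norm_adjoint (T : E →ₗ[ℝ] F) {v : F}
    (hv : v ∈ LinearMap.range T) :
    T.singularValues (Module.finrank ℝ (LinearMap.range T) - 1) * ‖v‖ ≤ ‖T.adjoint v‖ := by
  obtain ⟨w, rfl⟩ := hv
  set k := Module.finrank ℝ (LinearMap.range T)
  set σ := T.singularValues (k - 1)
  have hσ : 0 ≤ σ := T.singularValues_nonneg _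
  have hS := T.isSymmetric_adjoint_comp_self
  let b := hS.eigenvectorBasis rfl
  have hb : ∀ i, T.adjoint (T (b i)) = (T.singularValues i ^ 2) • b i := fun i => by
    have := hS.apply_eigenvectorBasis rfl i
    rwa [← T.sq_singularValues_fin rfl] at this
  have hc : ∀ i, ⟪b i, T.adjoint (T w)⟫ = T.singularValues i ^ 2 * ⟪b i, w⟫ := fun i => by
    rw [LinearMap.adjoint_inner_right, ← LinearMap.adjoint_inner_left, hb, real_inner_smul_left]
  have h1 : ‖T w‖ ^ 2 = ∑ i : Fin (Module.finrank ℝ E), T.singularValues i ^ 2 * ⟪b i, w⟫ ^ 2 := by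
    rw [← real_inner_self_eq_norm_sq, ← LinearMap.adjoint_inner_left, ← b.sum_inner_mul_inner]
    refine Finset.sum_congr rfl fun i _ => ?_
    rw [real_inner_comm, hc]; ring
  have h2 : ‖T.adjoint (T w)‖ ^ 2 =
      ∑ i : Fin (Module.finrank ℝ E), (T.singularValues i ^ 2) ^ 2 * ⟪b i, w⟫ ^ 2 := by
    rw [← b.sum_sq_norm_inner_right]
    refine Finset.sum_congr rfl fun i _ => ?_
    rw [hc, Real.norm_eq_abs, sq_abs, mul_pow]
  refine le_of_sq_le_sq ?_ (norm_nonneg _)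
  rw [mul_pow, h1, h2, Finset.mul_sum]
  refine Finset.sum_le_sum fun i _ => ?_
  rw [← mul_assoc]
  refine mul_le_mul_of_nonneg_right ?_ (sq_nonneg _)
  rcases lt_or_ge (i : ℕ) k with hi | hi
  · have h3 : σ ≤ T.singularValues i := T.singularValues_antitone (by omega)
    have h4 : σ ^ 2 ≤ T.singularValues i ^ 2 := pow_le_pow_left₀ hσ h3 2
    rw [pow_two (T.singularValues i ^ 2)]
    exact mul_le_mul_of_nonneg_right h4 (sq_nonneg _)
  · rw [T.singularValues_eq_zero_iff_le_finrank_range.2 hi]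
    simp

/-- The singular values of a positive operator are its eigenvalues. -/
theorem exists_eigenbasis_singularValues {S : E →ₗ[ℝ] E} (hS : S.IsPositive) {n : ℕ}
    (hn : Module.finrank ℝ E = n) :
    ∃ b : OrthonormalBasis (Fin n) ℝ E, ∀ i : Fin n, S (b i) = S.singularValues i • b i := by
  have hSS := S.isSymmetric_adjoint_comp_self
  refine ⟨hSS.eigenvectorBasis hn, fun i => ?_⟩
  set b := hSS.eigenvectorBasis hn
  set σ := S.singularValues i
  have hσ : 0 ≤ σ := S.singularValues_nonneg _
  have hb : S (S (b i)) = (σ ^ 2) • b i := by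
    have := hSS.apply_eigenvectorBasis hn i
    rw [← S.sq_singularValues_fin hn, LinearMap.comp_apply] at this
    have h2 : S.adjoint (S (b i)) = S (S (b i)) := by rw [hS.isSymmetric.adjoint_eq]
    rw [← h2]
    exact this
  -- `u = S bᵢ - σ bᵢ` satisfies `S u = - σ u`, so it vanishes by positivity
  set u := S (b i) - σ • b i with hu
  have hSu : S u = -σ • u := by
    rw [hu, map_sub, map_smul, hb, smul_sub, smul_smul]
    module
  have h1 : 0 ≤ ⟪S u, u⟫ := by simpa using hS.2 u
  have hu0 : u = 0 := by
    rcases hσ.eq_or_lt with h0 | h0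
    · have h2 : S (S (b i)) = 0 := by rw [hb, ← h0]; simp
      have h3 : ‖S (b i)‖ ^ 2 = 0 := by
        rw [← real_inner_self_eq_norm_sq, hS.isSymmetric, h2, inner_zero_right]
      rw [hu, ← h0, zero_smul, sub_zero]
      exact norm_eq_zero.1 (pow_eq_zero_iff two_ne_zero |>.1 h3)
    · rw [hSu, real_inner_smul_left, real_inner_self_eq_norm_sq] at h1
      have h2 : ‖u‖ ^ 2 ≤ 0 := by nlinarith [sq_nonneg ‖u‖]
      exact norm_eq_zero.1 (pow_eq_zero_iff two_ne_zero |>.1 (le_antisymm h2 (sq_nonneg _)))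
  exact sub_eq_zero.1 hu0

theorem exists_ne_zero_inner_eq_zero {ι : Type*} (b : ι → E) (J : Finset ι)
    (V : Submodule ℝ E) (hJ : J.card < Module.finrank ℝ V) :
    ∃ x ∈ V, x ≠ 0 ∧ ∀ j ∈ J, ⟪b j, x⟫ = 0 := by
  let f : V →ₗ[ℝ] (J → ℝ) :=
    LinearMap.pi fun j => (innerSL ℝ (b j)).toLinearMap ∘ₗ V.subtype
  have h1 : LinearMap.ker f ≠ ⊥ := LinearMap.ker_ne_bot_of_finrank_lt (by simpa using hJ)
  obtain ⟨x, hx, hx0⟩ := Submodule.exists_mem_ne_zero_of_ne_bot h1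
  refine ⟨x, x.2, by simpa using hx0, fun j hj => ?_⟩
  exact congrFun (LinearMap.mem_ker.1 hx) ⟨j, hj⟩

/-- Courant-Fischer, upper bound. -/
theorem eigenvalue_le_of_forall_inner_le {n : ℕ} (S : E →ₗ[ℝ] E)
    (b : OrthonormalBasis (Fin n) ℝ E) {μ : ℕ → ℝ} (hμ : Antitone μ)
    (hb : ∀ i : Fin n, S (b i) = μ i • b i) (V : Submodule ℝ E) {c : ℝ}
    (hV : ∀ x ∈ V, ⟪S x, x⟫ ≤ c * ‖x‖ ^ 2) {i : ℕ} (hi : i < n)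
    (hdim : n ≤ Module.finrank ℝ V + i) : μ i ≤ c := by
  obtain ⟨x, hxV, hx0, hx⟩ := exists_ne_zero_inner_eq_zero b (Finset.Ioi (⟨i, hi⟩ : Fin n)) V
    (by rw [Fin.card_Ioi]; simp only; omega)
  have h1 := hV x hxV
  have h2 : μ i * ‖x‖ ^ 2 ≤ ⟪S x, x⟫ := by
    rw [inner_apply_self_eq_sum S b μ hb, norm_sq_eq_sum_inner b, Finset.mul_sum]
    refine Finset.sum_le_sum fun j _ => ?_
    rcases lt_or_ge (⟨i, hi⟩ : Fin n) j with hj | hj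
    · rw [hx j (Finset.mem_Ioi.2 hj)]; simp
    · exact mul_le_mul_of_nonneg_right (hμ (Fin.le_iff_val_le_val.1 hj)) (sq_nonneg _)
  exact le_of_mul_le_mul_right (h2.trans h1) (by positivity)

/-- Courant-Fischer, lower bound. -/
theorem le_eigenvalue_of_forall_le_inner {n : ℕ} (S : E →ₗ[ℝ] E)
    (b : OrthonormalBasis (Fin n) ℝ E) {μ : ℕ → ℝ} (hμ : Antitone μ)
    (hb : ∀ i : Fin n, S (b i) = μ i • b i) (V : Submodule ℝ E) {c : ℝ}
    (hV : ∀ x ∈ V, c * ‖x‖ ^ 2 ≤ ⟪S x, x⟫) {i : ℕ} (hi : i < n)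
    (hdim : i < Module.finrank ℝ V) : c ≤ μ i := by
  obtain ⟨x, hxV, hx0, hx⟩ := exists_ne_zero_inner_eq_zero b (Finset.Iio (⟨i, hi⟩ : Fin n)) V
    (by rw [Fin.card_Iio]; exact hdim)
  have h1 := hV x hxV
  have h2 : ⟪S x, x⟫ ≤ μ i * ‖x‖ ^ 2 := by
    rw [inner_apply_self_eq_sum S b μ hb, norm_sq_eq_sum_inner b, Finset.mul_sum]
    refine Finset.sum_le_sum fun j _ => ?_
    rcases lt_or_ge j (⟨i, hi⟩ : Fin n) with hj | hj
    · rw [hx j (Finset.mem_Iio.2 hj)]; simp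
    · exact mul_le_mul_of_nonneg_right (hμ (Fin.le_iff_val_le_val.1 hj)) (sq_nonneg _)
  exact le_of_mul_le_mul_right (h1.trans h2) (by positivity)

end LinearAlgebra

section Perturbation

variable {E F : Type*} [NormedAddCommGroup E] [InnerProductSpace ℝ E] [FiniteDimensional ℝ E]
  [NormedAddCommGroup F] [InnerProductSpace ℝ F] [FiniteDimensional ℝ F]

/-- The hypotheses of the deterministic perturbation analysis, for a signal `W` and a noise `N`
(both in the form `v ↦ (⟪yₜ, v⟫)ₜ`): the signal lives on the subspace `V` and has strength at
least `h` there, the noise is nearly isotropic with energy `τ` up to the error `e`, and it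
correlates with the signal at most at the level `b`. -/
structure SignalNoise (V : Submodule ℝ E) (W N : E →ₗ[ℝ] F) (h b e τ : ℝ) : Prop where
  range_le : ∀ q, W.adjoint q ∈ V
  h_pos : 0 < h
  b_nonneg : 0 ≤ b
  signal : ∀ p ∈ V, h * ‖p‖ ≤ ‖W p‖
  cross : ∀ x, ‖N.adjoint (W x)‖ ≤ b * ‖W x‖
  noise : ∀ x, |‖N x‖ ^ 2 - τ * ‖x‖ ^ 2| ≤ e * ‖x‖ ^ 2

namespace SignalNoise

variable {V : Submodule ℝ E} {W N : E →ₗ[ℝ] F} {h b e τ : ℝ}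

theorem inner_gram_self (W : E →ₗ[ℝ] F) (x : E) : ⟪(W.adjoint ∘ₗ W) x, x⟫ = ‖W x‖ ^ 2 := by
  rw [LinearMap.comp_apply, LinearMap.adjoint_inner_left, real_inner_self_eq_norm_sq]

theorem abs_cross_le (H : SignalNoise V W N h b e τ) (x y : E) :
    |⟪W x, N y⟫| ≤ b * ‖W x‖ * ‖y‖ := by
  rw [← LinearMap.adjoint_inner_left]
  exact (abs_real_inner_le_norm _ _).trans
    (mul_le_mul_of_nonneg_right (H.cross x) (norm_nonneg _))

theorem inner_gram_le_of_mem_orthogonal (H : SignalNoise V W N h b e τ) {x : E} (hx : x ∈ Vᗮ) :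
    ⟪((W + N).adjoint ∘ₗ (W + N)) x, x⟫ ≤ (τ + e) * ‖x‖ ^ 2 := by
  have hW : W x = 0 := by
    rw [← norm_eq_zero, ← pow_eq_zero_iff two_ne_zero, ← real_inner_self_eq_norm_sq,
      ← LinearMap.adjoint_inner_left]
    exact Submodule.inner_right_of_mem_orthogonal (H.range_le _) hx
  rw [inner_gram_self, LinearMap.add_apply, hW, zero_add]
  linarith [(abs_le.1 (H.noise x)).2]

theorem norm_add_sq_ge (H : SignalNoise V W N h b e τ) (x : E) :
    (τ - e) * ‖x‖ ^ 2 + ‖W x‖ ^ 2 - 2 * b * ‖W x‖ * ‖x‖ ≤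
      ⟪((W + N).adjoint ∘ₗ (W + N)) x, x⟫ := by
  rw [inner_gram_self, LinearMap.add_apply, norm_add_sq_real]
  linarith [(abs_le.1 (H.noise x)).1, (abs_le.1 (H.abs_cross_le x x)).1]

theorem le_inner_gram (H : SignalNoise V W N h b e τ) (x : E) :
    (τ - e - b ^ 2) * ‖x‖ ^ 2 ≤ ⟪((W + N).adjoint ∘ₗ (W + N)) x, x⟫ := by
  refine le_trans ?_ (H.norm_add_sq_ge x)
  nlinarith [sq_nonneg (‖W x‖ - b * ‖x‖)]

theorem le_inner_gram_of_mem (H : SignalNoise V W N h b e τ) (hbh : b ≤ h) {x : E} (hx : x ∈ V) :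
    (τ - e + (h ^ 2 - 2 * b * h)) * ‖x‖ ^ 2 ≤ ⟪((W + N).adjoint ∘ₗ (W + N)) x, x⟫ := by
  refine le_trans ?_ (H.norm_add_sq_ge x)
  have h1 := H.signal x hx
  have h2 := norm_nonneg x
  have h3 := H.h_pos
  -- `z ↦ z² - 2 b z` is increasing on `[b, ∞)`
  have h4 : 0 ≤ (‖W x‖ - h * ‖x‖) * (‖W x‖ + h * ‖x‖ - 2 * b * ‖x‖) := by
    refine mul_nonneg (by linarith) ?_
    nlinarith
  nlinarith

/-- A `sin Θ` bound. If `R` is a contraction that commutes with the Gram operator of `W + N`,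
which is close to `τ` on the range of `R`, then `R` nearly annihilates `V`. The error is linear
in the noise level `b / h`, and does not involve the norm of the signal. -/
theorem norm_apply_le (H : SignalNoise V W N h b e τ) (he : 0 ≤ e) (hb : 8 * b ≤ h)
    (R : E →ₗ[ℝ] E) (hR1 : ∀ x, ‖R x‖ ≤ ‖x‖) {l : ℝ} (hl : 4 * l ≤ h ^ 2)
    (hcomm : ∀ x, R (((W + N).adjoint ∘ₗ (W + N)) x) = ((W + N).adjoint ∘ₗ (W + N)) (R x))
    (htail : ∀ x, ‖((W + N).adjoint ∘ₗ (W + N)) (R x) - τ • R x‖ ≤ l * ‖R x‖)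
    {z : E} (hz : z ∈ V) : ‖R z‖ ≤ (4 * (b / h) + 4 * (e / h ^ 2)) * ‖z‖ := by
  have h0 := H.h_pos
  have hb0 := H.b_nonneg
  let RV : V →L[ℝ] E := (R ∘ₗ V.subtype).toContinuousLinearMap
  set θ := ‖RV‖ with hθ
  have hθ0 : 0 ≤ θ := norm_nonneg RV
  have hθle : ∀ p ∈ V, ‖R p‖ ≤ θ * ‖p‖ := fun p hp => RV.le_opNorm ⟨p, hp⟩
  let D : E →ₗ[ℝ] E := N.adjoint ∘ₗ N - τ • LinearMap.id
  have hD : ∀ x, ‖D x‖ ≤ e * ‖x‖ := by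
    refine norm_apply_le_of_abs_inner_le ?_ fun x => ?_
    · intro x y
      simp [D, inner_sub_left, inner_sub_right, LinearMap.adjoint_inner_left,
        LinearMap.adjoint_inner_right, real_inner_smul_left, real_inner_smul_right]
    · have : ⟪D x, x⟫ = ‖N x‖ ^ 2 - τ * ‖x‖ ^ 2 := by
        simp [D, inner_sub_left, LinearMap.adjoint_inner_left, real_inner_smul_left]
      rw [this]; exact H.noise x
  -- every element of `V` has the form `Wᵀ (W + N) p` with `p ∈ V`
  let G : V →ₗ[ℝ] V := LinearMap.codRestrict V (W.adjoint ∘ₗ (W + N) ∘ₗ V.subtype)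
    fun p => H.range_le _
  have hG : ∀ p : V, h / 2 * ‖W p‖ ≤ ‖G p‖ := by
    intro p
    rcases eq_or_ne p 0 with rfl | hp
    · simp
    have hp0 : 0 < ‖(p : E)‖ := norm_pos_iff.2 (by simpa using hp)
    have h1 : ⟪((G p : V) : E), (p : E)⟫ = ‖W p‖ ^ 2 + ⟪W p, N p⟫ := by
      change ⟪W.adjoint ((W + N) p), (p : E)⟫ = _
      rw [LinearMap.adjoint_inner_left, LinearMap.add_apply, inner_add_left,
        real_inner_self_eq_norm_sq, real_inner_comm (W p)]
    have h2 := real_inner_le_norm ((G p : V) : E) (p : E)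
    have h3 := (abs_le.1 (H.abs_cross_le (p : E) p)).1
    have h4 := H.signal p p.2
    have h5 : ‖((G p : V) : E)‖ = ‖G p‖ := rfl
    rw [h5, h1] at h2
    have hWp := norm_nonneg (W p)
    have h6 : b * ‖W p‖ * ‖(p : E)‖ ≤ ‖W p‖ * ‖W p‖ / 8 := by
      have : b * ‖(p : E)‖ ≤ ‖W p‖ / 8 := by nlinarith
      nlinarith
    have h7 : h / 2 * ‖W p‖ * ‖(p : E)‖ ≤ ‖G p‖ * ‖(p : E)‖ := by
      have : h * ‖(p : E)‖ * ‖W p‖ ≤ ‖W p‖ * ‖W p‖ := mul_le_mul_of_nonneg_right h4 hWp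
      nlinarith
    exact le_of_mul_le_mul_right h7 hp0
  have hGp : ∀ p : V, h ^ 2 / 2 * ‖(p : E)‖ ≤ ‖G p‖ := fun p => by
    nlinarith [hG p, H.signal p p.2]
  have hGinj : Function.Injective G := by
    refine (injective_iff_map_eq_zero G).2 fun p hp => ?_
    have h1 := hGp p
    rw [hp, norm_zero] at h1
    have h2 : ‖(p : E)‖ ≤ 0 := by
      by_contra! hc
      have : 0 < h ^ 2 / 2 * ‖(p : E)‖ := by positivity
      linarith
    simpa using h2
  have hGsurj : Function.Surjective G := LinearMap.injective_iff_surjective.1 hGinj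
  have key : ∀ z : V, ‖R z‖ ≤ (θ / 2 + 2 * (b / h) + 2 * (e / h ^ 2)) * ‖z‖ := by
    intro z
    obtain ⟨p, rfl⟩ := hGsurj z
    have h1 : R (G p) = (((W + N).adjoint ∘ₗ (W + N)) (R p) - τ • R p) -
        R (N.adjoint (W p)) - R (D p) := by
      rw [← hcomm]
      have : ((G p : V) : E) = ((W + N).adjoint ∘ₗ (W + N)) p - τ • (p : E) -
          N.adjoint (W p) - D p := by
        change W.adjoint ((W + N) p) = _
        simp only [D, LinearMap.comp_apply, map_add, LinearMap.add_apply, LinearMap.sub_apply,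
          LinearMap.smul_apply, LinearMap.id_apply]
        abel
      rw [this, map_sub, map_sub, map_sub, map_smul]
    have h2 : ‖R (G p)‖ ≤ l * ‖R p‖ + b * ‖W p‖ + e * ‖(p : E)‖ := by
      rw [h1]
      refine (norm_sub_le _ _).trans (add_le_add ((norm_sub_le _ _).trans
        (add_le_add (htail p) ?_)) ((hR1 _).trans (hD p)))
      exact (hR1 _).trans (H.cross p)
    have h3 : l * ‖R p‖ ≤ θ / 2 * ‖G p‖ := by
      have h4 := hθle p p.2
      have h5 : l * ‖R p‖ ≤ h ^ 2 / 4 * ‖R p‖ :=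
        mul_le_mul_of_nonneg_right (by linarith) (norm_nonneg _)
      have h6 : h ^ 2 / 4 * ‖R p‖ ≤ h ^ 2 / 4 * (θ * ‖(p : E)‖) :=
        mul_le_mul_of_nonneg_left h4 (by positivity)
      have h7 : θ / 2 * (h ^ 2 / 2 * ‖(p : E)‖) ≤ θ / 2 * ‖G p‖ :=
        mul_le_mul_of_nonneg_left (hGp p) (by positivity)
      linarith
    have h4 : b * ‖W p‖ ≤ 2 * (b / h) * ‖G p‖ := by
      have : 2 * (b / h) * (h / 2 * ‖W p‖) ≤ 2 * (b / h) * ‖G p‖ :=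
        mul_le_mul_of_nonneg_left (hG p) (by positivity)
      have e1 : 2 * (b / h) * (h / 2 * ‖W p‖) = b * ‖W p‖ := by field_simp
      linarith
    have h5 : e * ‖(p : E)‖ ≤ 2 * (e / h ^ 2) * ‖G p‖ := by
      have : 2 * (e / h ^ 2) * (h ^ 2 / 2 * ‖(p : E)‖) ≤ 2 * (e / h ^ 2) * ‖G p‖ :=
        mul_le_mul_of_nonneg_left (hGp p) (by positivity)
      have e1 : 2 * (e / h ^ 2) * (h ^ 2 / 2 * ‖(p : E)‖) = e * ‖(p : E)‖ := by field_simp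
      linarith
    calc ‖R (G p)‖ ≤ _ := h2
      _ ≤ _ := by linarith
  have hθ2 : θ ≤ θ / 2 + 2 * (b / h) + 2 * (e / h ^ 2) :=
    RV.opNorm_le_bound (by positivity) key
  exact (hθle z hz).trans (mul_le_mul_of_nonneg_right (by linarith) (norm_nonneg _))

end SignalNoise

end Perturbation

/-! ### Deterministic guarantee of PCA -/

/-- The analysis operator `v ↦ (⟪yₜ, v⟫)ₜ` of a finite family of vectors. -/
def analysis {E : Type*} [NormedAddCommGroup E] [InnerProductSpace ℝ E] {N : ℕ} (y : Fin N → E) :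
    E →ₗ[ℝ] EuclideanSpace ℝ (Fin N) where
  toFun v := WithLp.toLp 2 fun t => ⟪y t, v⟫
  map_add' u v := by ext t; simp [inner_add_right]
  map_smul' c v := by ext t; simp [real_inner_smul_right]

theorem analysis_apply {E : Type*} [NormedAddCommGroup E] [InnerProductSpace ℝ E] {N : ℕ}
    (y : Fin N → E) (v : E) (t : Fin N) : analysis y v t = ⟪y t, v⟫ := rfl

theorem analysis_add {E : Type*} [NormedAddCommGroup E] [InnerProductSpace ℝ E] {N : ℕ}
    (y z : Fin N → E) : analysis (fun t => y t + z t) = analysis y + analysis z := by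
  ext v t
  simp [analysis_apply, inner_add_left]

theorem adjoint_analysis_apply {E : Type*} [NormedAddCommGroup E] [InnerProductSpace ℝ E]
    [FiniteDimensional ℝ E] {N : ℕ} (y : Fin N → E) (q : EuclideanSpace ℝ (Fin N)) :
    (analysis y).adjoint q = ∑ t, q t • y t := by
  refine ext_inner_right ℝ fun v => ?_
  rw [LinearMap.adjoint_inner_left, sum_inner]
  simp only [real_inner_smul_left, PiLp.inner_apply, analysis_apply]
  exact Finset.sum_congr rfl fun t _ => by simp [mul_comm]

theorem analysis_comp_adjoint {E F : Type*} [NormedAddCommGroup E] [InnerProductSpace ℝ E]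
    [FiniteDimensional ℝ E] [NormedAddCommGroup F] [InnerProductSpace ℝ F]
    [FiniteDimensional ℝ F] {N : ℕ} (y : Fin N → E) (C : E →ₗ[ℝ] F) :
    analysis (fun t => C (y t)) = analysis y ∘ₗ C.adjoint := by
  ext v t
  simp [analysis_apply, LinearMap.adjoint_inner_right]

theorem toEuclideanLin_transpose {α β : Type*} [Fintype α] [Fintype β] [DecidableEq α]
    [DecidableEq β] (P : Matrix α β ℝ) :
    Pᵀ.toEuclideanLin = P.toEuclideanLin.adjoint := by
  rw [← Matrix.toEuclideanLin_conjTranspose_eq_adjoint, Matrix.conjTranspose_eq_transpose_of_trivial]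

theorem toEuclideanLin_mul_apply {α β γ : Type*} [Fintype α] [Fintype β] [Fintype γ]
    [DecidableEq β] [DecidableEq γ] (P : Matrix α β ℝ) (Q : Matrix β γ ℝ)
    (v : EuclideanSpace ℝ γ) :
    (P * Q).toEuclideanLin v = P.toEuclideanLin (Q.toEuclideanLin v) := by
  ext i
  simp [Matrix.toLpLin_apply, Matrix.mulVec_mulVec]

theorem sampleCov_toEuclideanLin {n T : ℕ} (Y : Fin (T + 1) → Vec n) :
    (sampleCov Y).toEuclideanLin = (analysis Y).adjoint ∘ₗ analysis Y := by
  ext v i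
  rw [LinearMap.comp_apply, adjoint_analysis_apply]
  simp only [sampleCov, Matrix.toLpLin_apply, Matrix.sum_mulVec, analysis_apply]
  simp only [Finset.sum_apply, WithLp.ofLp_sum, WithLp.ofLp_smul, Pi.smul_apply, smul_eq_mul]
  refine Finset.sum_congr rfl fun t _ => ?_
  simp [Matrix.vecMulVec_apply, Matrix.mulVec, dotProduct, PiLp.inner_apply, Finset.sum_mul]
  exact Finset.sum_congr rfl fun j _ => by ring

section Spectral

variable {E : Type*} [NormedAddCommGroup E] [InnerProductSpace ℝ E] [FiniteDimensional ℝ E]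

/-- Let the isometry `Q` parametrize eigenvectors of a symmetric operator `S` for its `s` largest
eigenvalues, separated from the others by a gap. Then the complementary projection `1 - QQᵀ` is
a contraction, commutes with `S`, and maps into the span of the other eigenvectors. -/
theorem complement_of_top_eigenvectors {n s : ℕ} {S : E →ₗ[ℝ] E} (hS : S.IsSymmetric)
    (b : OrthonormalBasis (Fin n) ℝ E) {μ : ℕ → ℝ} (hμ : Antitone μ)
    (hb : ∀ i : Fin n, S (b i) = μ i • b i) (hs : 0 < s) (hsn : s < n) (hgap : μ s < μ (s - 1))
    (Q : EuclideanSpace ℝ (Fin s) →ₗ[ℝ] E) (hQ : ∀ x, Q.adjoint (Q x) = x)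
    (hSQ : ∀ x, S (Q x) = Q (WithLp.toLp 2 fun i => μ i * x i)) :
    (∀ x, ‖x - Q (Q.adjoint x)‖ ≤ ‖x‖) ∧
    (∀ x, S x - Q (Q.adjoint (S x)) = S (x - Q (Q.adjoint x))) ∧
    ∀ x (j : Fin n), (j : ℕ) < s → ⟪b j, x - Q (Q.adjoint x)⟫ = 0 := by
  have hQS : ∀ x, Q.adjoint (S x) = WithLp.toLp 2 fun i : Fin s => μ i * Q.adjoint x i := by
    intro x
    refine ext_inner_right ℝ fun y => ?_
    rw [LinearMap.adjoint_inner_left, hS, hSQ, ← LinearMap.adjoint_inner_left]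
    simp only [PiLp.inner_apply]
    exact Finset.sum_congr rfl fun i _ => by simp; ring
  have hnorm : ∀ x, ‖x - Q (Q.adjoint x)‖ ^ 2 = ‖x‖ ^ 2 - ‖Q.adjoint x‖ ^ 2 := by
    intro x
    rw [norm_sub_sq_real, ← LinearMap.adjoint_inner_left, real_inner_self_eq_norm_sq,
      ← real_inner_self_eq_norm_sq (Q (Q.adjoint x)), ← LinearMap.adjoint_inner_left, hQ,
      real_inner_self_eq_norm_sq]
    ring
  refine ⟨fun x => ?_, fun x => ?_, ?_⟩
  · refine le_of_sq_le_sq ?_ (norm_nonneg _)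
    rw [hnorm]; linarith [sq_nonneg ‖Q.adjoint x‖]
  · rw [map_sub, hSQ, hQS]
  have h0 : ∀ j : Fin n, s ≤ (j : ℕ) → Q.adjoint (b j) = 0 := by
    intro j hj
    have h1 := hQS (b j)
    rw [hb, map_smul] at h1
    ext i
    have h2 := congrArg (fun v : EuclideanSpace ℝ (Fin s) => v i) h1
    simp only [WithLp.ofLp_smul, Pi.smul_apply, smul_eq_mul] at h2
    have h3 : μ j < μ i :=
      (hμ hj).trans_lt (hgap.trans_le (hμ (by have := i.2; omega)))
    have h4 : (μ i - μ j) * Q.adjoint (b j) i = 0 := by linarith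
    simpa using (mul_eq_zero.1 h4).resolve_left (by linarith)
  -- the squared norms `‖Qᵀ bⱼ‖² ≤ 1` sum to `s`, and vanish for `j ≥ s`
  have hle : ∀ j, ‖Q.adjoint (b j)‖ ^ 2 ≤ 1 := by
    intro j
    have := hnorm (b j)
    rw [b.norm_eq_one] at this
    linarith [sq_nonneg ‖b j - Q (Q.adjoint (b j))‖]
  have hsum : ∑ j, ‖Q.adjoint (b j)‖ ^ 2 = s := by
    have h1 : ∀ j, ‖Q.adjoint (b j)‖ ^ 2 =
        ∑ i, ⟪b j, Q (EuclideanSpace.basisFun (Fin s) ℝ i)⟫ ^ 2 := by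
      intro j
      rw [← (EuclideanSpace.basisFun (Fin s) ℝ).sum_sq_norm_inner_left]
      refine Finset.sum_congr rfl fun i _ => ?_
      rw [LinearMap.adjoint_inner_left, Real.norm_eq_abs, sq_abs]
    simp_rw [h1]
    rw [Finset.sum_comm]
    simp_rw [← norm_sq_eq_sum_inner b]
    have h2 : ∀ i, ‖Q (EuclideanSpace.basisFun (Fin s) ℝ i)‖ ^ 2 = 1 := by
      intro i
      rw [← real_inner_self_eq_norm_sq, ← LinearMap.adjoint_inner_left, hQ,
        real_inner_self_eq_norm_sq, OrthonormalBasis.norm_eq_one, one_pow]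
    rw [Finset.sum_congr rfl fun i _ => h2 i]
    simp
  have hone : ∀ j : Fin n, (j : ℕ) < s → ‖Q.adjoint (b j)‖ ^ 2 = 1 := by
    have h1 : ∑ j : Fin n, ((if (j : ℕ) < s then 1 else 0) - ‖Q.adjoint (b j)‖ ^ 2) = 0 := by
      rw [Finset.sum_sub_distrib, hsum, Finset.sum_ite, Finset.sum_const_zero, add_zero,
        Finset.sum_const, nsmul_eq_mul, mul_one]
      have h2 : (Finset.univ.filter fun j : Fin n => (j : ℕ) < s).card = s := by
        have : (Finset.univ.filter fun j : Fin n => (j : ℕ) < s) = Finset.Iio ⟨s, hsn⟩ := by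
          ext j; simp [Fin.lt_def]
        rw [this, Fin.card_Iio]
      rw [h2, sub_self]
    intro j hj
    have h2 := (Finset.sum_eq_zero_iff_of_nonneg fun j _ => ?_).1 h1 j (Finset.mem_univ _)
    · rw [if_pos hj] at h2; linarith
    · split_ifs with h
      · linarith [hle j]
      · rw [h0 j (not_lt.1 h)]; simp
  intro x j hj
  have h1 : b j - Q (Q.adjoint (b j)) = 0 := by
    rw [← norm_eq_zero, ← pow_eq_zero_iff two_ne_zero, hnorm, b.norm_eq_one, hone j hj]; simp
  have h2 : ⟪b j, x - Q (Q.adjoint x)⟫ = ⟪b j - Q (Q.adjoint (b j)), x⟫ := by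
    rw [inner_sub_right, inner_sub_left, ← LinearMap.adjoint_inner_left Q,
      ← LinearMap.adjoint_inner_right Q]
  rw [h2, h1, inner_zero_left]

end Spectral

theorem norm_apply_sub_smul_le {E : Type*} [NormedAddCommGroup E] [InnerProductSpace ℝ E]
    {n s : ℕ} (S : E →ₗ[ℝ] E) (b : OrthonormalBasis (Fin n) ℝ E)
    {μ : ℕ → ℝ} (hb : ∀ i : Fin n, S (b i) = μ i • b i) (hS : S.IsSymmetric) {τ l : ℝ}
    (hl : ∀ j, s ≤ j → j < n → |μ j - τ| ≤ l) (hl0 : 0 ≤ l) {x : E}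
    (hx : ∀ j : Fin n, (j : ℕ) < s → ⟪b j, x⟫ = 0) : ‖S x - τ • x‖ ≤ l * ‖x‖ := by
  refine le_of_sq_le_sq ?_ (by positivity)
  rw [mul_pow, norm_sq_eq_sum_inner b, norm_sq_eq_sum_inner b, Finset.mul_sum]
  refine Finset.sum_le_sum fun j _ => ?_
  have h1 : ⟪b j, S x - τ • x⟫ = (μ j - τ) * ⟪b j, x⟫ := by
    rw [inner_sub_right, ← hS, hb, real_inner_smul_left, real_inner_smul_right]; ring
  rcases lt_or_ge (j : ℕ) s with hj | hj
  · rw [h1, hx j hj]; simp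
  · rw [h1, mul_pow]
    exact mul_le_mul_of_nonneg_right (sq_le_sq' (by linarith [(abs_le.1 (hl j hj j.2)).1])
      (abs_le.1 (hl j hj j.2)).2) (sq_nonneg _)

theorem rankEst_eq {n T s : ℕ} (Y : Fin (T + 1) → Vec n) (hs : 0 < s) (hsn : s < n)
    (h1 : (T : ℝ) ^ (3 / 4 : ℝ) < sv (sampleCov Y) (s - 1) - sv (sampleCov Y) s)
    (h2 : ∀ i, s < i → i < n →
      sv (sampleCov Y) (i - 1) - sv (sampleCov Y) i ≤ (T : ℝ) ^ (3 / 4 : ℝ)) :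
    rankEst Y = s := by
  classical
  unfold rankEst
  apply le_antisymm
  · refine Finset.sup_le fun i hi => ?_
    rw [Finset.mem_filter, Finset.mem_Icc] at hi
    by_contra! hc
    exact absurd hi.2 (not_lt.2 (h2 i hc (by omega)))
  · have : s ∈ (Finset.Icc 1 (n - 1)).filter fun i =>
        (T : ℝ) ^ (3 / 4 : ℝ) < sv (sampleCov Y) (i - 1) - sv (sampleCov Y) i := by
      rw [Finset.mem_filter, Finset.mem_Icc]
      exact ⟨by omega, h1⟩
    convert! Finset.le_sup (f := id) this

/-- Deterministic guarantee of PCA: if the signal dominates the noise, the rank is estimated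
correctly and the computed eigenvectors nearly span the signal subspace. -/
theorem SignalNoise.pca {n T s : ℕ} {Y : Fin (T + 1) → Vec n} {V : Submodule ℝ (Vec n)}
    {W N : Vec n →ₗ[ℝ] EuclideanSpace ℝ (Fin (T + 1))} {h b e τ : ℝ}
    (H : SignalNoise V W N h b e τ) (hY : analysis Y = W + N) (hV : Module.finrank ℝ V = s)
    (hs : 0 < s) (hsn : s < n) (he0 : 0 ≤ e) (hb : 8 * b ≤ h) (he : 16 * e ≤ h ^ 2)
    (hgap : (T : ℝ) ^ (3 / 4 : ℝ) < h ^ 2 / 2) (htail : 2 * e + b ^ 2 ≤ (T : ℝ) ^ (3 / 4 : ℝ)) :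
    rankEst Y = s ∧ ∀ Φ : Matrix (Fin n) (Fin s) ℝ, Φᵀ * Φ = 1 →
      (sampleCov Y * Φ = Φ * Matrix.diagonal fun i : Fin s => sv (sampleCov Y) i) →
      ∀ z ∈ V, ‖z - (Φ * Φᵀ).toEuclideanLin z‖ ≤ (4 * (b / h) + 4 * (e / h ^ 2)) * ‖z‖ := by
  have hh := H.h_pos
  have hb0 := H.b_nonneg
  have hSdef : (sampleCov Y).toEuclideanLin = (W + N).adjoint ∘ₗ (W + N) := by
    rw [sampleCov_toEuclideanLin, hY]
  set S := (sampleCov Y).toEuclideanLin with hS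
  have hpos : S.IsPositive := by
    rw [hSdef]; exact (W + N).isPositive_adjoint_comp_self
  obtain ⟨bs, hbs⟩ := exists_eigenbasis_singularValues hpos
    (n := n) (by simp)
  set μ : ℕ → ℝ := fun i => sv (sampleCov Y) i with hμdef
  have hμ : Antitone μ := S.singularValues_antitone
  have hbs' : ∀ i : Fin n, S (bs i) = μ i • bs i := hbs
  have hVo : n ≤ Module.finrank ℝ Vᗮ + s := by
    have := V.finrank_add_finrank_orthogonal
    rw [hV, finrank_euclideanSpace_fin] at this
    omega
  have hup : μ s ≤ τ + e := by
    refine eigenvalue_le_of_forall_inner_le S bs hμ hbs' Vᗮ (fun x hx => ?_) hsn ?_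
    · rw [hSdef]; exact H.inner_gram_le_of_mem_orthogonal hx
    · exact hVo
  have hlow : ∀ i, i < n → τ - e - b ^ 2 ≤ μ i := by
    intro i hi
    refine le_eigenvalue_of_forall_le_inner S bs hμ hbs' ⊤ (fun x _ => ?_) hi (by simpa using hi)
    rw [hSdef]; exact H.le_inner_gram x
  have htop : τ - e + (h ^ 2 - 2 * b * h) ≤ μ (s - 1) := by
    refine le_eigenvalue_of_forall_le_inner S bs hμ hbs' V (fun x hx => ?_) (by omega)
      (lt_of_lt_of_eq (by omega) hV.symm)
    rw [hSdef]; exact H.le_inner_gram_of_mem (by linarith) hx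
  have hbh : 8 * b * h ≤ h ^ 2 := by nlinarith
  have hgap' : (T : ℝ) ^ (3 / 4 : ℝ) < μ (s - 1) - μ s := by linarith
  refine ⟨rankEst_eq Y hs hsn hgap' fun i hi hin => ?_, fun Φ hΦ hSΦ z hz => ?_⟩
  · have h1 : μ (i - 1) ≤ μ s := hμ (by omega)
    have h2 := hlow i hin
    change μ (i - 1) - μ i ≤ _
    linarith
  set Q := Φ.toEuclideanLin with hQ
  have hQadj : Q.adjoint = Φᵀ.toEuclideanLin := (toEuclideanLin_transpose Φ).symm
  have hTpos : 0 ≤ (T : ℝ) ^ (3 / 4 : ℝ) := by positivity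
  obtain ⟨hR1, hR2, hR3⟩ := complement_of_top_eigenvectors hpos.isSymmetric bs hμ hbs' hs hsn
    (by linarith) Q
    (fun x => by rw [hQadj, hQ, ← toEuclideanLin_mul_apply, hΦ]; simp)
    (fun x => by
      rw [hS, hQ, ← toEuclideanLin_mul_apply, hSΦ, toEuclideanLin_mul_apply]
      congr 1
      ext i
      simp [Matrix.toLpLin_apply, Matrix.mulVec_diagonal, hμdef])
  have hPz : ∀ z, (Φ * Φᵀ).toEuclideanLin z = Q (Q.adjoint z) := fun z => by
    rw [toEuclideanLin_mul_apply, hQadj]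
  have hb2 : b ^ 2 ≤ h ^ 2 / 64 := by nlinarith
  have hcontr := H.norm_apply_le he0 hb (LinearMap.id - Q ∘ₗ Q.adjoint) (l := e + b ^ 2)
    (fun x => by simpa using hR1 x) (by linarith)
    (fun x => by rw [← hSdef]; simpa using hR2 x)
    (fun x => by
      rw [← hSdef]
      refine norm_apply_sub_smul_le (s := s) S bs hbs' hpos.isSymmetric (fun j hj hjn => ?_)
        (by positivity) (fun j hj => by simpa using hR3 x j hj)
      have h1 := hlow j hjn
      have h2 : μ j ≤ μ s := hμ hj
      rw [abs_le]
      constructor <;> nlinarith [sq_nonneg b])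
    hz
  rw [hPz]
  simpa using hcontr

/-! ### Moments and concentration of the observation noise -/

instance isGaussian_pi_multivariateGaussian {d N : ℕ} (S : Matrix (Fin d) (Fin d) ℝ) :
    IsGaussian (Measure.pi fun _ : Fin N => multivariateGaussian (0 : Vec d) S) :=
  isGaussian_pi _

section Pi

variable {d N : ℕ} {S : Matrix (Fin d) (Fin d) ℝ}

theorem integral_inner_multivariateGaussian (a : Vec d) :
    ∫ x, ⟪a, x⟫ ∂(multivariateGaussian (0 : Vec d) S) = 0 := by
  have := (innerSL ℝ a).integral_comp_comm
    (IsGaussian.integrable_fun_id (μ := multivariateGaussian (0 : Vec d) S))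
  simp only [innerSL_apply_apply, integral_id_multivariateGaussian, inner_zero_right] at this
  exact this

theorem memLp_inner_multivariateGaussian (a : Vec d) :
    MemLp (fun x => ⟪a, x⟫) 2 (multivariateGaussian (0 : Vec d) S) :=
  IsGaussian.memLp_dual _ (innerSL ℝ a) 2 (by simp)

theorem variance_inner_multivariateGaussian (hS : S.PosSemidef) (a : Vec d) :
    Var[fun x => ⟪a, x⟫; multivariateGaussian (0 : Vec d) S] = ⟪a, S.toEuclideanLin a⟫ := by
  rw [← covarianceBilin_self IsGaussian.memLp_two_id, covarianceBilin_multivariateGaussian hS]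
  simp [PiLp.inner_apply, dotProduct, Matrix.toLpLin_apply, mul_comm]

theorem memLp_sum_inner_pi (a : Fin N → Vec d) :
    MemLp (fun ξ : Fin N → Vec d => ∑ j, ⟪a j, ξ j⟫) 2
      (Measure.pi fun _ => multivariateGaussian (0 : Vec d) S) :=
  memLp_finsetSum _ fun j _ => (memLp_inner_multivariateGaussian (a j)).comp_measurePreserving
    (measurePreserving_eval _ j)

theorem integral_sum_inner_pi (a : Fin N → Vec d) :
    ∫ ξ : Fin N → Vec d, ∑ j, ⟪a j, ξ j⟫
      ∂(Measure.pi fun _ => multivariateGaussian (0 : Vec d) S) = 0 := by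
  have hint : ∀ j ∈ Finset.univ, Integrable (fun ξ : Fin N → Vec d => ⟪a j, ξ j⟫)
      (Measure.pi fun _ => multivariateGaussian (0 : Vec d) S) := fun j _ =>
    ((memLp_inner_multivariateGaussian (a j)).comp_measurePreserving
      (measurePreserving_eval _ j)).integrable one_le_two
  rw [integral_finsetSum _ hint]
  refine Finset.sum_eq_zero fun j _ => ?_
  have h := integral_comp_eval (μ := fun _ : Fin N => multivariateGaussian (0 : Vec d) S) (i := j)
    (f := fun x => ⟪a j, x⟫) (Measurable.aestronglyMeasurable (by fun_prop))
  rw [h, integral_inner_multivariateGaussian]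

theorem integral_sum_inner_sq_pi (hS : S.PosSemidef) (a : Fin N → Vec d) :
    ∫ ξ : Fin N → Vec d, (∑ j, ⟪a j, ξ j⟫) ^ 2
      ∂(Measure.pi fun _ => multivariateGaussian (0 : Vec d) S) =
      ∑ j, ⟪a j, S.toEuclideanLin (a j)⟫ := by
  rw [← variance_of_integral_eq_zero (X := fun ξ : Fin N → Vec d => ∑ j, ⟪a j, ξ j⟫)
    (Measurable.aemeasurable (by fun_prop)) (integral_sum_inner_pi a)]
  have h := variance_sum_pi (μ := fun _ : Fin N => multivariateGaussian (0 : Vec d) S)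
    (X := fun j x => ⟪a j, x⟫) fun j => memLp_inner_multivariateGaussian (a j)
  simp_rw [variance_inner_multivariateGaussian hS] at h
  rw [← h]
  congr 1
  ext ξ
  simp

end Pi

theorem integral_add_sq_prod {Ω₁ Ω₂ : Type*} [MeasurableSpace Ω₁] [MeasurableSpace Ω₂]
    {P : Measure Ω₁} {Q : Measure Ω₂} [IsProbabilityMeasure P] [IsProbabilityMeasure Q]
    {f : Ω₁ → ℝ} {g : Ω₂ → ℝ} (hf : MemLp f 2 P) (hg : MemLp g 2 Q)
    (hf0 : ∫ x, f x ∂P = 0) :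
    ∫ z, (f z.1 + g z.2) ^ 2 ∂(P.prod Q) = ∫ x, f x ^ 2 ∂P + ∫ y, g y ^ 2 ∂Q := by
  have h1 : Integrable (fun z : Ω₁ × Ω₂ => f z.1 ^ 2) (P.prod Q) :=
    hf.integrable_sq.comp_fst Q
  have h2 : Integrable (fun z : Ω₁ × Ω₂ => g z.2 ^ 2) (P.prod Q) :=
    hg.integrable_sq.comp_snd P
  have h3 : Integrable (fun z : Ω₁ × Ω₂ => 2 * (f z.1 * g z.2)) (P.prod Q) :=
    ((hf.integrable one_le_two).mul_prod (hg.integrable one_le_two)).const_mul 2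
  have h4 : ∀ z : Ω₁ × Ω₂, (f z.1 + g z.2) ^ 2 = f z.1 ^ 2 + g z.2 ^ 2 + 2 * (f z.1 * g z.2) :=
    fun z => by ring
  simp_rw [h4]
  have h12 : Integrable (fun z : Ω₁ × Ω₂ => f z.1 ^ 2 + g z.2 ^ 2) (P.prod Q) := h1.add h2
  rw [integral_add h12 h3, integral_add h1 h2, integral_const_mul,
    integral_prod_mul, hf0, zero_mul, mul_zero, add_zero, integral_fun_fst (fun x => f x ^ 2),
    integral_fun_snd (fun y => g y ^ 2)]
  simp

/-- The expected squared norm of a random vector from its second moments in the coordinate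
directions. -/
theorem integral_norm_sq_eq_sum {Ω ι : Type*} [MeasurableSpace Ω] [Fintype ι] {P : Measure Ω}
    {X : Ω → EuclideanSpace ℝ ι} (hX : MemLp X 2 P) :
    ∫ ω, ‖X ω‖ ^ 2 ∂P = ∑ i, ∫ ω, ⟪EuclideanSpace.basisFun ι ℝ i, X ω⟫ ^ 2 ∂P := by
  simp_rw [← (EuclideanSpace.basisFun ι ℝ).sum_sq_norm_inner_right, Real.norm_eq_abs, sq_abs]
  exact integral_finsetSum _ fun i _ => (hX.const_inner _).integrable_sq

section Isotropic

variable {d N : ℕ}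

theorem inner_analysis_eq_sum (ξ : Fin N → Vec d) (c : EuclideanSpace ℝ (Fin N)) (a : Vec d) :
    ⟪c, analysis ξ a⟫ = ∑ t, ⟪c t • a, ξ t⟫ := by
  rw [PiLp.inner_apply]
  refine Finset.sum_congr rfl fun t _ => ?_
  rw [analysis_apply, real_inner_smul_left, real_inner_comm a]
  simp [mul_comm]

/-- The bilinear form `∑ cₜ ⟪ηₜ, a⟫` of isotropic Gaussian vectors has variance `σ² ‖c‖² ‖a‖²`. -/
theorem integral_inner_analysis_sq (σ : ℝ) (c : EuclideanSpace ℝ (Fin N)) (a : Vec d) :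
    ∫ ξ : Fin N → Vec d, ⟪c, analysis ξ a⟫ ^ 2
      ∂(Measure.pi fun _ => multivariateGaussian (0 : Vec d)
        (σ ^ 2 • (1 : Matrix (Fin d) (Fin d) ℝ))) = σ ^ 2 * ‖a‖ ^ 2 * ‖c‖ ^ 2 := by
  simp_rw [inner_analysis_eq_sum]
  rw [integral_sum_inner_sq_pi (Matrix.PosSemidef.one.smul (sq_nonneg σ)),
    EuclideanSpace.real_norm_sq_eq c, Finset.mul_sum]
  refine Finset.sum_congr rfl fun t _ => ?_
  have h2 : (σ ^ 2 • (1 : Matrix (Fin d) (Fin d) ℝ)).toEuclideanLin (c t • a) =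
      σ ^ 2 • (c t • a) := by
    ext i; simp; ring
  rw [h2, real_inner_smul_right, real_inner_self_eq_norm_sq, norm_smul, mul_pow,
    Real.norm_eq_abs, sq_abs]
  ring

variable (d N) in
/-- `ξ ↦ analysis ξ a` for fixed `a`, as a continuous linear map. -/
noncomputable def analysisCLM (a : Vec d) : (Fin N → Vec d) →L[ℝ] EuclideanSpace ℝ (Fin N) :=
  LinearMap.toContinuousLinearMap
    { toFun := fun ξ => analysis ξ a
      map_add' := fun ξ ζ => by ext t; simp [analysis_apply, inner_add_left]
      map_smul' := fun c ξ => by ext t; simp [analysis_apply, real_inner_smul_left] }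

/-- `ξ ↦ ∑ qₜ ξₜ` for fixed `q`, as a continuous linear map. -/
noncomputable def synthesisCLM (q : EuclideanSpace ℝ (Fin N)) : (Fin N → Vec d) →L[ℝ] Vec d :=
  LinearMap.toContinuousLinearMap
    { toFun := fun ξ => (analysis ξ).adjoint q
      map_add' := fun ξ ζ => by simp [adjoint_analysis_apply, Finset.sum_add_distrib]
      map_smul' := fun c ξ => by
        simp [adjoint_analysis_apply, Finset.smul_sum, smul_comm c] }

theorem hasGaussianLaw_analysis {Ω : Type*} [MeasurableSpace Ω] {P : Measure Ω}
    {x : Ω → Fin N → Vec d} (hx : HasGaussianLaw x P) (a : Vec d) :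
    HasGaussianLaw (fun ω => analysis (x ω) a) P :=
  hx.map_fun (analysisCLM d N a)

/-- The isotropic noise energy `∑ ⟪ηₜ, a⟫²` concentrates uniformly over all directions `a`. -/
theorem measure_noise_energy_le {σ κ p x : ℝ} (hκ0 : 0 < κ) (hκ : σ ^ 2 ≤ κ) (hp0 : 0 < p)
    (hp1 : p ≤ 1) (hx : 4 * d + 2 + Real.log (1 / p) ≤ x) :
    (Measure.pi fun _ : Fin N => multivariateGaussian (0 : Vec d)
      (σ ^ 2 • (1 : Matrix (Fin d) (Fin d) ℝ)))
      {ξ | ∃ a, 4 * (4 * √(κ * (N * σ ^ 2) * x) + 8 * κ * x) * ‖a‖ ^ 2 <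
        |‖analysis ξ a‖ ^ 2 - N * σ ^ 2 * ‖a‖ ^ 2|} ≤ ENNReal.ofReal p := by
  set P := Measure.pi fun _ : Fin N => multivariateGaussian (0 : Vec d)
      (σ ^ 2 • (1 : Matrix (Fin d) (Fin d) ℝ)) with hP
  have hG : ∀ a, HasGaussianLaw (fun ξ : Fin N → Vec d => analysis ξ a) P := fun a =>
    hasGaussianLaw_analysis (x := fun ξ => ξ) IsGaussian.hasGaussianLaw_id a
  refine measure_exists_norm_sq_deviation_le (P := P) (fun ξ => analysis ξ) hG (fun a => ?_)
    hκ0 hp0 hp1 (fun a c => ?_) (fun a => ?_) (by simpa using hx)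
  · refine ext_inner_left ℝ fun c => ?_
    rw [inner_zero_right, ← integral_inner (hG a).integrable]
    simp_rw [inner_analysis_eq_sum]
    exact integral_sum_inner_pi _
  · rw [integral_inner_analysis_sq]
    gcongr
  · rw [integral_norm_sq_eq_sum (hG a).memLp_two]
    have h1 : ∀ t, ∫ ξ : Fin N → Vec d, ⟪EuclideanSpace.basisFun (Fin N) ℝ t, analysis ξ a⟫ ^ 2 ∂P =
        σ ^ 2 * ‖a‖ ^ 2 := fun t => by
      rw [integral_inner_analysis_sq, OrthonormalBasis.norm_eq_one, one_pow, mul_one]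
    rw [Finset.sum_congr rfl fun t _ => h1 t]
    simp; ring

/-- The correlation `∑ qₜ ηₜ` of isotropic noise with the elements `q` of a fixed subspace. -/
theorem measure_noise_correlation_le {σ κ p x : ℝ} (hκ0 : 0 < κ) (hκ : σ ^ 2 ≤ κ) (hp0 : 0 < p)
    (hp1 : p ≤ 1) (U : Submodule ℝ (EuclideanSpace ℝ (Fin N)))
    (hx : 4 * Module.finrank ℝ U + 2 + Real.log (1 / p) ≤ x) :
    (Measure.pi fun _ : Fin N => multivariateGaussian (0 : Vec d)
      (σ ^ 2 • (1 : Matrix (Fin d) (Fin d) ℝ)))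
      {ξ | ∃ q ∈ U, (d * σ ^ 2 + 4 * (4 * √(κ * (d * σ ^ 2) * x) + 8 * κ * x)) * ‖q‖ ^ 2 <
        ‖(analysis ξ).adjoint q‖ ^ 2} ≤ ENNReal.ofReal p := by
  set P := Measure.pi fun _ : Fin N => multivariateGaussian (0 : Vec d)
      (σ ^ 2 • (1 : Matrix (Fin d) (Fin d) ℝ)) with hP
  have hG : ∀ q : U, HasGaussianLaw (fun ξ : Fin N → Vec d => (analysis ξ).adjoint q) P :=
    fun q => (IsGaussian.hasGaussianLaw_id (μ := P)).map_fun (synthesisCLM (q : _))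
  have hsq : ∀ (q : U) (c : Vec d), ∫ ξ : Fin N → Vec d, ⟪c, (analysis ξ).adjoint q⟫ ^ 2 ∂P =
      σ ^ 2 * ‖q‖ ^ 2 * ‖c‖ ^ 2 := by
    intro q c
    simp_rw [LinearMap.adjoint_inner_right, real_inner_comm (q : EuclideanSpace ℝ (Fin N))]
    rw [integral_inner_analysis_sq]
    rw [Submodule.coe_norm]; ring
  have key := measure_exists_norm_sq_deviation_le (P := P)
    (fun ξ => (analysis ξ).adjoint ∘ₗ U.subtype) hG (fun q => ?_) (τ := d * σ ^ 2)
    hκ0 hp0 hp1 (fun q c => ?_) (fun q => ?_) hx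
  · refine (measure_mono ?_).trans key
    rintro ξ ⟨q, hq, h⟩
    refine ⟨⟨q, hq⟩, ?_⟩
    have h1 : ‖(⟨q, hq⟩ : U)‖ = ‖q‖ := rfl
    rw [h1]
    exact (lt_sub_iff_add_lt'.2 (by rw [← add_mul]; exact h)).trans_le (le_abs_self _)
  · refine ext_inner_left ℝ fun c => ?_
    have hint : Integrable (fun ξ => ((analysis ξ).adjoint ∘ₗ U.subtype) q) P :=
      (hG q).integrable
    rw [inner_zero_right, ← integral_inner hint]
    have h1 : ∀ ξ : Fin N → Vec d, ⟪c, ((analysis ξ).adjoint ∘ₗ U.subtype) q⟫ =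
        ∑ t, ⟪(q : EuclideanSpace ℝ (Fin N)) t • c, ξ t⟫ := by
      intro ξ
      rw [LinearMap.comp_apply, adjoint_analysis_apply, inner_sum]
      simp [real_inner_smul_right, real_inner_smul_left]
    simp_rw [h1]
    exact integral_sum_inner_pi _
  · exact (hsq q c).trans_le (by gcongr)
  · change ∫ ξ, ‖(analysis ξ).adjoint (q : EuclideanSpace ℝ (Fin N))‖ ^ 2 ∂P = _
    rw [integral_norm_sq_eq_sum (hG q).memLp_two]
    simp_rw [hsq, OrthonormalBasis.norm_eq_one]
    simp; ring

end Isotropic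

/-! ### Excitation of the states -/

open scoped MatrixOrder in
/-- Lower tail of a Gaussian chaos relative to its own mean. The quadratic form `𝔼 ‖X v‖²` is
whitened, so that only the ratio `K / c` of the largest variance to the smallest mean enters, and
no condition number of the mean. -/
theorem measure_exists_norm_sq_lt_half {Ω F : Type*} [MeasurableSpace Ω] {r : ℕ}
    {P : Measure Ω} [IsProbabilityMeasure P] [NormedAddCommGroup F]
    [InnerProductSpace ℝ F] [FiniteDimensional ℝ F] [MeasurableSpace F] [BorelSpace F]
    (X : Ω → Vec r →ₗ[ℝ] F) (hX : ∀ a, HasGaussianLaw (fun ω => X ω a) P)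
    (h0 : ∀ a, ∫ ω, X ω a ∂P = 0) {K c p : ℝ} (hK0 : 0 < K) (hc0 : 0 < c)
    (hp0 : 0 < p) (hp1 : p ≤ 1)
    (hK : ∀ a c, ∫ ω, ⟪c, X ω a⟫ ^ 2 ∂P ≤ K * ‖a‖ ^ 2 * ‖c‖ ^ 2)
    {G : Matrix (Fin r) (Fin r) ℝ} (hG : G.PosSemidef)
    (hτ : ∀ a, ∫ ω, ‖X ω a‖ ^ 2 ∂P = ⟪a, G.toEuclideanLin a⟫)
    (hc : ∀ a, c * ‖a‖ ^ 2 ≤ ⟪a, G.toEuclideanLin a⟫)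
    (hx : 2025 * K * (4 * r + 2 + Real.log (1 / p)) ≤ c) :
    P {ω | ∃ a, ‖X ω a‖ ^ 2 < c / 2 * ‖a‖ ^ 2} ≤ ENNReal.ofReal p := by
  obtain ⟨B, hB⟩ : ∃ B : Matrix (Fin r) (Fin r) ℝ, G = Bᴴ * B :=
    CStarAlgebra.nonneg_iff_eq_star_mul_self.1 (Matrix.nonneg_iff_posSemidef.2 hG)
  have hGB : ∀ a, ⟪a, G.toEuclideanLin a⟫ = ‖B.toEuclideanLin a‖ ^ 2 := by
    intro a
    rw [hB, Matrix.conjTranspose_eq_transpose_of_trivial, toEuclideanLin_mul_apply,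
      toEuclideanLin_transpose, LinearMap.adjoint_inner_right, real_inner_self_eq_norm_sq]
  have hinj : Function.Injective B.toEuclideanLin := by
    refine (injective_iff_map_eq_zero _).2 fun a ha => ?_
    have h1 := hc a
    rw [hGB, ha, norm_zero] at h1
    have h2 : ‖a‖ ^ 2 ≤ 0 := by nlinarith [sq_nonneg ‖a‖]
    exact norm_eq_zero.1 (pow_eq_zero_iff two_ne_zero |>.1 (le_antisymm h2 (sq_nonneg _)))
  let e : Vec r ≃ₗ[ℝ] Vec r := LinearEquiv.ofInjectiveEndo _ hinj
  have he : ∀ a, ‖a‖ ^ 2 = ⟪e.symm a, G.toEuclideanLin (e.symm a)⟫ := by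
    intro a
    rw [hGB]
    congr 2
    exact (e.apply_symm_apply a).symm
  set x := 4 * (r : ℝ) + 2 + Real.log (1 / p) with hxdef
  have hlog : 0 ≤ Real.log (1 / p) := Real.log_nonneg (by rw [le_div_iff₀ hp0]; linarith)
  have hx0 : 0 < x := by positivity
  have key := measure_exists_norm_sq_deviation_le (P := P) (fun ω => X ω ∘ₗ e.symm.toLinearMap)
    (fun a => hX _) (fun a => h0 _) (κ := K / c) (τ := 1) (p := p) (x := x) (by positivity) hp0 hp1
    (fun a d => ?_) (fun a => ?_) (by simp [hxdef])
  · refine (measure_mono ?_).trans key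
    rintro ω ⟨a, ha⟩
    refine ⟨e a, ?_⟩
    have h1 : (X ω ∘ₗ e.symm.toLinearMap) (e a) = X ω a := by simp
    have h2 : ‖e a‖ ^ 2 = ⟪a, G.toEuclideanLin a⟫ := by rw [he]; simp
    have h3 := hc a
    have h4 : K / c * x ≤ 1 / 2025 := by
      rw [div_mul_eq_mul_div, div_le_iff₀ hc0]; linarith
    have h5 : √(K / c * 1 * x) ≤ 1 / 45 := by
      rw [mul_one]
      exact Real.sqrt_le_iff.2 ⟨by norm_num, h4.trans (by norm_num)⟩
    rw [h1, h2, one_mul]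
    have h6 : 0 ≤ ⟪a, G.toEuclideanLin a⟫ := by rw [hGB]; positivity
    have h7 : 4 * (4 * √(K / c * 1 * x) + 8 * (K / c) * x) ≤ 1 / 2 := by
      rw [mul_assoc 8]; linarith
    refine lt_of_le_of_lt (mul_le_mul_of_nonneg_right h7 h6) ?_
    refine lt_of_lt_of_le ?_ (neg_le_abs _)
    linarith
  · refine (hK _ _).trans (mul_le_mul_of_nonneg_right ?_ (sq_nonneg _))
    have := hc (e.symm a)
    rw [← he] at this
    rw [div_mul_eq_mul_div, le_div_iff₀ hc0]
    change K * ‖e.symm a‖ ^ 2 * c ≤ _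
    nlinarith
  · rw [one_mul, he]
    exact hτ _

/-- Schur's test: a nonnegative kernel whose row and column sums are at most `S` has `ℓ²` operator
norm at most `S`. -/
theorem schur_test {ι κ : Type*} [Fintype ι] [Fintype κ] (m : ι → κ → ℝ) (hm : ∀ i j, 0 ≤ m i j)
    {S : ℝ} (h1 : ∀ i, ∑ j, m i j ≤ S) (h2 : ∀ j, ∑ i, m i j ≤ S) (c : ι → ℝ) :
    ∑ j, (∑ i, |c i| * m i j) ^ 2 ≤ S ^ 2 * ∑ i, c i ^ 2 := by
  have h3 : ∀ j, (∑ i, |c i| * m i j) ^ 2 ≤ S * ∑ i, c i ^ 2 * m i j := by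
    intro j
    have h4 := Finset.sum_mul_sq_le_sq_mul_sq Finset.univ (fun i => √(m i j))
      (fun i => |c i| * √(m i j))
    have h5 : ∀ i, √(m i j) * (|c i| * √(m i j)) = |c i| * m i j := fun i => by
      rw [mul_left_comm, Real.mul_self_sqrt (hm i j)]
    simp_rw [h5, mul_pow, Real.sq_sqrt (hm _ j), sq_abs] at h4
    exact h4.trans (mul_le_mul_of_nonneg_right (h2 j)
      (Finset.sum_nonneg fun i _ => mul_nonneg (sq_nonneg _) (hm i j)))
  rcases isEmpty_or_nonempty κ with hκ | ⟨⟨j₀⟩⟩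
  · simp only [Finset.univ_eq_empty, Finset.sum_empty]; positivity
  have hS : 0 ≤ S := (Finset.sum_nonneg fun i _ => hm i j₀).trans (h2 j₀)
  calc ∑ j, (∑ i, |c i| * m i j) ^ 2 ≤ ∑ j, S * ∑ i, c i ^ 2 * m i j :=
        Finset.sum_le_sum fun j _ => h3 j
    _ = S * ∑ i, c i ^ 2 * ∑ j, m i j := by
        rw [← Finset.mul_sum, Finset.sum_comm]
        simp_rw [Finset.mul_sum]
    _ ≤ S * ∑ i, c i ^ 2 * S := by
        gcongr with i
        exact h1 i
    _ = S ^ 2 * ∑ i, c i ^ 2 := by rw [← Finset.sum_mul]; ring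

theorem sum_fin_ite_lt_sub (f : ℕ → ℝ) {T t : ℕ} (ht : t ≤ T) :
    (∑ j : Fin T, if (j : ℕ) < t then f (t - 1 - j) else 0) = ∑ i ∈ Finset.range t, f i := by
  rw [Fin.sum_univ_eq_sum_range (fun j => if j < t then f (t - 1 - j) else 0),
    ← Finset.sum_range_reflect f t, ← Finset.sum_filter]
  congr 1
  ext j
  simp only [Finset.mem_filter, Finset.mem_range]
  omega

theorem sum_fin_ite_gt_sub_le {f : ℕ → ℝ} (hf : ∀ i, 0 ≤ f i) (N j : ℕ) :
    (∑ t : Fin N, if j < (t : ℕ) then f (t - 1 - j) else 0) ≤ ∑ i ∈ Finset.range N, f i := by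
  rw [Fin.sum_univ_eq_sum_range (fun t => if j < t then f (t - 1 - j) else 0)]
  have h : ∀ N, (∑ t ∈ Finset.range N, if j < t then f (t - 1 - j) else 0) =
      ∑ i ∈ Finset.range (N - 1 - j), f i := by
    intro N
    induction N with
    | zero => simp
    | succ k ih =>
      rw [Finset.sum_range_succ, ih]
      split_ifs with hk
      · rw [show k + 1 - 1 - j = (k - 1 - j) + 1 by omega, Finset.sum_range_succ]
      · rw [show k + 1 - 1 - j = 0 by omega, show k - 1 - j = 0 by omega]; simp
  rw [h]
  exact Finset.sum_le_sum_of_subset_of_nonneg (Finset.range_subset_range.2 (by omega))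
    fun i _ _ => hf i

theorem norm_toEuclideanLin_le {α β : Type*} [Fintype α] [Fintype β] [DecidableEq α]
    [DecidableEq β] (P : Matrix α β ℝ) (v : EuclideanSpace ℝ β) :
    ‖P.toEuclideanLin v‖ ≤ ‖P‖ * ‖v‖ := Matrix.l2_opNorm_mulVec P v

theorem norm_transpose_eq {α β : Type*} [Fintype α] [Fintype β] [DecidableEq α]
    [DecidableEq β] (P : Matrix α β ℝ) : ‖Pᵀ‖ = ‖P‖ := by
  rw [← Matrix.conjTranspose_eq_transpose_of_trivial, Matrix.l2_opNorm_conjTranspose]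

namespace LTISystem

variable {r n m : ℕ} (M : LTISystem r n m)

/-- The coefficient of the `j`-th excitation `B uⱼ + wⱼ` in `⟪xₜ, v⟫`. -/
noncomputable def stateCoeff {T : ℕ} (t : ℕ) (v : Vec r) (j : Fin T) : Vec r :=
  if (j : ℕ) < t then ((M.A ^ (t - 1 - j))ᵀ).toEuclideanLin v else 0

theorem inner_state_eq {T : ℕ} (u : Fin T → Vec m) (w : Fin T → Vec r) (t : ℕ) (v : Vec r) :
    ⟪M.state u w t, v⟫ = ∑ j, ⟪M.stateCoeff t v j, M.B.toEuclideanLin (u j) + w j⟫ := by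
  induction t generalizing v with
  | zero => simp [state, stateCoeff]
  | succ t ih =>
    have h1 : ∀ j : Fin T, M.stateCoeff (t + 1) v j =
        M.stateCoeff t (M.Aᵀ.toEuclideanLin v) j + if (j : ℕ) = t then v else 0 := by
      intro j
      unfold stateCoeff
      rcases lt_trichotomy (j : ℕ) t with h | h | h
      · rw [if_pos (by omega), if_pos h, if_neg (by omega), add_zero,
          ← toEuclideanLin_mul_apply, ← Matrix.transpose_mul, ← pow_succ',
          show t - 1 - (j : ℕ) + 1 = t + 1 - 1 - j by omega]
      · rw [if_pos (by omega), if_neg (by omega), if_pos h, zero_add,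
          show t + 1 - 1 - (j : ℕ) = 0 by omega]
        simp
      · rw [if_neg (by omega), if_neg (by omega), if_neg (by omega), add_zero]
    simp_rw [h1, inner_add_left, Finset.sum_add_distrib]
    rw [← ih, state, inner_add_left, ← LinearMap.adjoint_inner_right, ← toEuclideanLin_transpose]
    congr 1
    by_cases ht : t < T
    · rw [dif_pos ht, Finset.sum_eq_single ⟨t, ht⟩]
      · simp [real_inner_comm]
      · intro j _ hj
        rw [if_neg fun h => hj (Fin.ext h), inner_zero_left]
      · simp
    · rw [dif_neg ht, inner_zero_left, Finset.sum_eq_zero]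
      intro j _
      rw [if_neg (by have := j.2; omega), inner_zero_left]

/-- The covariance of an excitation `B u + w`. -/
def excCov (covU : Matrix (Fin m) (Fin m) ℝ) : Matrix (Fin r) (Fin r) ℝ :=
  M.covW + M.B * covU * M.Bᵀ

theorem excCov_posSemidef {covU : Matrix (Fin m) (Fin m) ℝ} (hW : M.covW.PosSemidef)
    (hU : covU.PosSemidef) : (M.excCov covU).PosSemidef := by
  have := hU.mul_mul_conjTranspose_same M.B
  rw [Matrix.conjTranspose_eq_transpose_of_trivial] at this
  exact hW.add this

theorem inner_excCov (covU : Matrix (Fin m) (Fin m) ℝ) (g : Vec r) :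
    ⟪g, (M.excCov covU).toEuclideanLin g⟫ = ⟪M.Bᵀ.toEuclideanLin g,
      covU.toEuclideanLin (M.Bᵀ.toEuclideanLin g)⟫ + ⟪g, M.covW.toEuclideanLin g⟫ := by
  have h1 : (M.excCov covU).toEuclideanLin g = M.covW.toEuclideanLin g +
      M.B.toEuclideanLin (covU.toEuclideanLin (M.Bᵀ.toEuclideanLin g)) := by
    rw [← toEuclideanLin_mul_apply, ← toEuclideanLin_mul_apply, excCov,
      map_add, LinearMap.add_apply]
  rw [h1, inner_add_right, toEuclideanLin_transpose, LinearMap.adjoint_inner_left, add_comm]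

/-- The law of the inputs and process noises. -/
noncomputable def excLaw (covU : Matrix (Fin m) (Fin m) ℝ) (T : ℕ) :
    Measure ((Fin T → Vec m) × (Fin T → Vec r)) :=
  (Measure.pi fun _ => multivariateGaussian 0 covU).prod
    (Measure.pi fun _ => multivariateGaussian 0 M.covW)

instance isGaussian_excLaw (covU : Matrix (Fin m) (Fin m) ℝ) (T : ℕ) :
    IsGaussian (M.excLaw covU T) := by
  unfold excLaw; infer_instance

theorem integral_excitation_sq {covU : Matrix (Fin m) (Fin m) ℝ} (hW : M.covW.PosSemidef)
    (hU : covU.PosSemidef) {T : ℕ} (g : Fin T → Vec r) :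
    ∫ z, (∑ j, ⟪g j, M.B.toEuclideanLin (z.1 j) + z.2 j⟫) ^ 2 ∂(M.excLaw covU T) =
      ∑ j, ⟪g j, (M.excCov covU).toEuclideanLin (g j)⟫ := by
  have h1 : ∀ z : (Fin T → Vec m) × (Fin T → Vec r),
      ∑ j, ⟪g j, M.B.toEuclideanLin (z.1 j) + z.2 j⟫ =
        (∑ j, ⟪M.Bᵀ.toEuclideanLin (g j), z.1 j⟫) + ∑ j, ⟪g j, z.2 j⟫ := by
    intro z
    rw [← Finset.sum_add_distrib]
    refine Finset.sum_congr rfl fun j _ => ?_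
    rw [inner_add_right, toEuclideanLin_transpose, LinearMap.adjoint_inner_left]
  simp_rw [h1]
  have e1 : MemLp (fun u : Fin T → Vec m => ∑ j, ⟪M.Bᵀ.toEuclideanLin (g j), u j⟫) 2
      (Measure.pi fun _ => multivariateGaussian 0 covU) := memLp_sum_inner_pi _
  have e2 : MemLp (fun w : Fin T → Vec r => ∑ j, ⟪g j, w j⟫) 2
      (Measure.pi fun _ => multivariateGaussian 0 M.covW) := memLp_sum_inner_pi _
  rw [excLaw]
  refine (integral_add_sq_prod e1 e2 (integral_sum_inner_pi _)).trans ?_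
  rw [integral_sum_inner_sq_pi hU, integral_sum_inner_sq_pi hW, ← Finset.sum_add_distrib]
  exact Finset.sum_congr rfl fun j _ => (M.inner_excCov covU (g j)).symm

theorem integral_excitation {covU : Matrix (Fin m) (Fin m) ℝ} {T : ℕ} (g : Fin T → Vec r) :
    ∫ z, ∑ j, ⟪g j, M.B.toEuclideanLin (z.1 j) + z.2 j⟫ ∂(M.excLaw covU T) = 0 := by
  have h1 : ∀ z : (Fin T → Vec m) × (Fin T → Vec r),
      ∑ j, ⟪g j, M.B.toEuclideanLin (z.1 j) + z.2 j⟫ =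
        (∑ j, ⟪M.Bᵀ.toEuclideanLin (g j), z.1 j⟫) + ∑ j, ⟪g j, z.2 j⟫ := by
    intro z
    rw [← Finset.sum_add_distrib]
    refine Finset.sum_congr rfl fun j _ => ?_
    rw [inner_add_right, toEuclideanLin_transpose, LinearMap.adjoint_inner_left]
  simp_rw [h1]
  have e1 : Integrable (fun u : Fin T → Vec m => ∑ j, ⟪M.Bᵀ.toEuclideanLin (g j), u j⟫)
      (Measure.pi fun _ => multivariateGaussian 0 covU) :=
    (memLp_sum_inner_pi _).integrable one_le_two
  have e2 : Integrable (fun w : Fin T → Vec r => ∑ j, ⟪g j, w j⟫)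
      (Measure.pi fun _ => multivariateGaussian 0 M.covW) :=
    (memLp_sum_inner_pi _).integrable one_le_two
  rw [excLaw, integral_add (e1.comp_fst _) (e2.comp_snd _),
    integral_fun_fst (fun u : Fin T → Vec m => ∑ j, ⟪M.Bᵀ.toEuclideanLin (g j), u j⟫),
    integral_fun_snd (fun w : Fin T → Vec r => ∑ j, ⟪g j, w j⟫), integral_sum_inner_pi,
    integral_sum_inner_pi]
  simp

variable (r m) in
theorem state_add {T : ℕ} (M : LTISystem r n m) (u u' : Fin T → Vec m) (w w' : Fin T → Vec r)
    (t : ℕ) : M.state (u + u') (w + w') t = M.state u w t + M.state u' w' t := by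
  refine ext_inner_right ℝ fun v => ?_
  rw [inner_add_left, inner_state_eq, inner_state_eq, inner_state_eq, ← Finset.sum_add_distrib]
  refine Finset.sum_congr rfl fun j _ => ?_
  rw [← inner_add_right, Pi.add_apply, Pi.add_apply, map_add]
  congr 1; abel

theorem state_smul {T : ℕ} (c : ℝ) (u : Fin T → Vec m) (w : Fin T → Vec r)
    (t : ℕ) : M.state (c • u) (c • w) t = c • M.state u w t := by
  refine ext_inner_right ℝ fun v => ?_
  rw [real_inner_smul_left, inner_state_eq, inner_state_eq, Finset.mul_sum]
  refine Finset.sum_congr rfl fun j _ => ?_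
  rw [← real_inner_smul_right, Pi.smul_apply, Pi.smul_apply, map_smul, smul_add]

/-- The states `x₀, …, x_T` as a continuous linear function of inputs and process noises. -/
noncomputable def stateCLM (T : ℕ) :
    ((Fin T → Vec m) × (Fin T → Vec r)) →L[ℝ] (Fin (T + 1) → Vec r) :=
  LinearMap.toContinuousLinearMap
    { toFun := fun z t => M.state z.1 z.2 t
      map_add' := fun z z' => by ext1 t; exact M.state_add r m z.1 z'.1 z.2 z'.2 t
      map_smul' := fun c z => by ext1 t; exact M.state_smul c z.1 z.2 t }

theorem stateCLM_apply (T : ℕ) (z : (Fin T → Vec m) × (Fin T → Vec r)) (t : Fin (T + 1)) :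
    M.stateCLM T z t = M.state z.1 z.2 t := rfl

theorem inner_analysis_state {T : ℕ} (z : (Fin T → Vec m) × (Fin T → Vec r))
    (c : EuclideanSpace ℝ (Fin (T + 1))) (v : Vec r) :
    ⟪c, analysis (M.stateCLM T z) v⟫ =
      ∑ j, ⟪∑ t, c t • M.stateCoeff t v j, M.B.toEuclideanLin (z.1 j) + z.2 j⟫ := by
  simp_rw [sum_inner]
  rw [Finset.sum_comm, inner_analysis_eq_sum]
  refine Finset.sum_congr rfl fun t _ => ?_
  rw [real_inner_smul_left, stateCLM_apply, real_inner_comm, inner_state_eq, Finset.mul_sum]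
  simp_rw [real_inner_smul_left]

theorem sum_norm_pow_le {ψA ρA : ℝ} (hM : M.IsStableWith ψA ρA) (N : ℕ) :
    ∑ i ∈ Finset.range N, ‖M.A ^ i‖ ≤ 2 * ψA / (1 - ρA) := by
  obtain ⟨hψ, hρ0, hρ1, hA⟩ := hM
  have h1 : ∑ i ∈ Finset.range N, ‖M.A ^ i‖ ≤ ∑ i ∈ Finset.range (N + 1), ‖M.A ^ i‖ :=
    Finset.sum_le_sum_of_subset_of_nonneg (Finset.range_subset_range.2 (by omega))
      fun i _ _ => norm_nonneg _
  rw [Finset.sum_range_succ', pow_zero] at h1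
  have h2 : ‖(1 : Matrix (Fin r) (Fin r) ℝ)‖ ≤ 1 := by
    rw [Matrix.l2_opNorm_def]
    refine ContinuousLinearMap.opNorm_le_bound _ zero_le_one fun x => ?_
    simp
  have h3 : ∑ i ∈ Finset.range N, ‖M.A ^ (i + 1)‖ ≤ ψA / (1 - ρA) := by
    refine (Finset.sum_le_sum fun i _ => hA i).trans ?_
    rw [← Finset.mul_sum, div_eq_mul_inv, ← tsum_geometric_of_lt_one hρ0.le hρ1]
    refine mul_le_mul_of_nonneg_left ?_ (by linarith)
    exact (summable_geometric_of_lt_one hρ0.le hρ1).sum_le_tsum _ fun i _ => by positivity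
  have h4 : 1 ≤ ψA / (1 - ρA) := by rw [le_div_iff₀ (by linarith)]; linarith
  rw [mul_div_assoc]
  linarith

/-- No combination of the states has a large variance in any direction: its coefficients are
dominated by the kernel `‖A ^ (t - 1 - j)‖`, to which stability and Schur's test apply. -/
theorem sum_norm_stateCoeff_sq_le {ψA ρA : ℝ} (hM : M.IsStableWith ψA ρA) (T : ℕ)
    (c : EuclideanSpace ℝ (Fin (T + 1))) (v : Vec r) :
    ∑ j : Fin T, ‖∑ t : Fin (T + 1), c t • M.stateCoeff t v j‖ ^ 2 ≤
      (2 * ψA / (1 - ρA)) ^ 2 * ‖v‖ ^ 2 * ‖c‖ ^ 2 := by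
  let μ : Fin (T + 1) → Fin T → ℝ := fun t j =>
    if (j : ℕ) < (t : ℕ) then ‖M.A ^ ((t : ℕ) - 1 - j)‖ else 0
  have h1 : ∀ (t : Fin (T + 1)) (j : Fin T), ‖M.stateCoeff t v j‖ ≤ μ t j * ‖v‖ := by
    intro t j
    simp only [μ, stateCoeff]
    split_ifs
    · rw [← norm_transpose_eq]; exact norm_toEuclideanLin_le _ _
    · simp
  have h2 := schur_test μ (fun t j => by simp only [μ]; split_ifs <;> positivity)
    (S := 2 * ψA / (1 - ρA))
    (fun t => by
      refine (sum_fin_ite_lt_sub (fun i => ‖M.A ^ i‖) (by have := t.2; omega)).trans_le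
        (M.sum_norm_pow_le hM _))
    (fun j => (sum_fin_ite_gt_sub_le (fun i => norm_nonneg (M.A ^ i)) _ _).trans
        (M.sum_norm_pow_le hM _)) c
  rw [EuclideanSpace.real_norm_sq_eq c]
  calc ∑ j : Fin T, ‖∑ t : Fin (T + 1), c t • M.stateCoeff t v j‖ ^ 2
      ≤ ∑ j : Fin T, ((∑ t, |c t| * μ t j) * ‖v‖) ^ 2 := by
        refine Finset.sum_le_sum fun j _ => pow_le_pow_left₀ (norm_nonneg _) ?_ 2
        refine (norm_sum_le _ _).trans ?_
        rw [Finset.sum_mul]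
        refine Finset.sum_le_sum fun t _ => ?_
        rw [norm_smul, Real.norm_eq_abs, mul_assoc]
        exact mul_le_mul_of_nonneg_left (h1 t j) (abs_nonneg _)
    _ = (∑ j : Fin T, (∑ t, |c t| * μ t j) ^ 2) * ‖v‖ ^ 2 := by
        rw [Finset.sum_mul]; simp_rw [mul_pow]
    _ ≤ _ := by
        refine (mul_le_mul_of_nonneg_right h2 (sq_nonneg _)).trans (le_of_eq ?_)
        ring

/-- The controllability Gramian dominates: the accumulated state covariance is at least
`(T + 1 - r) λ_min(Σ_u) σ_min([B, AB, …])²`. -/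
theorem sum_stateCoeff_ge {covU : Matrix (Fin m) (Fin m) ℝ} (hW : M.covW.PosSemidef)
    {φu φr : ℝ} (hφu : ∀ x, φu * ‖x‖ ^ 2 ≤ ⟪x, covU.toEuclideanLin x⟫) (hφu0 : 0 ≤ φu)
    (hφr : ∀ v, φr * ‖v‖ ^ 2 ≤ ‖M.ctrlMatrixᵀ.toEuclideanLin v‖ ^ 2) {T : ℕ} (hT : 2 * r ≤ T)
    (v : Vec r) :
    T / 2 * (φu * φr) * ‖v‖ ^ 2 ≤ ∑ t : Fin (T + 1), ∑ j : Fin T,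
      ⟪M.stateCoeff t v j, (M.excCov covU).toEuclideanLin (M.stateCoeff t v j)⟫ := by
  let f : ℕ → ℝ := fun i => ⟪((M.A ^ i)ᵀ).toEuclideanLin v,
    (M.excCov covU).toEuclideanLin (((M.A ^ i)ᵀ).toEuclideanLin v)⟫
  have hWx : ∀ x : Vec r, 0 ≤ ⟪x, M.covW.toEuclideanLin x⟫ := fun x => by
    have := hW.dotProduct_mulVec_nonneg x
    simpa [PiLp.inner_apply, dotProduct, Matrix.toLpLin_apply, mul_comm] using this
  have hf1 : ∀ i, φu * ‖M.Bᵀ.toEuclideanLin (((M.A ^ i)ᵀ).toEuclideanLin v)‖ ^ 2 ≤ f i := by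
    intro i
    simp only [f, inner_excCov]
    linarith [hφu (M.Bᵀ.toEuclideanLin (((M.A ^ i)ᵀ).toEuclideanLin v)),
      hWx (((M.A ^ i)ᵀ).toEuclideanLin v)]
  have hf0 : ∀ i, 0 ≤ f i := fun i => (by positivity : (0 : ℝ) ≤ _).trans (hf1 i)
  have hctrl : ‖M.ctrlMatrixᵀ.toEuclideanLin v‖ ^ 2 =
      ∑ i ∈ Finset.range r, ‖M.Bᵀ.toEuclideanLin (((M.A ^ i)ᵀ).toEuclideanLin v)‖ ^ 2 := by
    rw [EuclideanSpace.real_norm_sq_eq, Fintype.sum_prod_type,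
      ← Fin.sum_univ_eq_sum_range
        (fun i => ‖M.Bᵀ.toEuclideanLin (((M.A ^ i)ᵀ).toEuclideanLin v)‖ ^ 2)]
    refine Finset.sum_congr rfl fun i _ => ?_
    rw [EuclideanSpace.real_norm_sq_eq]
    refine Finset.sum_congr rfl fun k _ => ?_
    rw [← toEuclideanLin_mul_apply, ← Matrix.transpose_mul]
    rfl
  have hsum : φu * φr * ‖v‖ ^ 2 ≤ ∑ i ∈ Finset.range r, f i := by
    calc φu * φr * ‖v‖ ^ 2 = φu * (φr * ‖v‖ ^ 2) := by ring
      _ ≤ φu * ∑ i ∈ Finset.range r,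
          ‖M.Bᵀ.toEuclideanLin (((M.A ^ i)ᵀ).toEuclideanLin v)‖ ^ 2 := by
          rw [← hctrl]; exact mul_le_mul_of_nonneg_left (hφr v) hφu0
      _ ≤ _ := by rw [Finset.mul_sum]; exact Finset.sum_le_sum fun i _ => hf1 i
  have hrow : ∀ t : Fin (T + 1), ∑ j : Fin T, ⟪M.stateCoeff t v j,
      (M.excCov covU).toEuclideanLin (M.stateCoeff t v j)⟫ = ∑ i ∈ Finset.range t, f i := by
    intro t
    rw [← sum_fin_ite_lt_sub f (T := T) (by have := t.2; omega)]
    refine Finset.sum_congr rfl fun j _ => ?_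
    simp only [stateCoeff, f]
    split_ifs <;> simp
  simp_rw [hrow]
  rw [Fin.sum_univ_eq_sum_range (fun t => ∑ i ∈ Finset.range t, f i)]
  have hc0 : 0 ≤ ∑ i ∈ Finset.range r, f i := Finset.sum_nonneg fun i _ => hf0 i
  have hcard : (Finset.Ico r (T + 1)).card = T + 1 - r := by simp
  calc T / 2 * (φu * φr) * ‖v‖ ^ 2 = T / 2 * (φu * φr * ‖v‖ ^ 2) := by ring
    _ ≤ T / 2 * ∑ i ∈ Finset.range r, f i := mul_le_mul_of_nonneg_left hsum (by positivity)
    _ ≤ (T + 1 - r : ℕ) * ∑ i ∈ Finset.range r, f i := by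
        refine mul_le_mul_of_nonneg_right ?_ hc0
        have : (T : ℝ) ≤ 2 * ((T + 1 - r : ℕ) : ℝ) := by exact_mod_cast (by omega)
        linarith
    _ = ∑ t ∈ Finset.Ico r (T + 1), ∑ i ∈ Finset.range r, f i := by
        rw [Finset.sum_const, hcard, nsmul_eq_mul]
    _ ≤ ∑ t ∈ Finset.Ico r (T + 1), ∑ i ∈ Finset.range t, f i := by
        refine Finset.sum_le_sum fun t ht => ?_
        exact Finset.sum_le_sum_of_subset_of_nonneg
          (Finset.range_subset_range.2 (Finset.mem_Ico.1 ht).1) fun i _ _ => hf0 i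
    _ ≤ _ := by
        refine Finset.sum_le_sum_of_subset_of_nonneg (fun t ht => ?_)
          fun t _ _ => Finset.sum_nonneg fun i _ => hf0 i
        exact Finset.mem_range.2 (Finset.mem_Ico.1 ht).2

/-- Persistent excitation: with high probability the empirical state covariance `∑ xₜ xₜᵀ` is at
least a quarter of `T λ_min(Σ_u) σ_min([B, AB, …])²`. -/
theorem measure_state_energy_lt_le {covU : Matrix (Fin m) (Fin m) ℝ} (hW : M.covW.PosSemidef)
    (hU : covU.PosSemidef) {ψA ρA ψw φu φr p : ℝ} (hM : M.IsStableWith ψA ρA)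
    (hφu : ∀ x, φu * ‖x‖ ^ 2 ≤ ⟪x, covU.toEuclideanLin x⟫) (hφu0 : 0 < φu)
    (hφr : ∀ v, φr * ‖v‖ ^ 2 ≤ ‖M.ctrlMatrixᵀ.toEuclideanLin v‖ ^ 2) (hφr0 : 0 < φr)
    (hψw : ∀ g, ⟪g, (M.excCov covU).toEuclideanLin g⟫ ≤ ψw * ‖g‖ ^ 2) (hψw0 : 0 < ψw)
    {T : ℕ} (hT : 2 * r ≤ T) (hT0 : 0 < T) (hp0 : 0 < p) (hp1 : p ≤ 1)
    (hx : 2025 * (ψw * (2 * ψA / (1 - ρA)) ^ 2) * (4 * r + 2 + Real.log (1 / p)) ≤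
      T / 2 * (φu * φr)) :
    M.excLaw covU T {z | ∃ v, ‖analysis (M.stateCLM T z) v‖ ^ 2 <
      T / 2 * (φu * φr) / 2 * ‖v‖ ^ 2} ≤ ENNReal.ofReal p := by
  have hψA : 0 < ψA := zero_lt_one.trans_le hM.1
  have hρA : 0 < 1 - ρA := by linarith [hM.2.2.1]
  have hT' : (0 : ℝ) < T := by exact_mod_cast hT0
  have hGs : ∀ v, HasGaussianLaw (fun z => analysis (M.stateCLM T z) v) (M.excLaw covU T) :=
    fun v => hasGaussianLaw_analysis (IsGaussian.hasGaussianLaw_id.map_fun (M.stateCLM T)) v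
  let G : Matrix (Fin r) (Fin r) ℝ := ∑ t : Fin (T + 1), ∑ j : Fin T,
    if (j : ℕ) < t then M.A ^ ((t : ℕ) - 1 - j) * M.excCov covU * (M.A ^ ((t : ℕ) - 1 - j))ᵀ else 0
  have hΓ := M.excCov_posSemidef hW hU
  have hG : G.PosSemidef := by
    refine Matrix.posSemidef_sum _ fun t _ => Matrix.posSemidef_sum _ fun j _ => ?_
    split_ifs
    · have := hΓ.mul_mul_conjTranspose_same (M.A ^ ((t : ℕ) - 1 - j))
      rwa [Matrix.conjTranspose_eq_transpose_of_trivial] at this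
    · exact Matrix.PosSemidef.zero
  have hGv : ∀ v, ⟪v, G.toEuclideanLin v⟫ = ∑ t : Fin (T + 1), ∑ j : Fin T,
      ⟪M.stateCoeff t v j, (M.excCov covU).toEuclideanLin (M.stateCoeff t v j)⟫ := by
    intro v
    simp only [G, map_sum, LinearMap.sum_apply, inner_sum]
    refine Finset.sum_congr rfl fun t _ => Finset.sum_congr rfl fun j _ => ?_
    simp only [stateCoeff]
    split_ifs
    · rw [toEuclideanLin_mul_apply, toEuclideanLin_mul_apply, toEuclideanLin_transpose,
        LinearMap.adjoint_inner_left]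
    · simp
  refine measure_exists_norm_sq_lt_half (P := M.excLaw covU T)
    (fun z => analysis (M.stateCLM T z)) hGs (fun v => ?_)
    (K := ψw * (2 * ψA / (1 - ρA)) ^ 2) (by positivity) (by positivity) hp0 hp1
    (fun v c => ?_) hG (fun v => ?_) (fun v => ?_) hx
  · refine ext_inner_left ℝ fun c => ?_
    rw [inner_zero_right, ← integral_inner (hGs v).integrable]
    simp_rw [inner_analysis_state]
    exact M.integral_excitation _
  · simp_rw [inner_analysis_state]
    rw [M.integral_excitation_sq hW hU]
    refine (Finset.sum_le_sum fun j _ => hψw _).trans ?_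
    rw [← Finset.mul_sum, mul_assoc, mul_assoc]
    refine mul_le_mul_of_nonneg_left ?_ hψw0.le
    rw [← mul_assoc]
    exact M.sum_norm_stateCoeff_sq_le hM T c v
  · rw [integral_norm_sq_eq_sum (hGs v).memLp_two, hGv]
    refine Finset.sum_congr rfl fun t _ => ?_
    have h1 : ∀ z, ⟪EuclideanSpace.basisFun (Fin (T + 1)) ℝ t, analysis (M.stateCLM T z) v⟫ =
        ∑ j, ⟪M.stateCoeff t v j, M.B.toEuclideanLin (z.1 j) + z.2 j⟫ := by
      intro z
      rw [← inner_state_eq]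
      rw [EuclideanSpace.basisFun_inner, analysis_apply, stateCLM_apply]
    simp_rw [h1]
    exact M.integral_excitation_sq hW hU _
  · rw [hGv]
    exact M.sum_stateCoeff_ge hW hφu hφu0.le hφr hT v

end LTISystem

/-! ### Probability that PCA fails -/

section SingularValues

variable {α β : Type*} [Fintype α] [Fintype β] [DecidableEq β]

theorem rank_eq_finrank_range_toEuclideanLin (P : Matrix α β ℝ) :
    P.rank = Module.finrank ℝ (LinearMap.range P.toEuclideanLin) :=
  P.rank_eq_finrank_range_toLin (PiLp.basisFun 2 ℝ α) (PiLp.basisFun 2 ℝ β)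

theorem svMin_mul_norm_le [DecidableEq α] (P : Matrix α β ℝ) {v : EuclideanSpace ℝ α}
    (hv : v ∈ LinearMap.range P.toEuclideanLin) :
    svMin P * ‖v‖ ≤ ‖Pᵀ.toEuclideanLin v‖ := by
  rw [toEuclideanLin_transpose, svMin, sv, rank_eq_finrank_range_toEuclideanLin]
  exact singularValues_mul_norm_le_norm_adjoint _ hv

theorem svMin_pos {P : Matrix α β ℝ} (h : 0 < P.rank) : 0 < svMin P := by
  rw [svMin, sv, LinearMap.singularValues_pos_iff_lt_finrank_range,
    ← rank_eq_finrank_range_toEuclideanLin]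
  exact Nat.sub_lt h one_pos

theorem svMin_mul_norm_sq_le_inner {d : ℕ} {S : Matrix (Fin d) (Fin d) ℝ} (hS : S.PosDef)
    (x : Vec d) : svMin S * ‖x‖ ^ 2 ≤ ⟪x, S.toEuclideanLin x⟫ := by
  obtain ⟨b, hb⟩ := exists_eigenbasis_singularValues
    (Matrix.isPositive_toEuclideanLin_iff.2 hS.posSemidef) (n := d) (by simp)
  rw [real_inner_comm, inner_apply_self_eq_sum _ b _ hb, norm_sq_eq_sum_inner b, Finset.mul_sum]
  refine Finset.sum_le_sum fun i _ => mul_le_mul_of_nonneg_right ?_ (sq_nonneg _)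
  rw [svMin, sv, Matrix.rank_of_isUnit _ hS.isUnit, Fintype.card_fin]
  exact S.toEuclideanLin.singularValues_antitone (by omega)

theorem inner_le_svMax_mul_norm_sq {d : ℕ} {S : Matrix (Fin d) (Fin d) ℝ} (hS : S.PosSemidef)
    (x : Vec d) : ⟪x, S.toEuclideanLin x⟫ ≤ svMax S * ‖x‖ ^ 2 := by
  obtain ⟨b, hb⟩ := exists_eigenbasis_singularValues
    (Matrix.isPositive_toEuclideanLin_iff.2 hS) (n := d) (by simp)
  rw [real_inner_comm, inner_apply_self_eq_sum _ b _ hb, norm_sq_eq_sum_inner b, Finset.mul_sum]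
  exact Finset.sum_le_sum fun i _ => mul_le_mul_of_nonneg_right
    (S.toEuclideanLin.singularValues_antitone (Nat.zero_le _)) (sq_nonneg _)

theorem le_svMax_smul_one {d : ℕ} (hd : 0 < d) {c : ℝ} (hc : 0 ≤ c) :
    c ≤ svMax (c • (1 : Matrix (Fin d) (Fin d) ℝ)) := by
  have h := inner_le_svMax_mul_norm_sq (S := c • (1 : Matrix (Fin d) (Fin d) ℝ))
    (Matrix.PosSemidef.one.smul hc) (EuclideanSpace.single ⟨0, hd⟩ 1)
  simpa [real_inner_smul_right] using h

theorem range_toEuclideanLin_eq_top {P : Matrix α β ℝ} (h : P.rank = Fintype.card α) :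
    LinearMap.range P.toEuclideanLin = ⊤ := by
  refine Submodule.eq_top_of_finrank_eq ?_
  rw [← rank_eq_finrank_range_toEuclideanLin, h, finrank_euclideanSpace]

end SingularValues

namespace LTISystem

variable {r n m : ℕ} (M : LTISystem r n m)

theorem noiseLaw_apply (covU : Matrix (Fin m) (Fin m) ℝ) (T : ℕ) (s : Set (Noise r n m T)) :
    M.noiseLaw covU T s = ((M.excLaw covU T).prod
      (Measure.pi fun _ => multivariateGaussian 0 M.covEta)) (MeasurableEquiv.prodAssoc ⁻¹' s) :=
  (MeasurePreserving.measure_preimage_equiv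
    (f := MeasurableEquiv.prodAssoc) (measurePreserving_prodAssoc _ _ _) s).symm

/-- The observation noise correlates little with the realized state directions: conditionally on
the states these span a subspace of dimension at most `r`. -/
theorem measure_state_noise_correlation_le (covU : Matrix (Fin m) (Fin m) ℝ) {T : ℕ}
    {σ κ p x : ℝ} (hκ0 : 0 < κ) (hκ : σ ^ 2 ≤ κ) (hp0 : 0 < p) (hp1 : p ≤ 1)
    (hx : 4 * r + 2 + Real.log (1 / p) ≤ x) :
    ((M.excLaw covU T).prod (Measure.pi fun _ : Fin (T + 1) => multivariateGaussian (0 : Vec n)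
      (σ ^ 2 • (1 : Matrix (Fin n) (Fin n) ℝ))))
      {ω | ∃ v, (n * σ ^ 2 + 4 * (4 * √(κ * (n * σ ^ 2) * x) + 8 * κ * x)) *
        ‖analysis (M.stateCLM T ω.1) v‖ ^ 2 <
        ‖(analysis ω.2).adjoint (analysis (M.stateCLM T ω.1) v)‖ ^ 2} ≤ ENNReal.ofReal p := by
  set Q := Measure.pi fun _ : Fin (T + 1) => multivariateGaussian (0 : Vec n)
      (σ ^ 2 • (1 : Matrix (Fin n) (Fin n) ℝ))
  have hopen : IsOpen {ω : ((Fin T → Vec m) × (Fin T → Vec r)) × (Fin (T + 1) → Vec n) |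
      ∃ v, (n * σ ^ 2 + 4 * (4 * √(κ * (n * σ ^ 2) * x) + 8 * κ * x)) *
        ‖analysis (M.stateCLM T ω.1) v‖ ^ 2 <
        ‖(analysis ω.2).adjoint (analysis (M.stateCLM T ω.1) v)‖ ^ 2} := by
    rw [Set.ofPred_exists]
    refine isOpen_iUnion fun v => ?_
    have h1 : Continuous fun ω : ((Fin T → Vec m) × (Fin T → Vec r)) × (Fin (T + 1) → Vec n) =>
        analysis (M.stateCLM T ω.1) v :=
      (analysisCLM r (T + 1) v).continuous.comp ((M.stateCLM T).continuous.comp continuous_fst)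
    have h2 : Continuous fun ω : ((Fin T → Vec m) × (Fin T → Vec r)) × (Fin (T + 1) → Vec n) =>
        (analysis ω.2).adjoint (analysis (M.stateCLM T ω.1) v) := by
      simp_rw [adjoint_analysis_apply, analysis_apply]
      have h3 : ∀ t, Continuous fun ω : ((Fin T → Vec m) × (Fin T → Vec r)) ×
          (Fin (T + 1) → Vec n) => M.stateCLM T ω.1 t := fun t =>
        (continuous_apply t).comp ((M.stateCLM T).continuous.comp continuous_fst)
      refine continuous_finsetSum _ fun t _ =>
        Continuous.smul (f := fun ω : ((Fin T → Vec m) × (Fin T → Vec r)) ×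
          (Fin (T + 1) → Vec n) => ⟪M.stateCLM T ω.1 t, v⟫) ((h3 t).inner continuous_const) ?_
      exact (continuous_apply t).comp continuous_snd
    exact isOpen_lt (continuous_const.mul (h1.norm.pow 2)) (h2.norm.pow 2)
  rw [Measure.prod_apply hopen.measurableSet]
  refine (lintegral_mono (g := fun _ => ENNReal.ofReal p) fun z => ?_).trans (by simp)
  have hU : Module.finrank ℝ (LinearMap.range (analysis (M.stateCLM T z))) ≤ r := by
    simpa using LinearMap.finrank_range_le (analysis (M.stateCLM T z))
  have hU' : (Module.finrank ℝ (LinearMap.range (analysis (M.stateCLM T z))) : ℝ) ≤ r := by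
    exact_mod_cast hU
  refine (measure_mono ?_).trans (measure_noise_correlation_le (d := n) (N := T + 1) hκ0 hκ hp0 hp1
    (LinearMap.range (analysis (M.stateCLM T z))) (x := x) (by linarith))
  rintro ξ ⟨v, hv⟩
  exact ⟨_, ⟨v, rfl⟩, hv⟩

/-- PCA succeeds on the observations of a trajectory outside three rare events: too little
excitation, anisotropic noise, and noise correlated with the states. -/
theorem measure_pca_failure_le {covU : Matrix (Fin m) (Fin m) ℝ} {ση ψA ρA κ p : ℝ}
    (hr : 0 < M.C.rank) (hrn : M.C.rank < n) (hctrl : M.ctrlMatrix.rank = r)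
    (hW : M.covW.PosSemidef) (hη : M.covEta = ση ^ 2 • (1 : Matrix (Fin n) (Fin n) ℝ))
    (hU : covU.PosDef) (hm : 0 < covU.rank) (hM : M.IsStableWith ψA ρA)
    (hκ0 : 0 < κ) (hκ : ση ^ 2 ≤ κ)
    {T : ℕ} (hT : 2 * r ≤ T) (hT0 : 0 < T) (hp0 : 0 < p) (hp1 : p ≤ 1) {x y h b e : ℝ}
    (hx : 4 * r + 2 + Real.log (1 / p) ≤ x) (hy : 4 * n + 2 + Real.log (1 / p) ≤ y)
    (hexc : 2025 * (M.psiW covU * (2 * ψA / (1 - ρA)) ^ 2) * x ≤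
      T / 2 * (phiU covU * M.phiR ^ 2))
    (hh0 : 0 < h) (hh : h ^ 2 = T / 2 * (phiU covU * M.phiR ^ 2) / 2 * M.phiC ^ 2)
    (hb0 : 0 ≤ b)
    (hb : n * ση ^ 2 + 4 * (4 * √(κ * (n * ση ^ 2) * x) + 8 * κ * x) ≤ b ^ 2)
    (he : 4 * (4 * √(κ * ((T + 1 : ℕ) * ση ^ 2) * y) + 8 * κ * y) ≤ e)
    (hbh : 8 * b ≤ h) (heh : 16 * e ≤ h ^ 2)
    (hgap : (T : ℝ) ^ (3 / 4 : ℝ) < h ^ 2 / 2) (htail : 2 * e + b ^ 2 ≤ (T : ℝ) ^ (3 / 4 : ℝ)) :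
    M.noiseLaw covU T {ω | ¬ (rankEst (M.trajectory T ω).1 = M.C.rank ∧
      ∀ Φ : Matrix (Fin n) (Fin M.C.rank) ℝ, Φᵀ * Φ = 1 →
      (sampleCov (M.trajectory T ω).1 * Φ =
        Φ * Matrix.diagonal fun i : Fin M.C.rank => sv (sampleCov (M.trajectory T ω).1) i) →
      ∀ z ∈ LinearMap.range M.C.toEuclideanLin,
        ‖z - (Φ * Φᵀ).toEuclideanLin z‖ ≤ (4 * (b / h) + 4 * (e / h ^ 2)) * ‖z‖)} ≤
      ENNReal.ofReal p + ENNReal.ofReal p + ENNReal.ofReal p := by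
  have hφu0 : 0 < phiU covU := lt_min one_pos (svMin_pos hm)
  have hφC0 : 0 < M.phiC := lt_min one_pos (svMin_pos hr)
  have hr' : 0 < r := hr.trans_le (by simpa using M.C.rank_le_width)
  have hφR0 : 0 < M.phiR := lt_min one_pos (svMin_pos (by rw [hctrl]; exact hr'))
  have hφu : ∀ x, phiU covU * ‖x‖ ^ 2 ≤ ⟪x, covU.toEuclideanLin x⟫ := fun x =>
    (mul_le_mul_of_nonneg_right (min_le_right _ _) (sq_nonneg _)).trans
      (svMin_mul_norm_sq_le_inner hU x)
  have hφr : ∀ v, M.phiR ^ 2 * ‖v‖ ^ 2 ≤ ‖M.ctrlMatrixᵀ.toEuclideanLin v‖ ^ 2 := fun v => by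
    rw [← mul_pow]
    refine pow_le_pow_left₀ (by positivity) ?_ 2
    refine (mul_le_mul_of_nonneg_right (min_le_right _ _) (norm_nonneg _)).trans
      (svMin_mul_norm_le _ ?_)
    rw [range_toEuclideanLin_eq_top (by simpa using hctrl)]
    trivial
  have hψw0 : 0 < M.psiW covU := zero_lt_one.trans_le (le_max_left _ _)
  have hψw : ∀ g, ⟪g, (M.excCov covU).toEuclideanLin g⟫ ≤ M.psiW covU * ‖g‖ ^ 2 := fun g =>
    (inner_le_svMax_mul_norm_sq (M.excCov_posSemidef hW hU.posSemidef) g).trans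
      (mul_le_mul_of_nonneg_right (le_max_right _ _) (sq_nonneg _))
  have he0 : 0 ≤ e := by
    refine le_trans ?_ he
    have : 0 ≤ Real.log (1 / p) := Real.log_nonneg (by rw [le_div_iff₀ hp0]; linarith)
    have hy0 : 0 ≤ y := le_trans (by positivity) hy
    positivity
  have ha := M.measure_state_energy_lt_le hW hU.posSemidef hM hφu hφu0 hφr (by positivity) hψw hψw0
    hT hT0 hp0 hp1 (le_trans (mul_le_mul_of_nonneg_left hx (by positivity)) hexc)
  have hb' := measure_noise_energy_le (d := n) (N := T + 1) hκ0 hκ hp0 hp1 hy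
  have hc := M.measure_state_noise_correlation_le (n := n) covU (T := T) hκ0 hκ hp0 hp1 hx
  rw [noiseLaw_apply, hη]
  set Pz := M.excLaw covU T
  set Q := Measure.pi fun _ : Fin (T + 1) => multivariateGaussian (0 : Vec n)
      (ση ^ 2 • (1 : Matrix (Fin n) (Fin n) ℝ))
  set S₁ := {z | ∃ v, ‖analysis (M.stateCLM T z) v‖ ^ 2 <
      T / 2 * (phiU covU * M.phiR ^ 2) / 2 * ‖v‖ ^ 2}
  set S₂ := {ξ : Fin (T + 1) → Vec n | ∃ a,
    4 * (4 * √(κ * ((T + 1 : ℕ) * ση ^ 2) * y) + 8 * κ * y) * ‖a‖ ^ 2 <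
        |‖analysis ξ a‖ ^ 2 - (T + 1 : ℕ) * ση ^ 2 * ‖a‖ ^ 2|}
  set S₃ := {ω : ((Fin T → Vec m) × (Fin T → Vec r)) × (Fin (T + 1) → Vec n) |
    ∃ v, (n * ση ^ 2 + 4 * (4 * √(κ * (n * ση ^ 2) * x) + 8 * κ * x)) *
        ‖analysis (M.stateCLM T ω.1) v‖ ^ 2 <
        ‖(analysis ω.2).adjoint (analysis (M.stateCLM T ω.1) v)‖ ^ 2}
  have h1 : (Pz.prod Q) (S₁ ×ˢ Set.univ) ≤ ENNReal.ofReal p := by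
    rw [Measure.prod_prod, measure_univ, mul_one]; exact ha
  have h2 : (Pz.prod Q) (Set.univ ×ˢ S₂) ≤ ENNReal.ofReal p := by
    rw [Measure.prod_prod, measure_univ, one_mul]; exact hb'
  refine le_trans (measure_mono (t := (S₁ ×ˢ Set.univ ∪ Set.univ ×ˢ S₂) ∪ S₃) ?_)
    ((measure_union_le _ _).trans (add_le_add ((measure_union_le _ _).trans (add_le_add h1 h2)) hc))
  rintro ⟨z, ξ⟩ hω
  by_contra hgood
  apply hω
  simp only [Set.mem_union, Set.mem_prod, Set.mem_univ, and_true, true_and, not_or] at hgood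
  obtain ⟨⟨g1, g2⟩, g3⟩ := hgood
  simp only [S₁, Set.mem_ofPred_eq, not_exists, not_lt] at g1
  simp only [S₂, Set.mem_ofPred_eq, not_exists, not_lt] at g2
  simp only [S₃, Set.mem_ofPred_eq, not_exists, not_lt] at g3
  have H : SignalNoise (LinearMap.range M.C.toEuclideanLin)
      (analysis (M.stateCLM T z) ∘ₗ M.C.toEuclideanLin.adjoint) (analysis ξ) h b e
      ((T + 1 : ℕ) * ση ^ 2) := by
    refine ⟨fun q => ?_, hh0, hb0, fun v hv => ?_, fun v => ?_, fun v => ?_⟩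
    · rw [LinearMap.adjoint_comp, LinearMap.adjoint_adjoint]
      exact ⟨_, rfl⟩
    · refine le_of_sq_le_sq ?_ (norm_nonneg _)
      rw [LinearMap.comp_apply, mul_pow, hh]
      refine le_trans ?_ (g1 _)
      rw [mul_assoc]
      refine mul_le_mul_of_nonneg_left ?_ (by positivity)
      rw [← mul_pow]
      refine pow_le_pow_left₀ (by positivity) ?_ 2
      rw [← toEuclideanLin_transpose]
      exact (mul_le_mul_of_nonneg_right (min_le_right _ _) (norm_nonneg _)).trans
        (svMin_mul_norm_le _ hv)
    · refine le_of_sq_le_sq ?_ (by positivity)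
      rw [mul_pow]
      exact (g3 _).trans (mul_le_mul_of_nonneg_right hb (sq_nonneg _))
    · exact (g2 v).trans (mul_le_mul_of_nonneg_right he (sq_nonneg _))
  refine H.pca ?_ (rank_eq_finrank_range_toEuclideanLin _).symm hr hrn he0 hbh heh hgap htail
  rw [← analysis_comp_adjoint, ← analysis_add]
  rfl

end LTISystem

/-! ### Sample size -/

section Numerics

/-- Scalar estimates behind the choice of the noise levels `b² = 369 ψ N L` (correlation) and
`e = 368 ψ √(T N L)` (energy), against the signal strength `h² = T φ / 4`. -/
theorem pca_level_estimates {N R T ψ φ L σ x y : ℝ} (hR : 0 ≤ R) (hRN : R ≤ N) (hN : 1 ≤ N)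
    (hψ : 1 ≤ ψ) (hφ0 : 0 < φ) (hφ1 : φ ≤ 1) (hL : 1 ≤ L) (hσ0 : 0 ≤ σ) (hσ : σ ≤ ψ)
    (hT1 : 1 ≤ T)
    (hx : x = 4 * R + 2 + 3 * L) (hy : y = 4 * N + 2 + 3 * L)
    (h1 : 10 ^ 10 * (ψ ^ 2 * L * N) ≤ φ ^ 2 * T) (h2 : 10 ^ 13 ≤ φ ^ 4 * T)
    (h3 : 10 ^ 13 * (ψ ^ 4 * L ^ 2 * N ^ 2) ≤ T) :
    ∃ h b e : ℝ, 0 < h ∧ h ^ 2 = T * φ / 4 ∧ 0 ≤ b ∧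
      N * σ + 4 * (4 * √(ψ * (N * σ) * x) + 8 * ψ * x) ≤ b ^ 2 ∧
      4 * (4 * √(ψ * ((T + 1) * σ) * y) + 8 * ψ * y) ≤ e ∧ 8 * b ≤ h ∧ 16 * e ≤ h ^ 2 ∧
      T ^ (3 / 4 : ℝ) < h ^ 2 / 2 ∧ 2 * e + b ^ 2 ≤ T ^ (3 / 4 : ℝ) ∧
      4 * (b / h) + 4 * (e / h ^ 2) ≤ 6100 * (ψ / φ * √L * √(N / T)) ∧
      6100 * (ψ / φ * √L * √(N / T)) ≤ 1 / 2 := by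
  have hψ0 : 0 < ψ := by linarith
  have hT0 : 0 < T := by linarith
  have hN0 : 0 < N := by linarith
  have hL0 : 0 < L := by linarith
  obtain ⟨g, hg⟩ : ∃ g, g = √(L * (N / T)) := ⟨_, rfl⟩
  have hg0 : 0 < g := by rw [hg]; positivity
  have hg2 : g ^ 2 * T = L * N := by
    rw [hg, Real.sq_sqrt (by positivity)]; field_simp
  obtain ⟨a, ha⟩ : ∃ a, a = ψ / φ * g := ⟨_, rfl⟩
  have ha0 : 0 < a := by rw [ha]; positivity
  have haφ : a * φ = ψ * g := by rw [ha]; field_simp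
  have ha_eq : ψ / φ * √L * √(N / T) = a := by
    rw [ha, hg, Real.sqrt_mul hL0.le, mul_assoc]
  have ha1 : a ≤ 1 / 10 ^ 5 := by
    have h4 : (10 ^ 5 * a) ^ 2 * (φ ^ 2 * T) ≤ 1 * (φ ^ 2 * T) := by
      calc (10 ^ 5 * a) ^ 2 * (φ ^ 2 * T) = 10 ^ 10 * (a * φ) ^ 2 * T := by ring
        _ = 10 ^ 10 * ψ ^ 2 * (g ^ 2 * T) := by rw [haφ]; ring
        _ = 10 ^ 10 * (ψ ^ 2 * L * N) := by rw [hg2]; ring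
        _ ≤ 1 * (φ ^ 2 * T) := by linarith
    have h5 := le_of_mul_le_mul_right h4 (by positivity)
    have h6 : 10 ^ 5 * a ≤ 1 := (pow_le_one_iff_of_nonneg (by positivity) two_ne_zero).1 h5
    linarith
  have hψg : ψ * g ≤ a := by rw [← haφ]; exact mul_le_of_le_one_right ha0.le hφ1
  have hga : g ≤ a := (le_mul_of_one_le_left hg0.le hψ).trans hψg
  have hg1 : g ≤ 1 := by linarith
  have hgT : g ^ 2 * T ≤ T * g := by
    rw [mul_comm]
    exact mul_le_mul_of_nonneg_left (pow_le_of_le_one hg0.le hg1 two_ne_zero) hT0.le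
  have hNL : N ≤ L * N := le_mul_of_one_le_left hN0.le hL
  have hLN : L ≤ L * N := le_mul_of_one_le_right hL0.le hN
  have hLN1 : 1 ≤ L * N := by linarith
  have hx0 : 0 ≤ x := by rw [hx]; positivity
  have hy0 : 0 ≤ y := by rw [hy]; positivity
  have hx9 : x ≤ 9 * (L * N) := by rw [hx]; linarith
  have hy9 : y ≤ 9 * (g ^ 2 * T) := by rw [hg2, hy]; linarith
  have hh2 : √(T * φ / 4) ^ 2 = T * φ / 4 := Real.sq_sqrt (by positivity)
  have hh0 : 0 < √(T * φ / 4) := by positivity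
  have hb2 : √(369 * ψ * (g ^ 2 * T)) ^ 2 = 369 * ψ * (g ^ 2 * T) :=
    Real.sq_sqrt (by positivity)
  have hbh : √(369 * ψ * (g ^ 2 * T)) ≤ 39 * a * √(T * φ / 4) := by
    refine le_of_sq_le_sq ?_ (by positivity)
    rw [mul_pow, hb2, hh2]
    have : ψ * g * g ≤ a * φ * a := by rw [haφ]; exact mul_le_mul_of_nonneg_left hga (by positivity)
    have h7 : 0 ≤ T * (a * φ * a - ψ * g * g) := mul_nonneg hT0.le (by linarith)
    have h8 : 0 ≤ T * (a * φ * a) := by positivity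
    linarith
  -- fourth root of the length
  obtain ⟨t, ht0, htT⟩ : ∃ t : ℝ, 0 < t ∧ t ^ 4 = T := by
    refine ⟨T ^ (1 / 4 : ℝ), by positivity, ?_⟩
    rw [← Real.rpow_natCast, ← Real.rpow_mul hT0.le]; norm_num
  have ht3 : T ^ (3 / 4 : ℝ) = t ^ 3 := by
    rw [← htT, ← Real.rpow_natCast, ← Real.rpow_mul ht0.le, ← Real.rpow_natCast]; norm_num
  refine ⟨√(T * φ / 4), √(369 * ψ * (g ^ 2 * T)), 368 * ψ * (T * g), hh0, hh2, by positivity,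
    ?_, ?_, ?_, ?_, ?_, ?_, ?_, ?_⟩
  · have h4 : √(ψ * (N * σ) * x) ≤ 3 * ψ * (L * N) := by
      refine Real.sqrt_le_iff.2 ⟨by positivity, ?_⟩
      calc ψ * (N * σ) * x ≤ ψ * ((L * N) * ψ) * (9 * (L * N)) := by gcongr
        _ = (3 * ψ * (L * N)) ^ 2 := by ring
    have h5 : ψ * x ≤ ψ * (9 * (L * N)) := mul_le_mul_of_nonneg_left hx9 hψ0.le
    have h6 : N * σ ≤ L * N * ψ := by gcongr
    have h7 : 0 ≤ ψ * (L * N) := by positivity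
    rw [hb2, hg2]
    linarith
  · have h4 : √(ψ * ((T + 1) * σ) * y) ≤ 5 * ψ * (T * g) := by
      refine Real.sqrt_le_iff.2 ⟨by positivity, ?_⟩
      calc ψ * ((T + 1) * σ) * y ≤ ψ * ((T + T) * ψ) * (9 * (g ^ 2 * T)) := by gcongr
        _ = 18 * (ψ * (T * g)) ^ 2 := by ring
        _ ≤ 25 * (ψ * (T * g)) ^ 2 := by gcongr; norm_num
        _ = (5 * ψ * (T * g)) ^ 2 := by ring
    have h5 : ψ * y ≤ ψ * (9 * (T * g)) := by
      exact mul_le_mul_of_nonneg_left (hy9.trans (by linarith)) hψ0.le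
    linarith
  · have h4 : 39 * a * √(T * φ / 4) ≤ 1 / 8 * √(T * φ / 4) :=
      mul_le_mul_of_nonneg_right (by linarith) hh0.le
    linarith
  · rw [hh2]
    have : 0 ≤ T * φ * (1 / 4 - 5888 * a) := mul_nonneg (by positivity) (by linarith)
    have h4 : ψ * (T * g) = T * φ * a := by
      calc ψ * (T * g) = T * (ψ * g) := by ring
        _ = _ := by rw [← haφ]; ring
    linarith
  · rw [ht3, hh2]
    have h4 : 8 < t * φ := by
      by_contra hcon
      have h5 : (t * φ) ^ 4 ≤ 8 ^ 4 := pow_le_pow_left₀ (by positivity) (not_lt.1 hcon) 4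
      rw [mul_pow, htT] at h5
      linarith
    have : 0 < t ^ 3 * (t * φ - 8) := mul_pos (by positivity) (by linarith)
    rw [← htT]
    linarith
  · rw [ht3, hb2]
    have h4 : 1105 * ψ * g * t ≤ 1 := by
      by_contra hcon
      have h5 : 1 < (1105 * ψ * g * t) ^ 4 := one_lt_pow₀ (not_le.1 hcon) (by norm_num)
      have h6 : (1105 * ψ * g * t) ^ 4 * T ≤ T := by
        calc (1105 * ψ * g * t) ^ 4 * T = 1105 ^ 4 * ψ ^ 4 * (g ^ 2 * T) ^ 2 * t ^ 4 / T := by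
              field_simp
          _ = 1105 ^ 4 * (ψ ^ 4 * L ^ 2 * N ^ 2) := by rw [htT, hg2]; field_simp
          _ ≤ 10 ^ 13 * (ψ ^ 4 * L ^ 2 * N ^ 2) := by gcongr; norm_num
          _ ≤ T := h3
      exact absurd h6 (not_le.2 (lt_mul_of_one_lt_left hT0 h5))
    have h8 : ψ * (g ^ 2 * T) ≤ ψ * (T * g) := mul_le_mul_of_nonneg_left hgT hψ0.le
    have h9 : 1105 * (ψ * (T * g)) ≤ t ^ 3 := by
      rw [← htT]
      have := mul_le_mul_of_nonneg_right h4 (by positivity : 0 ≤ t ^ 3)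
      linarith
    linarith
  · rw [ha_eq, hh2]
    have h4 : √(369 * ψ * (g ^ 2 * T)) / √(T * φ / 4) ≤ 39 * a := by
      rw [div_le_iff₀ hh0]; exact hbh
    have h5 : 368 * ψ * (T * g) / (T * φ / 4) = 1472 * a := by
      rw [ha]; field_simp; norm_num
    rw [h5]
    linarith
  · rw [ha_eq]; linarith

theorem log_six_div_le {δ : ℝ} (hδ : 0 < δ) (hL : 1 ≤ Real.log (1 / δ)) :
    Real.log (1 / (δ / 6)) ≤ 3 * Real.log (1 / δ) := by
  have h1 : Real.log (1 / (δ / 6)) = Real.log 6 + Real.log (1 / δ) := by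
    rw [← Real.log_mul (by norm_num) (by positivity)]; congr 1; field_simp
  have h2 : Real.log 6 ≤ 2 := by
    rw [Real.log_le_iff_le_exp (by norm_num)]
    have h3 := Real.exp_one_gt_d9
    have h4 : Real.exp 2 = Real.exp 1 * Real.exp 1 := by rw [← Real.exp_add]; norm_num
    nlinarith
  linarith

end Numerics

namespace LTISystem

variable {r n m : ℕ} (M : LTISystem r n m)

theorem rank_C_pos (hr : 0 < r) (hobs : M.obsMatrix.rank = r) : 0 < M.C.rank := by
  by_contra hcon
  have h0 : M.C = 0 := by
    have h1 : Module.finrank ℝ (LinearMap.range M.C.toEuclideanLin) = 0 := by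
      rw [← rank_eq_finrank_range_toEuclideanLin]; omega
    have h2 := LinearMap.range_eq_bot.1 (Submodule.finrank_eq_zero.1 h1)
    exact (LinearEquiv.map_eq_zero_iff Matrix.toEuclideanLin).1 h2
  have h3 : M.obsMatrix = 0 := by
    ext ki j
    simp [obsMatrix, h0]
  rw [h3, Matrix.rank_zero] at hobs
  omega

theorem rank_covU_pos {covU : Matrix (Fin m) (Fin m) ℝ} (hU : covU.PosDef) (hr : 0 < r)
    (hctrl : M.ctrlMatrix.rank = r) : 0 < covU.rank := by
  rw [Matrix.rank_of_isUnit _ hU.isUnit, Fintype.card_fin]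
  by_contra hcon
  have := M.ctrlMatrix.rank_le_card_width
  simp only [Fintype.card_prod, Fintype.card_fin] at this
  have h0 : r * m = 0 := by rw [Nat.eq_zero_of_not_pos hcon, mul_zero]
  omega

/-- The sample size required by `kappa3` in the form in which it is used. The denominators are
cleared and the double logarithm is bounded below by `ℓ`. -/
theorem sample_size_of_kappa3 {covU : Matrix (Fin m) (Fin m) ℝ} {ψA ρA δ ℓ : ℝ} {T : ℕ}
    (hr : 0 < r) (hn : 0 < n) (hmin : M.IsMinimal) (hU : covU.PosDef)
    (hM : M.IsStableWith ψA ρA) (hδ : 0 < δ) (hL : 1 ≤ Real.log (1 / δ)) (hℓ0 : 0 < ℓ)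
    (hℓ : ℓ ≤ Real.log (Real.log (1 / δ)))
    (hT : 10 ^ 13 * (1 + 1 / ℓ ^ 2) * M.kappa3 covU ψA ρA δ * n ^ 2 * r ^ 3 ≤ T) :
    10 ^ 13 * M.kappa4 covU δ ^ 2 * n ≤ T ∧
    10 ^ 13 * ((M.psiEta ^ 2 * M.psiC ^ 2 * M.psiW covU * ψA ^ 2) ^ 2 *
      Real.log (1 / δ) ^ 4 * n ^ 2 * r ^ 3) ≤
      T * (1 - ρA ^ 2) ^ 2 * (phiU covU * M.phiC ^ 2 * M.phiR ^ 2) ^ 4 := by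
  have hφu0 : 0 < phiU covU := lt_min one_pos (svMin_pos (M.rank_covU_pos hU hr hmin.1))
  have hφC0 : 0 < M.phiC := lt_min one_pos (svMin_pos (M.rank_C_pos hr hmin.2))
  have hφR0 : 0 < M.phiR := lt_min one_pos (svMin_pos (by rw [hmin.1]; exact hr))
  have hφO0 : 0 < M.phiO := lt_min one_pos (svMin_pos (by rw [hmin.2]; exact hr))
  have hφO1 : M.phiO ≤ 1 := min_le_left _ _
  have hψC : 1 ≤ M.psiC := le_max_left _ _
  have hψη : 1 ≤ M.psiEta := le_max_left _ _
  have hψw : 1 ≤ M.psiW covU := le_max_left _ _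
  obtain ⟨hψA, hρ0, hρ1, -⟩ := hM
  have hu0 : 0 < 1 - ρA ^ 2 := sub_pos.2 (pow_lt_one₀ hρ0.le hρ1 two_ne_zero)
  have hu1 : 1 - ρA ^ 2 ≤ 1 := sub_le_self _ (sq_nonneg _)
  have hr1 : (1 : ℝ) ≤ r := by exact_mod_cast hr
  have hn1 : (1 : ℝ) ≤ n := by exact_mod_cast hn
  set L := Real.log (1 / δ) with hLdef
  set u := 1 - ρA ^ 2 with hu
  have hLr : L ≤ Real.log (r / δ) := by
    refine Real.log_le_log (by positivity) ?_
    gcongr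
  have hk4 : M.kappa4 covU δ ^ 2 ≤ M.kappa3 covU ψA ρA δ := by
    refine le_trans ?_ (le_max_left _ _)
    refine le_mul_of_one_le_right (sq_nonneg _) ?_
    rw [one_le_div (by positivity)]
    have h1 : u * M.phiO ^ 2 ≤ 1 := mul_le_one₀ hu1 (by positivity) (pow_le_one₀ hφO0.le hφO1)
    have h2 : 1 ≤ ψA ^ 2 * M.psiC ^ 2 :=
      one_le_mul_of_one_le_of_one_le (one_le_pow₀ hψA) (one_le_pow₀ hψC)
    linarith
  have hκ0 : 0 ≤ M.kappa3 covU ψA ρA δ := (sq_nonneg _).trans hk4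
  have hlog : ℓ ≤ Real.log (M.psiC ^ 2 * M.psiW covU * ψA ^ 4 / u * r * Real.log (r / δ)) := by
    refine hℓ.trans (Real.log_le_log (by linarith) ?_)
    have h1 : 1 ≤ M.psiC ^ 2 * M.psiW covU * ψA ^ 4 / u := by
      rw [one_le_div hu0]
      refine hu1.trans ?_
      exact one_le_mul_of_one_le_of_one_le (one_le_mul_of_one_le_of_one_le (one_le_pow₀ hψC) hψw)
        (one_le_pow₀ hψA)
    have h2 := one_le_mul_of_one_le_of_one_le h1 hr1
    exact hLr.trans (le_mul_of_one_le_left (by linarith) h2)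
  have hk : (M.psiEta ^ 2 * M.psiC ^ 2 * M.psiW covU * ψA ^ 2 /
      (u * phiU covU ^ 2 * M.phiC ^ 4 * M.phiR ^ 4)) ^ 2 * ℓ ^ 2 * L ^ 4 ≤
      M.kappa3 covU ψA ρA δ := by
    refine le_trans ?_ (le_max_right _ _)
    gcongr
  have hnr : (n : ℝ) ≤ n ^ 2 * r ^ 3 :=
    (le_self_pow₀ hn1 two_ne_zero).trans
      (le_mul_of_one_le_right (by positivity) (one_le_pow₀ hr1))
  constructor
  · refine le_trans ?_ hT
    calc 10 ^ 13 * M.kappa4 covU δ ^ 2 * n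
        ≤ 10 ^ 13 * (1 + 1 / ℓ ^ 2) * M.kappa3 covU ψA ρA δ * (n ^ 2 * r ^ 3) := by
          refine mul_le_mul ?_ hnr (by positivity) (by positivity)
          refine mul_le_mul ?_ hk4 (by positivity) (by positivity)
          have : 0 ≤ 1 / ℓ ^ 2 := by positivity
          linarith
      _ = _ := by ring
  · calc 10 ^ 13 * ((M.psiEta ^ 2 * M.psiC ^ 2 * M.psiW covU * ψA ^ 2) ^ 2 *
          L ^ 4 * n ^ 2 * r ^ 3)
        = 10 ^ 13 * (1 / ℓ ^ 2) * ((M.psiEta ^ 2 * M.psiC ^ 2 * M.psiW covU * ψA ^ 2 /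
          (u * phiU covU ^ 2 * M.phiC ^ 4 * M.phiR ^ 4)) ^ 2 * ℓ ^ 2 * L ^ 4) * n ^ 2 * r ^ 3 *
          (u ^ 2 * (phiU covU * M.phiC ^ 2 * M.phiR ^ 2) ^ 4) := by
          field_simp
      _ ≤ 10 ^ 13 * (1 + 1 / ℓ ^ 2) * M.kappa3 covU ψA ρA δ * n ^ 2 * r ^ 3 *
          (u ^ 2 * (phiU covU * M.phiC ^ 2 * M.phiR ^ 2) ^ 4) := by
          gcongr
          linarith
      _ ≤ T * (u ^ 2 * (phiU covU * M.phiC ^ 2 * M.phiR ^ 2) ^ 4) := by gcongr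
      _ = _ := by ring

/-- From `kappa3` many samples on, PCA recovers the rank of the observer, and its column space up
to an error of order `kappa4 * √(n / T)`, which moreover is at most `1 / 2`. -/
theorem measure_pca_failure_le_of_kappa3 {covU : Matrix (Fin m) (Fin m) ℝ} {ση ψA ρA δ ℓ : ℝ}
    {T : ℕ} (hr : 0 < r) (hrn : r < n) (hmin : M.IsMinimal)
    (hW : M.covW.PosSemidef) (hη : M.covEta = ση ^ 2 • (1 : Matrix (Fin n) (Fin n) ℝ))
    (hU : covU.PosDef) (hM : M.IsStableWith ψA ρA)
    (hδ : 0 < δ) (hL : 1 ≤ Real.log (1 / δ)) (hℓ0 : 0 < ℓ)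
    (hℓ : ℓ ≤ Real.log (Real.log (1 / δ)))
    (hT : 10 ^ 13 * (1 + 1 / ℓ ^ 2) * M.kappa3 covU ψA ρA δ * n ^ 2 * r ^ 3 ≤ T) :
    0 < T ∧ 6100 * (M.kappa4 covU δ * √(n / T)) ≤ 1 / 2 ∧
    M.noiseLaw covU T {ω | ¬ (rankEst (M.trajectory T ω).1 = M.C.rank ∧
      ∀ Φ : Matrix (Fin n) (Fin M.C.rank) ℝ, Φᵀ * Φ = 1 →
      (sampleCov (M.trajectory T ω).1 * Φ =
        Φ * Matrix.diagonal fun i : Fin M.C.rank => sv (sampleCov (M.trajectory T ω).1) i) →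
      ∀ z ∈ LinearMap.range M.C.toEuclideanLin,
        ‖z - (Φ * Φᵀ).toEuclideanLin z‖ ≤ 6100 * (M.kappa4 covU δ * √(n / T)) * ‖z‖)} ≤
      ENNReal.ofReal (δ / 2) := by
  have hn : 0 < n := by omega
  obtain ⟨F1, F2⟩ := M.sample_size_of_kappa3 hr hn hmin hU hM hδ hL hℓ0 hℓ hT
  have hrC := M.rank_C_pos hr hmin.2
  have hrU := M.rank_covU_pos hU hr hmin.1
  have hφu0 : 0 < phiU covU := lt_min one_pos (svMin_pos hrU)
  have hφC0 : 0 < M.phiC := lt_min one_pos (svMin_pos hrC)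
  have hφR0 : 0 < M.phiR := lt_min one_pos (svMin_pos (by rw [hmin.1]; exact hr))
  have hφu1 : phiU covU ≤ 1 := min_le_left _ _
  have hφC1 : M.phiC ≤ 1 := min_le_left _ _
  have hφR1 : M.phiR ≤ 1 := min_le_left _ _
  have hψC : 1 ≤ M.psiC := le_max_left _ _
  have hψη : 1 ≤ M.psiEta := le_max_left _ _
  have hψw : 1 ≤ M.psiW covU := le_max_left _ _
  have hση : ση ^ 2 ≤ M.psiEta := by
    refine le_trans ?_ (le_max_right _ _)
    rw [hη]
    exact le_svMax_smul_one hn (sq_nonneg _)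
  obtain ⟨hψA, hρ0, hρ1, -⟩ := id hM
  have hu0 : 0 < 1 - ρA ^ 2 := sub_pos.2 (pow_lt_one₀ hρ0.le hρ1 two_ne_zero)
  have hu1 : 1 - ρA ^ 2 ≤ 1 := sub_le_self _ (sq_nonneg _)
  have hr1 : (1 : ℝ) ≤ r := by exact_mod_cast hr
  have hn1 : (1 : ℝ) ≤ n := by exact_mod_cast hn
  have hδ1 : δ ≤ 1 := by
    by_contra hcon
    have : Real.log (1 / δ) ≤ 0 := Real.log_nonpos (by positivity)
      (by rw [div_le_one hδ]; exact (not_le.1 hcon).le)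
    linarith
  have hlog6 := log_six_div_le hδ hL
  set L := Real.log (1 / δ) with hLdef
  obtain ⟨φ, hφ⟩ : ∃ φ, φ = phiU covU * M.phiC ^ 2 * M.phiR ^ 2 := ⟨_, rfl⟩
  have hφ0 : 0 < φ := by rw [hφ]; positivity
  have hφC2 : M.phiC ^ 2 ≤ 1 := pow_le_one₀ hφC0.le hφC1
  have hφR2 : M.phiR ^ 2 ≤ 1 := pow_le_one₀ hφR0.le hφR1
  have hφ' : φ ≤ phiU covU * M.phiR ^ 2 := by
    rw [hφ, mul_right_comm]
    exact mul_le_of_le_one_right (by positivity) hφC2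
  have hφ1 : φ ≤ 1 := hφ'.trans (mul_le_one₀ hφu1 (by positivity) hφR2)
  have hk4 : M.kappa4 covU δ = M.psiEta / φ * √L := by rw [hφ]; rfl
  rw [← hφ] at F2
  set u := 1 - ρA ^ 2 with hu
  obtain ⟨Wc, hWc⟩ : ∃ W, W = M.psiEta ^ 2 * M.psiC ^ 2 * M.psiW covU * ψA ^ 2 := ⟨_, rfl⟩
  rw [← hWc] at F2
  have hW1 : M.psiEta ^ 2 ≤ Wc := by
    rw [hWc, mul_assoc, mul_assoc]
    refine le_mul_of_one_le_right (by positivity) ?_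
    exact one_le_mul_of_one_le_of_one_le (one_le_pow₀ hψC)
      (one_le_mul_of_one_le_of_one_le hψw (one_le_pow₀ hψA))
  have hW2 : M.psiW covU * ψA ^ 2 ≤ Wc := by
    rw [hWc, mul_assoc]
    refine le_mul_of_one_le_left (by positivity) ?_
    exact one_le_mul_of_one_le_of_one_le (one_le_pow₀ hψη) (one_le_pow₀ hψC)
  have hW3 : 1 ≤ Wc := (one_le_pow₀ hψη).trans hW1
  have hW4 : Wc ≤ Wc ^ 2 := le_self_pow₀ hW3 two_ne_zero
  have hTnn : (0 : ℝ) ≤ T := by positivity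
  have hu2 : u ^ 2 ≤ 1 := pow_le_one₀ hu0.le hu1
  have hL4 : 1 ≤ L ^ 4 := one_le_pow₀ hL
  have hL24 : L ^ 2 ≤ L ^ 4 := pow_le_pow_right₀ hL (by norm_num)
  have hL14 : L ≤ L ^ 4 := le_self_pow₀ hL (by norm_num)
  have hn2 : (1 : ℝ) ≤ n ^ 2 := one_le_pow₀ hn1
  have hr3 : (1 : ℝ) ≤ r ^ 3 := one_le_pow₀ hr1
  have hr13 : (r : ℝ) ≤ r ^ 3 := le_self_pow₀ hr1 (by norm_num)
  have G2 : 10 ^ 13 ≤ φ ^ 4 * T := by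
    have h1 : T * u ^ 2 * φ ^ 4 ≤ φ ^ 4 * T := by
      rw [mul_right_comm, mul_comm (φ ^ 4)]
      exact mul_le_of_le_one_right (by positivity) hu2
    have h2 : 1 ≤ Wc ^ 2 * L ^ 4 * n ^ 2 * r ^ 3 :=
      one_le_mul_of_one_le_of_one_le (one_le_mul_of_one_le_of_one_le
        (one_le_mul_of_one_le_of_one_le (hW3.trans hW4) hL4) hn2) hr3
    linarith
  have hφ4 : φ ^ 4 ≤ 1 := pow_le_one₀ hφ0.le hφ1
  have hTle : T * u ^ 2 * φ ^ 4 ≤ T := by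
    rw [mul_assoc]
    exact mul_le_of_le_one_right hTnn (mul_le_one₀ hu2 (by positivity) hφ4)
  have G3 : 10 ^ 13 * (M.psiEta ^ 4 * L ^ 2 * n ^ 2) ≤ T := by
    refine le_trans ?_ (F2.trans hTle)
    calc 10 ^ 13 * (M.psiEta ^ 4 * L ^ 2 * n ^ 2)
        = 10 ^ 13 * ((M.psiEta ^ 2) ^ 2 * L ^ 2 * n ^ 2 * 1) := by ring
      _ ≤ 10 ^ 13 * (Wc ^ 2 * L ^ 4 * n ^ 2 * r ^ 3) := by gcongr
  have G4 : 10 ^ 13 * (M.psiW covU * ψA ^ 2 * L * r) ≤ T * u ^ 2 * (phiU covU * M.phiR ^ 2) := by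
    have h1 : T * u ^ 2 * φ ^ 4 ≤ T * u ^ 2 * (phiU covU * M.phiR ^ 2) := by
      gcongr
      exact (pow_le_of_le_one hφ0.le hφ1 (by norm_num)).trans hφ'
    refine le_trans ?_ (F2.trans h1)
    calc 10 ^ 13 * (M.psiW covU * ψA ^ 2 * L * r)
        = 10 ^ 13 * (M.psiW covU * ψA ^ 2 * L * 1 * r) := by ring
      _ ≤ 10 ^ 13 * (Wc ^ 2 * L ^ 4 * n ^ 2 * r ^ 3) := by
        gcongr
        exact hW2.trans hW4
  have hT1 : (1 : ℝ) ≤ T := by linarith [mul_le_of_le_one_left hTnn hφ4]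
  have hT0 : 0 < T := by exact_mod_cast (by linarith : (0 : ℝ) < T)
  have hT2r : 2 * r ≤ T := by
    have h1 : 10 ^ 13 * (r : ℝ) ≤ T := by
      refine le_trans ?_ (F2.trans hTle)
      calc 10 ^ 13 * (r : ℝ) = 10 ^ 13 * (1 * 1 * 1 * r) := by ring
        _ ≤ 10 ^ 13 * (Wc ^ 2 * L ^ 4 * n ^ 2 * r ^ 3) := by
          gcongr
          exact hW3.trans hW4
    have : (2 * r : ℝ) ≤ T := by linarith
    exact_mod_cast this
  have G1 : 10 ^ 10 * (M.psiEta ^ 2 * L * n) ≤ φ ^ 2 * T := by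
    have h1 : M.kappa4 covU δ ^ 2 * φ ^ 2 = M.psiEta ^ 2 * L := by
      rw [hk4, mul_pow, Real.sq_sqrt (by linarith)]; field_simp
    have h2 := mul_le_mul_of_nonneg_left F1 (sq_nonneg φ)
    have h3 : φ ^ 2 * (10 ^ 13 * M.kappa4 covU δ ^ 2 * n) =
        10 ^ 13 * (M.psiEta ^ 2 * L * n) := by rw [← h1]; ring
    have h4 : 0 ≤ M.psiEta ^ 2 * L * n := by positivity
    linarith
  obtain ⟨h, b, e, hh0, hh, hb0, hb, he, hbh, heh, hgap, htail, hθ, hθ1⟩ :=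
    pca_level_estimates (x := 4 * r + 2 + 3 * L) (y := 4 * n + 2 + 3 * L) (by positivity)
      (by exact_mod_cast hrn.le) hn1 hψη hφ0 hφ1 hL (sq_nonneg ση) hση hT1 rfl rfl G1 G2 G3
  rw [← hk4] at hθ hθ1
  refine ⟨hT0, by linarith, ?_⟩
  have hrank : M.C.rank ≤ r := by simpa using M.C.rank_le_width
  have key := M.measure_pca_failure_le (ση := ση) (κ := M.psiEta) (p := δ / 6) hrC (by omega)
    hmin.1 hW hη hU hrU hM (by linarith) hση hT2r hT0 (by positivity) (by linarith)
    (x := 4 * r + 2 + 3 * L) (y := 4 * n + 2 + 3 * L) (by linarith) (by linarith) ?_ hh0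
    (by rw [hh, hφ]; ring) hb0 hb (by simpa using he) hbh heh hgap htail
  · refine le_trans (measure_mono ?_) (key.trans (le_of_eq ?_))
    · intro ω hω hgood
      refine hω ⟨hgood.1, fun Φ h1 h2 z hz => (hgood.2 Φ h1 h2 z hz).trans ?_⟩
      exact mul_le_mul_of_nonneg_right hθ (norm_nonneg _)
    · rw [← ENNReal.ofReal_add (by positivity) (by positivity),
        ← ENNReal.ofReal_add (by positivity) (by positivity)]
      congr 1; ring
  · have hρ' : 0 < 1 - ρA := by linarith
    have h1 : u ≤ 2 * (1 - ρA) := by linarith [sq_nonneg (1 - ρA)]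
    have h2 : u ^ 2 ≤ 4 * (1 - ρA) ^ 2 :=
      (pow_le_pow_left₀ hu0.le h1 2).trans_eq (by ring)
    have h3 : 4 * r + 2 + 3 * L ≤ 9 * (L * r) := by
      linarith [le_mul_of_one_le_left (zero_le_one.trans hr1) hL,
        le_mul_of_one_le_right (zero_le_one.trans hL) hr1]
    have h4 : 2025 * (M.psiW covU * (2 * ψA / (1 - ρA)) ^ 2) * (4 * r + 2 + 3 * L) ≤
        2025 * (M.psiW covU * (2 * ψA / (1 - ρA)) ^ 2) * (9 * (L * r)) := by gcongr
    refine h4.trans ?_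
    have h5 : 2025 * (M.psiW covU * (2 * ψA / (1 - ρA)) ^ 2) * (9 * (L * r)) =
        72900 * (M.psiW covU * ψA ^ 2 * L * r) / (1 - ρA) ^ 2 := by field_simp; ring
    rw [h5, div_le_iff₀ (by positivity)]
    have h6 : 0 ≤ M.psiW covU * ψA ^ 2 * L * r := by positivity
    have h7 : T * u ^ 2 * (phiU covU * M.phiR ^ 2) ≤
        T * (4 * (1 - ρA) ^ 2) * (phiU covU * M.phiR ^ 2) := by gcongr
    linarith

end LTISystem

/-! ### Compression of a system -/

theorem norm_toEuclideanLin_of_transpose_mul_self {n k : ℕ} {Φ : Matrix (Fin n) (Fin k) ℝ}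
    (hΦ : Φᵀ * Φ = 1) (x : Vec k) : ‖Φ.toEuclideanLin x‖ = ‖x‖ := by
  refine (sq_eq_sq₀ (norm_nonneg _) (norm_nonneg _)).1 ?_
  rw [← real_inner_self_eq_norm_sq, ← LinearMap.adjoint_inner_right, ← toEuclideanLin_transpose,
    ← toEuclideanLin_mul_apply, hΦ, ← real_inner_self_eq_norm_sq]
  simp

theorem norm_mul_le_of_transpose_mul_self {n k r : ℕ} {Φ : Matrix (Fin n) (Fin k) ℝ}
    (hΦ : Φᵀ * Φ = 1) (P : Matrix (Fin k) (Fin r) ℝ) : ‖Φ * P‖ ≤ ‖P‖ := by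
  rw [Matrix.l2_opNorm_def]
  refine ContinuousLinearMap.opNorm_le_bound _ (norm_nonneg _) fun x => ?_
  change ‖(Φ * P).toEuclideanLin x‖ ≤ _
  rw [toEuclideanLin_mul_apply, norm_toEuclideanLin_of_transpose_mul_self hΦ]
  exact norm_toEuclideanLin_le P x

/-- `Φ` has orthonormal columns, whose span contains the column space of `C` up to a relative
error `θ`. -/
def ApproximatesRange {n k r : ℕ} (C : Matrix (Fin n) (Fin r) ℝ) (θ : ℝ)
    (Φ : Matrix (Fin n) (Fin k) ℝ) : Prop :=
  Φᵀ * Φ = 1 ∧ ∀ x, ‖C.toEuclideanLin x - (Φ * Φᵀ).toEuclideanLin (C.toEuclideanLin x)‖ ≤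
    θ * ‖C.toEuclideanLin x‖

/-- The error committed by compressing with `Φ` is charged to the estimate `Φ * P` of `C * S`
itself, so that the size of `S` does not enter. -/
theorem ApproximatesRange.norm_sub_le {n k r : ℕ} {C : Matrix (Fin n) (Fin r) ℝ} {θ : ℝ}
    {Φ : Matrix (Fin n) (Fin k) ℝ} (h : ApproximatesRange C θ Φ) (hθ0 : 0 ≤ θ) (hθ : θ ≤ 1 / 2)
    (S : Matrix (Fin r) (Fin r) ℝ) (P : Matrix (Fin k) (Fin r) ℝ) :
    ‖C * S - Φ * P‖ ≤ 2 * θ * ‖Φ * P‖ + 2 * ‖Φᵀ * C * S - P‖ := by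
  have h1 : ‖C * S - Φ * (Φᵀ * C * S)‖ ≤ θ * ‖C * S‖ := by
    rw [Matrix.l2_opNorm_def]
    refine ContinuousLinearMap.opNorm_le_bound _ (by positivity) fun x => ?_
    change ‖(C * S - Φ * (Φᵀ * C * S)).toEuclideanLin x‖ ≤ _
    rw [map_sub, LinearMap.sub_apply, Matrix.mul_assoc, ← Matrix.mul_assoc Φ,
      toEuclideanLin_mul_apply (Φ * Φᵀ), toEuclideanLin_mul_apply C]
    refine (h.2 _).trans ?_
    rw [mul_assoc, ← toEuclideanLin_mul_apply]
    exact mul_le_mul_of_nonneg_left (norm_toEuclideanLin_le _ _) hθ0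
  have h2 : ‖Φ * (Φᵀ * C * S) - Φ * P‖ ≤ ‖Φᵀ * C * S - P‖ := by
    rw [← Matrix.mul_sub]
    exact norm_mul_le_of_transpose_mul_self h.1 _
  have h3 := norm_sub_le_norm_sub_add_norm_sub (C * S) (Φ * (Φᵀ * C * S)) (Φ * P)
  have h4 : ‖C * S‖ ≤ ‖C * S - Φ * P‖ + ‖Φ * P‖ := by
    simpa using norm_add_le (C * S - Φ * P) (Φ * P)
  have h5 : 0 ≤ ‖C * S - Φ * P‖ := norm_nonneg _
  have h6 : θ * ‖C * S‖ ≤ θ * ‖C * S - Φ * P‖ + θ * ‖Φ * P‖ := by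
    rw [← mul_add]; exact mul_le_mul_of_nonneg_left h4 hθ0
  have h7 : θ * ‖C * S - Φ * P‖ ≤ 1 / 2 * ‖C * S - Φ * P‖ := mul_le_mul_of_nonneg_right hθ h5
  linarith

theorem rank_eq_iff_injective {α : Type*} [Fintype α] [DecidableEq α] {r : ℕ}
    (P : Matrix α (Fin r) ℝ) : P.rank = r ↔ Function.Injective P.toEuclideanLin := by
  rw [rank_eq_finrank_range_toEuclideanLin]
  constructor
  · intro h
    have h1 := P.toEuclideanLin.finrank_range_add_finrank_ker
    rw [h, finrank_euclideanSpace_fin] at h1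
    exact LinearMap.ker_eq_bot.1 (Submodule.finrank_eq_zero.1 (by omega))
  · intro h
    rw [LinearMap.finrank_range_of_inj h, finrank_euclideanSpace_fin]

theorem charFun_map_toEuclideanLin {n k : ℕ} (μ : Measure (Vec n))
    (P : Matrix (Fin k) (Fin n) ℝ) (t : Vec k) :
    charFun (μ.map P.toEuclideanLin) t = charFun μ (Pᵀ.toEuclideanLin t) := by
  have hP : Measurable P.toEuclideanLin :=
    P.toEuclideanLin.continuous_of_finiteDimensional.measurable
  rw [charFun_apply, charFun_apply, integral_map hP.aemeasurable (by fun_prop)]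
  simp_rw [toEuclideanLin_transpose, LinearMap.adjoint_inner_right]

theorem measurePreserving_multivariateGaussian {n k : ℕ} {S : Matrix (Fin n) (Fin n) ℝ}
    (hS : S.PosSemidef) (P : Matrix (Fin n) (Fin k) ℝ) :
    MeasurePreserving Pᵀ.toEuclideanLin (multivariateGaussian 0 S)
      (multivariateGaussian 0 (Pᵀ * S * P)) := by
  have hP : Measurable Pᵀ.toEuclideanLin :=
    Pᵀ.toEuclideanLin.continuous_of_finiteDimensional.measurable
  have hS' : (Pᵀ * S * P).PosSemidef := by
    have := hS.conjTranspose_mul_mul_same P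
    rwa [Matrix.conjTranspose_eq_transpose_of_trivial] at this
  refine ⟨hP, ?_⟩
  have := Measure.isProbabilityMeasure_map (μ := multivariateGaussian (0 : Vec n) S)
    hP.aemeasurable
  refine Measure.ext_of_charFun ?_
  ext t
  rw [charFun_map_toEuclideanLin, charFun_multivariateGaussian hS,
    charFun_multivariateGaussian hS']
  simp only [inner_zero_right, Matrix.transpose_transpose, Matrix.toLpLin_apply,
    ← Matrix.mulVec_mulVec, Matrix.dotProduct_mulVec, Matrix.vecMul_transpose]

theorem measurable_projectData {n m k T : ℕ} (Φ : Matrix (Fin n) (Fin k) ℝ) :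
    Measurable (projectData Φ : Data n m T → Data k m T) := by
  have h2 : Continuous Φᵀ.toEuclideanLin := Φᵀ.toEuclideanLin.continuous_of_finiteDimensional
  have h3 : Continuous (projectData Φ : Data n m T → Data k m T) := by
    refine Continuous.prodMk (continuous_pi fun t => ?_) continuous_snd
    exact h2.comp ((continuous_apply t).comp continuous_fst)
  exact h3.measurable

namespace LTISystem

variable {r n m k : ℕ} (M : LTISystem r n m)

/-- Since `Φᵀ` is injective on the range of `C`, a state that is unobservable through `Φᵀ C` is
unobservable through `C`. -/
theorem isMinimal_compress (hM : M.IsMinimal) {θ : ℝ} (hθ : θ < 1) {Φ : Matrix (Fin n) (Fin k) ℝ}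
    (h : ApproximatesRange M.C θ Φ) : (M.compress Φ).IsMinimal := by
  refine ⟨hM.1, (rank_eq_iff_injective _).2 ((injective_iff_map_eq_zero _).2 fun x hx => ?_)⟩
  refine (injective_iff_map_eq_zero _).1 ((rank_eq_iff_injective _).1 hM.2) x ?_
  have h1 : ∀ i : Fin r, Φᵀ.toEuclideanLin (M.C.toEuclideanLin
      ((M.A ^ (i : ℕ)).toEuclideanLin x)) = 0 := by
    intro i
    rw [← toEuclideanLin_mul_apply, ← toEuclideanLin_mul_apply]
    ext j
    exact congrFun (congrArg WithLp.ofLp hx) (i, j)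
  have h2 : ∀ i : Fin r, M.C.toEuclideanLin ((M.A ^ (i : ℕ)).toEuclideanLin x) = 0 := by
    intro i
    have h3 := h.2 ((M.A ^ (i : ℕ)).toEuclideanLin x)
    rw [toEuclideanLin_mul_apply, h1, map_zero, sub_zero] at h3
    have h4 : ‖M.C.toEuclideanLin ((M.A ^ (i : ℕ)).toEuclideanLin x)‖ ≤ 0 := by
      nlinarith [norm_nonneg (M.C.toEuclideanLin ((M.A ^ (i : ℕ)).toEuclideanLin x))]
    exact norm_le_zero_iff.1 h4
  ext ⟨i, j⟩
  have h3 := congrArg (fun v : Vec n => v j) (h2 i)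
  rw [← toEuclideanLin_mul_apply] at h3
  exact h3

theorem state_compress (Φ : Matrix (Fin n) (Fin k) ℝ) {T : ℕ} (u : Fin T → Vec m)
    (w : Fin T → Vec r) (t : ℕ) : (M.compress Φ).state u w t = M.state u w t := by
  induction t with
  | zero => rfl
  | succ t ih => rw [state, state, ih]; rfl

theorem measurable_trajectory (T : ℕ) : Measurable (M.trajectory T) := by
  have h1 : Continuous fun ω : Noise r n m T => M.stateCLM T (ω.1, ω.2.1) :=
    (M.stateCLM T).continuous.comp (by fun_prop)
  have h2 : Continuous M.C.toEuclideanLin := M.C.toEuclideanLin.continuous_of_finiteDimensional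
  have h3 : Continuous (M.trajectory T) := by
    refine Continuous.prodMk (continuous_pi fun t => ?_) continuous_fst
    refine (h2.comp ((continuous_apply t).comp h1)).add ?_
    exact (continuous_apply t).comp (continuous_snd.comp continuous_snd)
  exact h3.measurable

instance isProbabilityMeasure_noiseLaw (covU : Matrix (Fin m) (Fin m) ℝ) (T : ℕ) :
    IsProbabilityMeasure (M.noiseLaw covU T) := by
  unfold noiseLaw; infer_instance

instance isProbabilityMeasure_dataLaw (covU : Matrix (Fin m) (Fin m) ℝ) (T : ℕ) :
    IsProbabilityMeasure (M.dataLaw covU T) :=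
  Measure.isProbabilityMeasure_map (M.measurable_trajectory T).aemeasurable

/-- Projected data are data of the compressed system. -/
theorem dataLaw_compress (hη : M.covEta.PosSemidef) (covU : Matrix (Fin m) (Fin m) ℝ) (T : ℕ)
    (Φ : Matrix (Fin n) (Fin k) ℝ) :
    (M.compress Φ).dataLaw covU T = (M.dataLaw covU T).map (projectData Φ) := by
  have h1 : MeasurePreserving (Prod.map (id : (Fin T → Vec m) → _) (Prod.map
      (id : (Fin T → Vec r) → _) fun (ξ : Fin (T + 1) → Vec n) t => Φᵀ.toEuclideanLin (ξ t)))
      (M.noiseLaw covU T) ((M.compress Φ).noiseLaw covU T) :=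
    (MeasurePreserving.id _).prod ((MeasurePreserving.id _).prod
      (measurePreserving_pi _ _ fun _ => measurePreserving_multivariateGaussian hη Φ))
  rw [dataLaw, dataLaw, ← h1.map_eq,
    Measure.map_map ((M.compress Φ).measurable_trajectory T) h1.measurable,
    Measure.map_map (measurable_projectData Φ) (M.measurable_trajectory T)]
  congr 1
  funext ω
  refine Prod.ext (funext fun t => ?_) rfl
  simp only [Function.comp_apply, trajectory, projectData, state_compress, Prod.map, id, map_add]
  rw [← toEuclideanLin_mul_apply]
  rfl

theorem covEta_posSemidef_of_eq {σ : ℝ} (h : M.covEta = σ ^ 2 • (1 : Matrix (Fin n) (Fin n) ℝ)) :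
    M.covEta.PosSemidef := by
  rw [h]; exact Matrix.PosSemidef.one.smul (sq_nonneg σ)

theorem compress_eq {σ : ℝ} (h : M.covEta = σ ^ 2 • (1 : Matrix (Fin n) (Fin n) ℝ))
    {Φ : Matrix (Fin n) (Fin k) ℝ} (hΦ : Φᵀ * Φ = 1) :
    M.compress Φ = ⟨M.A, M.B, Φᵀ * M.C, M.covW, σ ^ 2 • (1 : Matrix (Fin k) (Fin k) ℝ)⟩ := by
  simp [compress, h, hΦ]

/-- The guarantee of an oracle, transported to the projected data of the original system. -/
theorem measure_oracle_failure_le {est : Estimator} {κ₁ κ₂ : ProblemConst}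
    {p₁ p₂ : MvPolynomial (Fin 3) ℕ} (horacle : IsSysIdOracle est κ₁ κ₂ p₁ p₂)
    {covU : Matrix (Fin m) (Fin m) ℝ} {T : ℕ} {ψA ρA δ θ : ℝ} (hr : 0 < r) (hM : M.IsMinimal)
    (hW : M.covW.PosSemidef) (hη : M.covEta.PosSemidef) (hU : covU.PosDef)
    (hs : M.IsStableWith ψA ρA) (hδ0 : 0 < δ) (hδ1 : δ < 1) (hT : 1 ≤ T) (hθ : θ < 1)
    {Φ : Matrix (Fin n) (Fin k) ℝ} (hΦ : ApproximatesRange M.C θ Φ) :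
    M.dataLaw covU T {D | κ₁ (M.compress Φ) covU T ψA ρA δ *
        (MvPolynomial.eval ![r, k, m] p₁ : ℕ) ≤ T ∧
      ¬ Recovers (M.compress Φ) (est δ k m T (projectData Φ D))
        ((MvPolynomial.eval ![r, k, m] p₂ : ℕ) / √T * κ₂ (M.compress Φ) covU T ψA ρA δ)} ≤
      ENNReal.ofReal δ := by
  by_cases hκ : κ₁ (M.compress Φ) covU T ψA ρA δ * (MvPolynomial.eval ![r, k, m] p₁ : ℕ) ≤ T
  · have hη' : (M.compress Φ).covEta.PosSemidef := by
      have := hη.conjTranspose_mul_mul_same Φ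
      rwa [Matrix.conjTranspose_eq_transpose_of_trivial] at this
    have h1 := horacle.guarantee (M.compress Φ) covU T ψA ρA δ hr (M.isMinimal_compress hM hθ hΦ)
      hW hη' hU hs hδ0 hδ1 hT hκ
    rw [M.dataLaw_compress hη] at h1
    refine le_trans (measure_mono ?_)
      ((Measure.le_map_apply (measurable_projectData Φ).aemeasurable _).trans h1)
    exact fun D hD => hD.2
  · simp [hκ]

end LTISystem

/-! ### Measurability -/

section Measurability

instance borelSpace_matrix {α β : Type*} [Fintype α] [Fintype β] [DecidableEq β] :
    BorelSpace (Matrix α β ℝ) :=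
  inferInstanceAs (BorelSpace (α → β → ℝ))

instance secondCountable_matrix {α β : Type*} [Fintype α] [Fintype β] [DecidableEq β] :
    SecondCountableTopology (Matrix α β ℝ) :=
  inferInstanceAs (SecondCountableTopology (α → β → ℝ))

theorem continuous_toEuclideanLin_apply {α β : Type*} [Fintype α] [Fintype β] [DecidableEq β] :
    Continuous fun p : Matrix α β ℝ × EuclideanSpace ℝ β => p.1.toEuclideanLin p.2 := by
  simp_rw [Matrix.toLpLin_apply]
  exact (PiLp.continuous_toLp 2 _).comp
    (continuous_fst.matrix_mulVec ((PiLp.continuous_ofLp 2 _).comp continuous_snd))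

theorem measurableSet_sigma_iff {ι : Type*} {β : ι → Type*} [∀ i, MeasurableSpace (β i)]
    {s : Set (Σ i, β i)} : MeasurableSet s ↔ ∀ i, MeasurableSet (Sigma.mk i ⁻¹' s) :=
  MeasurableSpace.measurableSet_iInf

/-- The component of an element of a disjoint union at the index `i`, with the value `0` if the
element lies at another index. -/
noncomputable def fiberAt {β : ℕ → Type*} [∀ i, Zero (β i)] (i : ℕ) (x : Σ j, β j) : β i :=
  if h : x.1 = i then h ▸ x.2 else 0

@[simp]
theorem fiberAt_mk {β : ℕ → Type*} [∀ i, Zero (β i)] (i : ℕ) (x : β i) :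
    fiberAt i ⟨i, x⟩ = x := by simp [fiberAt]

theorem measurable_fiberAt {β : ℕ → Type*} [∀ i, Zero (β i)] [∀ i, MeasurableSpace (β i)]
    (i : ℕ) : Measurable (fiberAt (β := β) i) := by
  intro s hs
  refine measurableSet_sigma_iff.2 fun j => ?_
  by_cases h : j = i
  · subst h
    have : Sigma.mk j ⁻¹' (fiberAt (β := β) j ⁻¹' s) = s := by ext x; simp
    rwa [this]
  · have : Sigma.mk j ⁻¹' (fiberAt (β := β) i ⁻¹' s) = {_x | (0 : β i) ∈ s} := by
      ext x; simp [fiberAt, h]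
    rw [this]
    exact MeasurableSet.const _

theorem measurableSet_index_eq {β : ℕ → Type*} [∀ i, MeasurableSpace (β i)] (i : ℕ) :
    MeasurableSet {x : Σ j, β j | x.1 = i} :=
  measurableSet_sigma_iff.2 fun j => MeasurableSet.const (j = i)

theorem measurableSet_approximatesRange {n k r : ℕ} (C : Matrix (Fin n) (Fin r) ℝ) (θ : ℝ) :
    MeasurableSet {Φ : Matrix (Fin n) (Fin k) ℝ | ApproximatesRange C θ Φ} := by
  have h1 : Continuous fun Φ : Matrix (Fin n) (Fin k) ℝ => Φᵀ * Φ :=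
    continuous_id.matrix_transpose.matrix_mul continuous_id
  have h2 : Continuous fun Φ : Matrix (Fin n) (Fin k) ℝ => Φ * Φᵀ :=
    continuous_id.matrix_mul continuous_id.matrix_transpose
  refine IsClosed.measurableSet ?_
  refine (isClosed_eq h1 continuous_const).inter ?_
  change IsClosed {Φ : Matrix (Fin n) (Fin k) ℝ | ∀ x, ‖C.toEuclideanLin x -
    (Φ * Φᵀ).toEuclideanLin (C.toEuclideanLin x)‖ ≤ θ * ‖C.toEuclideanLin x‖}
  rw [Set.ofPred_forall]
  refine isClosed_iInter fun x => isClosed_le ?_ continuous_const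
  exact (continuous_const.sub
    (continuous_toEuclideanLin_apply.comp (h2.prodMk continuous_const))).norm

/-- A candidate estimate, an observer matrix and an error level. -/
abbrev RecoveryQuery (r n m : ℕ) : Type :=
  (Matrix (Fin r) (Fin r) ℝ × Matrix (Fin r) (Fin m) ℝ × Matrix (Fin n) (Fin r) ℝ) ×
    Matrix (Fin n) (Fin r) ℝ × ℝ

/-- Whether an estimate is within a given error of a system, up to similarity, is a measurable
property of the estimate, the observer and the error: for similarity transformations of bounded
norm (with bounded inverse) it is closed, as the projection of a closed set along a compact one. -/
theorem measurableSet_recoveryError_le {r n m : ℕ} (A : Matrix (Fin r) (Fin r) ℝ)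
    (B : Matrix (Fin r) (Fin m) ℝ) (W : Matrix (Fin r) (Fin r) ℝ) (N : Matrix (Fin n) (Fin n) ℝ) :
    MeasurableSet {x : RecoveryQuery r n m | ∃ S : Matrix (Fin r) (Fin r) ℝ, IsUnit S ∧
        LTISystem.recoveryError ⟨A, B, x.2.1, W, N⟩ S x.1.1 x.1.2.1 x.1.2.2 ≤ x.2.2} := by
  let K : ℕ → Set (Matrix (Fin r) (Fin r) ℝ × Matrix (Fin r) (Fin r) ℝ) := fun j =>
    Metric.closedBall 0 j ×ˢ Metric.closedBall 0 j
  have hK : ∀ j, CompactSpace (K j) := fun j => isCompact_iff_compactSpace.1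
    ((isCompact_closedBall _ _).prod (isCompact_closedBall _ _))
  let Z : ∀ j, Set (RecoveryQuery r n m × K j) := fun j => {z | z.2.1.1 * z.2.1.2 = 1 ∧
    max ‖z.2.1.2 * A * z.2.1.1 - z.1.1.1‖ (max ‖z.2.1.2 * B - z.1.1.2.1‖
      ‖z.1.2.1 * z.2.1.1 - z.1.1.2.2‖) ≤ z.1.2.2}
  have hZ : ∀ j, IsClosed (Z j) := by
    intro j
    have c1 : Continuous fun z : RecoveryQuery r n m × K j => z.2.1.1 := by fun_prop
    have c2 : Continuous fun z : RecoveryQuery r n m × K j => z.2.1.2 := by fun_prop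
    have c3 : Continuous fun z : RecoveryQuery r n m × K j => z.1.1.1 := by fun_prop
    have c4 : Continuous fun z : RecoveryQuery r n m × K j => z.1.1.2.1 := by fun_prop
    have c5 : Continuous fun z : RecoveryQuery r n m × K j => z.1.1.2.2 := by fun_prop
    have c6 : Continuous fun z : RecoveryQuery r n m × K j => z.1.2.1 := by fun_prop
    have c7 : Continuous fun z : RecoveryQuery r n m × K j => z.1.2.2 := by fun_prop
    refine (isClosed_eq (c1.matrix_mul c2) continuous_const).inter (isClosed_le ?_ c7)
    exact (((c2.matrix_mul continuous_const).matrix_mul c1).sub c3).norm.max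
      (((c2.matrix_mul continuous_const).sub c4).norm.max ((c6.matrix_mul c1).sub c5).norm)
  have hset : {x : RecoveryQuery r n m | ∃ S : Matrix (Fin r) (Fin r) ℝ, IsUnit S ∧
        LTISystem.recoveryError ⟨A, B, x.2.1, W, N⟩ S x.1.1 x.1.2.1 x.1.2.2 ≤ x.2.2} =
      ⋃ j, Prod.fst '' Z j := by
    ext x
    simp only [Set.mem_ofPred_eq, Set.mem_iUnion, Set.mem_image]
    constructor
    · rintro ⟨S, hS, hx⟩
      obtain ⟨j, hj⟩ := exists_nat_ge (max ‖S‖ ‖S⁻¹‖)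
      refine ⟨j, (x, ⟨(S, S⁻¹), ?_⟩), ⟨?_, hx⟩, rfl⟩
      · exact ⟨mem_closedBall_zero_iff.2 ((le_max_left _ _).trans hj),
          mem_closedBall_zero_iff.2 ((le_max_right _ _).trans hj)⟩
      · exact Matrix.mul_nonsing_inv _ ((Matrix.isUnit_iff_isUnit_det S).1 hS)
    · rintro ⟨j, ⟨y, ⟨⟨S, S'⟩, _⟩⟩, ⟨h1, h2⟩, rfl⟩
      refine ⟨S, IsUnit.of_mul_eq_one _ h1, ?_⟩
      rw [LTISystem.recoveryError, Matrix.inv_eq_right_inv h1]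
      exact h2
  rw [hset]
  exact MeasurableSet.iUnion fun j =>
    ((isClosedMap_fst_of_compactSpace (Y := K j)) _ (hZ j)).measurableSet

theorem recovers_iff {r n m : ℕ} (M : LTISystem r n m) (E : Estimate n m) (ε : ℝ) :
    Recovers M E ε ↔ E.1 = r ∧ ∃ S : Matrix (Fin r) (Fin r) ℝ, IsUnit S ∧
      M.recoveryError S (fiberAt r E).1 (fiberAt r E).2.1 (fiberAt r E).2.2 ≤ ε := by
  constructor
  · rintro ⟨Ah, Bh, Ch, rfl, h⟩
    exact ⟨rfl, by simpa using h⟩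
  · obtain ⟨k, Ah, Bh, Ch⟩ := E
    rintro ⟨h1, h2⟩
    change k = r at h1
    subst h1
    exact ⟨Ah, Bh, Ch, rfl, by simpa using h2⟩

theorem measurable_projectData_prod {n m k T : ℕ} :
    Measurable fun p : Matrix (Fin n) (Fin k) ℝ × Data n m T => projectData p.1 p.2 := by
  refine Continuous.measurable ?_
  refine Continuous.prodMk (continuous_pi fun t => ?_) (by fun_prop)
  refine continuous_toEuclideanLin_apply.comp
    (Continuous.prodMk (continuous_fst.matrix_transpose) ?_)
  fun_prop

theorem measurableSet_oracle_failure {est : Estimator} {κ₁ κ₂ : ProblemConst}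
    {p₁ p₂ : MvPolynomial (Fin 3) ℕ} (horacle : IsSysIdOracle est κ₁ κ₂ p₁ p₂) {r n m k T : ℕ}
    (M : LTISystem r n m) (N : Matrix (Fin k) (Fin k) ℝ) (covU : Matrix (Fin m) (Fin m) ℝ)
    (ψA ρA δ a b : ℝ) :
    MeasurableSet {p : Matrix (Fin n) (Fin k) ℝ × Data n m T |
      κ₁ ⟨M.A, M.B, p.1ᵀ * M.C, M.covW, N⟩ covU T ψA ρA δ * a ≤ T ∧
      ¬ Recovers ⟨M.A, M.B, p.1ᵀ * M.C, M.covW, N⟩ (est δ k m T (projectData p.1 p.2))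
        (b * κ₂ ⟨M.A, M.B, p.1ᵀ * M.C, M.covW, N⟩ covU T ψA ρA δ)} := by
  have hC : Measurable fun p : Matrix (Fin n) (Fin k) ℝ × Data n m T => p.1ᵀ * M.C :=
    (continuous_fst.matrix_transpose.matrix_mul continuous_const).measurable
  let M' : LTISystem r k m := ⟨M.A, M.B, 0, M.covW, N⟩
  have h1 : Measurable fun p : Matrix (Fin n) (Fin k) ℝ × Data n m T =>
      κ₁ ⟨M.A, M.B, p.1ᵀ * M.C, M.covW, N⟩ covU T ψA ρA δ :=
    (horacle.measurable₁ M' covU T ψA ρA δ).comp hC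
  have h2 : Measurable fun p : Matrix (Fin n) (Fin k) ℝ × Data n m T =>
      κ₂ ⟨M.A, M.B, p.1ᵀ * M.C, M.covW, N⟩ covU T ψA ρA δ :=
    (horacle.measurable₂ M' covU T ψA ρA δ).comp hC
  have h3 : Measurable fun p : Matrix (Fin n) (Fin k) ℝ × Data n m T =>
      est δ k m T (projectData p.1 p.2) :=
    (horacle.measurable_est δ k m T).comp measurable_projectData_prod
  suffices h4 : MeasurableSet {p : Matrix (Fin n) (Fin k) ℝ × Data n m T |
      Recovers ⟨M.A, M.B, p.1ᵀ * M.C, M.covW, N⟩ (est δ k m T (projectData p.1 p.2))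
        (b * κ₂ ⟨M.A, M.B, p.1ᵀ * M.C, M.covW, N⟩ covU T ψA ρA δ)} from
    (measurableSet_le (h1.mul_const a) measurable_const).inter h4.compl
  simp_rw [recovers_iff]
  refine (h3 (measurableSet_index_eq r)).inter ?_
  exact (((measurable_fiberAt r).comp h3).prodMk (hC.prodMk (h2.const_mul b)))
    (measurableSet_recoveryError_le M.A M.B M.covW N)

end Measurability

/-! ### The two-stage algorithm -/

theorem eval_mono_nat {σ : Type*} [Fintype σ] (p : MvPolynomial σ ℕ) {x y : σ → ℕ} (h : x ≤ y) :
    MvPolynomial.eval x p ≤ MvPolynomial.eval y p := by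
  rw [MvPolynomial.eval_eq', MvPolynomial.eval_eq']
  exact Finset.sum_le_sum fun d _ => Nat.mul_le_mul_left _
    (Finset.prod_le_prod' fun i _ => Nat.pow_le_pow_left (h i) _)

theorem eval_rename_diagonal (p : MvPolynomial (Fin 3) ℕ) (r m : ℕ) :
    MvPolynomial.eval ![r, m] (MvPolynomial.rename ![0, 0, 1] p) =
      MvPolynomial.eval ![r, r, m] p := by
  rw [MvPolynomial.eval_rename]
  congr 1
  congr 1
  funext i
  fin_cases i <;> rfl

/-- A bound of order `T ^ (-1/2)`, solved for the sample size `T`. -/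
theorem mul_sqrt_div_le_half {c y N T ε : ℝ} (hN : 0 ≤ N) (hT : 0 < T)
    (hε : 0 < ε) (h : 4 * c ^ 2 * y ^ 2 * N / ε ^ 2 ≤ T) : c * (y * √(N / T)) ≤ ε / 2 := by
  refine le_of_sq_le_sq ?_ (by positivity)
  rw [mul_pow, mul_pow, Real.sq_sqrt (by positivity)]
  rw [div_le_iff₀ (by positivity)] at h
  rw [← mul_assoc, mul_div_assoc', div_le_iff₀ hT]
  linarith

section Lift

variable {r n m k : ℕ} (M : LTISystem r n m)

theorem exists_liftEstimate {θ η : ℝ} (hθ0 : 0 ≤ θ) (hθ : θ ≤ 1 / 2)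
    {Φ : Matrix (Fin n) (Fin k) ℝ} (hΦ : ApproximatesRange M.C θ Φ) {E : Estimate k m}
    (hE : Recovers (M.compress Φ) E η) :
    ∃ Ah Bh Ch, liftEstimate Φ E = ⟨r, Ah, Bh, Ch⟩ ∧
      ∃ S : Matrix (Fin r) (Fin r) ℝ, IsUnit S ∧
        M.recoveryError S Ah Bh Ch ≤ 2 * θ * ‖Ch‖ + 2 * η := by
  obtain ⟨Ah, Bh, Ct, rfl, S, hS, herr⟩ := hE
  refine ⟨Ah, Bh, Φ * Ct, rfl, S, hS, ?_⟩
  simp only [LTISystem.recoveryError, LTISystem.compress, max_le_iff] at herr ⊢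
  obtain ⟨h1, h2, h3⟩ := herr
  have h4 : 0 ≤ η := (norm_nonneg _).trans h1
  have h5 : 0 ≤ 2 * θ * ‖Φ * Ct‖ := by positivity
  refine ⟨by linarith, by linarith, ?_⟩
  have := hΦ.norm_sub_le hθ0 hθ S Ct
  linarith

theorem approximatesRange_fiberAt {T s : ℕ}
    {Φ : (Fin (T + 1) → Vec n) → SubspaceBasis n} (hΦ : IsColApprox Φ) {θ : ℝ}
    {Y : Fin (T + 1) → Vec n} (hs : rankEst Y = s)
    (h : ∀ F : Matrix (Fin n) (Fin s) ℝ, Fᵀ * F = 1 →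
      (sampleCov Y * F = F * Matrix.diagonal fun i : Fin s => sv (sampleCov Y) i) →
      ∀ z ∈ LinearMap.range M.C.toEuclideanLin, ‖z - (F * Fᵀ).toEuclideanLin z‖ ≤ θ * ‖z‖) :
    (Φ Y).1 = s ∧ ApproximatesRange M.C θ (fiberAt s (Φ Y)) := by
  have h1 := hΦ.rank_eq Y
  have h2 := hΦ.orthonormal Y
  have h3 := hΦ.eigenvectors Y
  generalize Φ Y = Ψ at h1 h2 h3 ⊢
  obtain ⟨k, F⟩ := Ψ
  obtain rfl : k = s := h1.trans hs
  exact ⟨rfl, by simpa using ⟨h2, fun x => h F h2 h3 _ ⟨x, rfl⟩⟩⟩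

end Lift

namespace LTISystem

variable {r n m : ℕ} (M : LTISystem r n m)

theorem kappa4_nonneg (covU : Matrix (Fin m) (Fin m) ℝ) (δ : ℝ) : 0 ≤ M.kappa4 covU δ := by
  have h1 : 0 ≤ M.psiEta := zero_le_one.trans (le_max_left _ _)
  have h2 : 0 ≤ phiU covU := le_min zero_le_one (LinearMap.singularValues_nonneg _ _)
  unfold kappa4
  positivity

/-- The failure probability of the two-stage algorithm, with explicit constants: `δ / 2` for PCA
plus, by Fubini and conditionally on its success, `δ / 2` for the oracle. -/
theorem measure_colSysId_failure_le {p₁ p₂ : MvPolynomial (Fin 3) ℕ} {est : Estimator}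
    {κ₁ κ₂ : ProblemConst} (horacle : IsSysIdOracle est κ₁ κ₂ p₁ p₂)
    {covU : Matrix (Fin m) (Fin m) ℝ} {ση ψA ρA δ ℓ : ℝ} {T₁ T₂ : ℕ}
    {Φ : (Fin (T₁ + 1) → Vec n) → SubspaceBasis n}
    (hr : 0 < r) (hrn : r < n) (hmin : M.IsMinimal) (hW : M.covW.PosSemidef)
    (hη : M.covEta = ση ^ 2 • (1 : Matrix (Fin n) (Fin n) ℝ)) (hU : covU.PosDef)
    (hM : M.IsStableWith ψA ρA) (hδ : 0 < δ) (hL : 1 ≤ Real.log (1 / δ)) (hℓ0 : 0 < ℓ)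
    (hℓ : ℓ ≤ Real.log (Real.log (1 / δ))) (hΦ : IsColApprox Φ)
    (hT₁ : 10 ^ 13 * (1 + 1 / ℓ ^ 2) * M.kappa3 covU ψA ρA δ * n ^ 2 * r ^ 3 ≤ T₁)
    (hT₂ : 1 ≤ T₂) :
    0 < T₁ ∧ ((M.dataLaw covU T₁).prod (M.dataLaw covU T₂))
      {D | κ₁ (M.compress (Φ D.1.1).2) covU T₂ ψA ρA (δ / 2) *
            (MvPolynomial.eval ![r, r, m] p₁ : ℕ) ≤ T₂ ∧
          ¬ ∃ Ah Bh Ch, colSysId Φ est (δ / 2) D.1 D.2 = ⟨r, Ah, Bh, Ch⟩ ∧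
            ∃ S : Matrix (Fin r) (Fin r) ℝ, IsUnit S ∧
              M.recoveryError S Ah Bh Ch ≤
                12200 * (M.kappa4 covU δ * √(n / T₁) * ‖Ch‖ +
                  κ₂ (M.compress (Φ D.1.1).2) covU T₂ ψA ρA (δ / 2) *
                    ((MvPolynomial.eval ![r, r, m] p₂ : ℕ) / √T₂))}
      ≤ ENNReal.ofReal δ := by
  obtain ⟨hT₁0, hθ, hpca⟩ := M.measure_pca_failure_le_of_kappa3 hr hrn hmin hW hη hU hM hδ hL hℓ0
    hℓ hT₁
  refine ⟨hT₁0, ?_⟩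
  set θ := 6100 * (M.kappa4 covU δ * √(n / T₁)) with hθdef
  have hθ0 : 0 ≤ θ := by have := M.kappa4_nonneg covU δ; positivity
  have hδ1 : δ / 2 < 1 := by
    by_contra hcon
    have : Real.log (1 / δ) ≤ 0 := Real.log_nonpos (by positivity)
      (by rw [div_le_one hδ]; linarith)
    linarith
  set s := M.C.rank
  have hsr : s ≤ r := by simpa using M.C.rank_le_width
  have heval : ∀ p : MvPolynomial (Fin 3) ℕ, ((MvPolynomial.eval ![r, s, m] p : ℕ) : ℝ) ≤
      (MvPolynomial.eval ![r, r, m] p : ℕ) := fun p => by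
    refine Nat.cast_le.2 (eval_mono_nat p fun i => ?_)
    fin_cases i
    · exact le_rfl
    · exact hsr
    · exact le_rfl
  -- the bases for which the compressed system is identifiable, and the oracle's failures there
  let G : Set (SubspaceBasis n) := {Ψ | Ψ.1 = s ∧ ApproximatesRange M.C θ (fiberAt s Ψ)}
  have hG' : MeasurableSet {Ψ : SubspaceBasis n | ApproximatesRange M.C θ (fiberAt s Ψ)} :=
    measurable_fiberAt (β := fun k => Matrix (Fin n) (Fin k) ℝ) s
      (measurableSet_approximatesRange M.C θ)
  have hG : MeasurableSet G := (measurableSet_index_eq s).inter hG'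
  let B : Set (Matrix (Fin n) (Fin s) ℝ × Data n m T₂) := {p |
      κ₁ ⟨M.A, M.B, p.1ᵀ * M.C, M.covW, ση ^ 2 • (1 : Matrix (Fin s) (Fin s) ℝ)⟩ covU T₂ ψA ρA
        (δ / 2) * (MvPolynomial.eval ![r, s, m] p₁ : ℕ) ≤ T₂ ∧
      ¬ Recovers ⟨M.A, M.B, p.1ᵀ * M.C, M.covW, ση ^ 2 • (1 : Matrix (Fin s) (Fin s) ℝ)⟩
        (est (δ / 2) s m T₂ (projectData p.1 p.2))
        ((MvPolynomial.eval ![r, s, m] p₂ : ℕ) / √T₂ *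
          κ₂ ⟨M.A, M.B, p.1ᵀ * M.C, M.covW, ση ^ 2 • (1 : Matrix (Fin s) (Fin s) ℝ)⟩
            covU T₂ ψA ρA (δ / 2))}
  have hB : MeasurableSet B := measurableSet_oracle_failure horacle M _ covU ψA ρA (δ / 2) _ _
  have hΦm : Measurable fun D : Data n m T₁ => Φ D.1 := hΦ.measurable.comp measurable_fst
  let S₁ : Set (Data n m T₁) := {D | Φ D.1 ∈ G}
  have hS₁ : MeasurableSet S₁ := hΦm hG
  let S₂ : Set (Data n m T₁ × Data n m T₂) :=
    {D | Φ D.1.1 ∈ G ∧ (fiberAt s (Φ D.1.1), D.2) ∈ B}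
  have hS₂ : MeasurableSet S₂ := (measurable_fst hS₁).inter
    ((((measurable_fiberAt s).comp (hΦm.comp measurable_fst)).prodMk measurable_snd) hB)
  have h1 : ((M.dataLaw covU T₁).prod (M.dataLaw covU T₂)) (S₁ᶜ ×ˢ Set.univ) ≤
      ENNReal.ofReal (δ / 2) := by
    rw [Measure.prod_prod, measure_univ, mul_one, dataLaw,
      Measure.map_apply (M.measurable_trajectory T₁) hS₁.compl]
    refine (measure_mono ?_).trans hpca
    intro ω hω hgood
    exact hω (approximatesRange_fiberAt M hΦ hgood.1 hgood.2)
  have h2 : ((M.dataLaw covU T₁).prod (M.dataLaw covU T₂)) S₂ ≤ ENNReal.ofReal (δ / 2) := by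
    rw [Measure.prod_apply hS₂]
    refine (lintegral_mono (g := fun _ => ENNReal.ofReal (δ / 2)) fun D₁ => ?_).trans (by simp)
    by_cases hD : Φ D₁.1 ∈ G
    · refine (measure_mono ?_).trans (M.measure_oracle_failure_le horacle (δ := δ / 2) (θ := θ) hr
        hmin hW (M.covEta_posSemidef_of_eq hη) hU hM (by positivity) hδ1 hT₂ (by linarith) hD.2)
      intro D₂ hD₂
      rw [M.compress_eq hη hD.2.1]
      exact hD₂.2
    · refine (measure_mono (t := ∅) fun D₂ hD₂ => hD hD₂.1).trans (by simp)
  refine (measure_mono (t := S₁ᶜ ×ˢ Set.univ ∪ S₂) ?_).trans ((measure_union_le _ _).trans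
    ((add_le_add h1 h2).trans (le_of_eq ?_)))
  · rintro ⟨D₁, D₂⟩ ⟨hκ, hfail⟩
    by_contra hgood
    apply hfail
    have hG' : Φ D₁.1 ∈ G := by
      by_contra hcon
      exact hgood (Or.inl ⟨hcon, trivial⟩)
    have hB' : (fiberAt s (Φ D₁.1), D₂) ∉ B := fun hcon => hgood (Or.inr ⟨hG', hcon⟩)
    unfold colSysId
    simp only at hκ ⊢
    generalize Φ D₁.1 = Ψ at hG' hB' hκ ⊢
    obtain ⟨k, F⟩ := Ψ
    obtain ⟨hk, hF⟩ := hG'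
    change k = s at hk
    subst hk
    rw [fiberAt_mk] at hF hB'
    have hrec : Recovers (M.compress F) (est (δ / 2) _ m T₂ (projectData F D₂))
        ((MvPolynomial.eval ![r, s, m] p₂ : ℕ) / √T₂ *
          κ₂ (M.compress F) covU T₂ ψA ρA (δ / 2)) := by
      by_contra hcon
      refine hB' ⟨?_, ?_⟩
      · rw [← M.compress_eq hη hF.1]
        exact (mul_le_mul_of_nonneg_left (heval p₁) (horacle.nonneg₁ _ _ _ _ _ _)).trans hκ
      · rw [← M.compress_eq hη hF.1]
        exact hcon
    obtain ⟨Ah, Bh, Ch, hE, S, hS, herr⟩ := exists_liftEstimate M hθ0 hθ hF hrec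
    refine ⟨Ah, Bh, Ch, hE, S, hS, herr.trans ?_⟩
    have hκ₂ := horacle.nonneg₂ (M.compress F) covU T₂ ψA ρA (δ / 2)
    have h3 : (MvPolynomial.eval ![r, s, m] p₂ : ℕ) / √T₂ *
          κ₂ (M.compress F) covU T₂ ψA ρA (δ / 2) ≤
        κ₂ (M.compress F) covU T₂ ψA ρA (δ / 2) *
          ((MvPolynomial.eval ![r, r, m] p₂ : ℕ) / √T₂) := by
      rw [mul_comm]
      exact mul_le_mul_of_nonneg_left
        (div_le_div_of_nonneg_right (heval p₂) (Real.sqrt_nonneg _)) hκ₂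
    have h4 : 0 ≤ κ₂ (M.compress F) covU T₂ ψA ρA (δ / 2) *
          ((MvPolynomial.eval ![r, r, m] p₂ : ℕ) / √T₂) := by positivity
    rw [hθdef]
    linarith
  · rw [← ENNReal.ofReal_add (by positivity) (by positivity), add_halves]

end LTISystem

end HDSysId

theorem theorem1 (δ₀ : ℝ) (hδ₀ : 0 < δ₀) (hδ₀' : δ₀ < Real.exp (-1)) :
    ∃ c₃ : ℝ, 0 < c₃ ∧ ∃ c : ℝ, 0 < c ∧
    ∀ p₁ p₂ : MvPolynomial (Fin 3) ℕ, ∃ q₁ q₂ : MvPolynomial (Fin 2) ℕ,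
    ∀ (est : HDSysId.Estimator) (κ₁ κ₂ : HDSysId.ProblemConst),
      HDSysId.IsSysIdOracle est κ₁ κ₂ p₁ p₂ →
    ∀ (r n m : ℕ) (M : HDSysId.LTISystem r n m) (covU : Matrix (Fin m) (Fin m) ℝ)
      (ση ψA ρA δ : ℝ) (T₁ T₂ : ℕ)
      (Φ : (Fin (T₁ + 1) → HDSysId.Vec n) → HDSysId.SubspaceBasis n),
      0 < r → r < n → M.IsMinimal → M.covW.PosSemidef →
      M.covEta = ση ^ 2 • (1 : Matrix (Fin n) (Fin n) ℝ) → covU.PosDef →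
      M.IsStableWith ψA ρA → 0 < δ → δ ≤ δ₀ → HDSysId.IsColApprox Φ →
      c₃ * M.kappa3 covU ψA ρA δ * n ^ 2 * r ^ 3 ≤ T₁ → 1 ≤ T₂ →
      ((M.dataLaw covU T₁).prod (M.dataLaw covU T₂))
        {D | κ₁ (M.compress (Φ D.1.1).2) covU T₂ ψA ρA (δ / 2) *
              (MvPolynomial.eval ![r, m] q₁ : ℕ) ≤ T₂ ∧
            ¬ ∃ Ah Bh Ch, HDSysId.colSysId Φ est (δ / 2) D.1 D.2 = ⟨r, Ah, Bh, Ch⟩ ∧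
              ∃ S : Matrix (Fin r) (Fin r) ℝ, IsUnit S ∧
                M.recoveryError S Ah Bh Ch ≤
                  c * (M.kappa4 covU δ * √(n / T₁) * ‖Ch‖ +
                    κ₂ (M.compress (Φ D.1.1).2) covU T₂ ψA ρA (δ / 2) *
                      √((MvPolynomial.eval ![r, m] q₂ : ℕ) / T₂)) ∧
                ∀ ε : ℝ, 0 < ε →
                  c * (M.kappa4 covU δ * ‖Ch‖) ^ 2 * n / ε ^ 2 ≤ T₁ →
                  c * κ₂ (M.compress (Φ D.1.1).2) covU T₂ ψA ρA (δ / 2) ^ 2 *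
                      (MvPolynomial.eval ![r, m] q₂ : ℕ) / ε ^ 2 ≤ T₂ →
                  M.recoveryError S Ah Bh Ch ≤ ε}
        ≤ ENNReal.ofReal δ := by
  have hL₀ : 1 < Real.log (1 / δ₀) := by
    rw [one_div, Real.log_inv, lt_neg]
    exact (Real.log_lt_iff_lt_exp hδ₀).2 hδ₀'
  have hℓ0 : 0 < Real.log (Real.log (1 / δ₀)) := Real.log_pos hL₀
  refine ⟨10 ^ 13 * (1 + 1 / Real.log (Real.log (1 / δ₀)) ^ 2), by positivity, 4 * 12200 ^ 2,
    by norm_num, fun p₁ p₂ => ⟨MvPolynomial.rename ![0, 0, 1] p₁,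
      MvPolynomial.rename ![0, 0, 1] p₂ ^ 2, ?_⟩⟩
  intro est κ₁ κ₂ horacle r n m M covU ση ψA ρA δ T₁ T₂ Φ hr hrn hmin hW hη hU hM hδ hδδ₀ hΦ hT₁ hT₂
  have hLδ : Real.log (1 / δ₀) ≤ Real.log (1 / δ) :=
    Real.log_le_log (by positivity) (one_div_le_one_div_of_le hδ hδδ₀)
  obtain ⟨hT₁0, hfail⟩ := M.measure_colSysId_failure_le horacle hr hrn hmin hW hη hU hM hδ
    (hL₀.le.trans hLδ) hℓ0 (Real.log_le_log (by linarith) hLδ) hΦ hT₁ hT₂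
  have hT₁r : (0 : ℝ) < T₁ := by exact_mod_cast hT₁0
  have hT₂r : (0 : ℝ) < T₂ := by exact_mod_cast hT₂
  refine (measure_mono ?_).trans hfail
  rintro ⟨D₁, D₂⟩ ⟨hκ, hbad⟩
  rw [HDSysId.eval_rename_diagonal] at hκ
  refine ⟨hκ, fun ⟨Ah, Bh, Ch, hE, S, hS, herr⟩ => hbad ⟨Ah, Bh, Ch, hE, S, hS, ?_⟩⟩
  have hκ₂ := horacle.nonneg₂ (M.compress (Φ D₁.1).2) covU T₂ ψA ρA (δ / 2)
  have hκ₄ := M.kappa4_nonneg covU δ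
  simp only at herr ⊢
  simp only [map_pow, HDSysId.eval_rename_diagonal, Nat.cast_pow]
  have hsqrt : √((MvPolynomial.eval ![r, r, m] p₂ : ℕ) ^ 2 / (T₂ : ℝ)) =
      (MvPolynomial.eval ![r, r, m] p₂ : ℕ) / √T₂ := by
    rw [Real.sqrt_div (by positivity), Real.sqrt_sq (by positivity)]
  rw [← hsqrt] at herr
  refine ⟨herr.trans ?_, fun ε hε h1 h2 => herr.trans ?_⟩
  · exact mul_le_mul_of_nonneg_right (by norm_num) (by positivity)
  · have h3 := HDSysId.mul_sqrt_div_le_half (c := 12200) n.cast_nonneg hT₁r hε h1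
    have h4 := HDSysId.mul_sqrt_div_le_half (c := 12200) (by positivity) hT₂r hε h2
    linarith
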